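/- Let $T,d\in\mathbb{N}$, let $(\Omega,\mathcal F,(\mathcal F_t)_{t=0,\dots,T},P)$ be a filtered probability space, let $S^j=(S^j_t)_{t=0,\dots,T}$, $j=1,\dots,d$, be real-valued adapted price processes, let $r=(r_t)_{t=1,\dots,T}$ be a nonnegative adapted interest rate process ($r_t$ being the rate between $t-1$ and $t$), and let $\alpha\in[0,1)$ be the tax rate. (In)equalities between random variables are understood almost surely, and $\langle\cdot,\cdot\rangle$ is the scalar product in $\mathbb{R}^d$. **Strategies.** Let $\mathcal N$ be the set of all families $N=(N_{i,t,j})_{0\le i\le T-1,\ i\le t\le T,\ 1\le j\le d}$ with $N_{i,t,j}\in L^0(\mathcal F_t;\mathbb{R}_+)$ and $N_{t,t,j}\ge N_{t,t+1,j}\ge\dots\ge N_{t,T,j}=0$ for $t=0,\dots,T-1$; here $N_{i,t,j}$ is the number of shares of asset $j$ bought at time $i$ and still held after trading at time $t$. Put $N_{i,t}:=(N_{i,t,1},\dots,N_{i,t,d})$ and $N_{T,T}:=0$. **Wealth with limited use of losses (LUL).** For $x\in\mathbb{R}$ and $N\in\mathcal N$ let $\eta=(\eta_t)_{t=0,\dots,T}$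 be the unique adapted process that satisfies $\eta_0=x-\langle N_{0,0},S_0\rangle$ and, for $t=1,\dots,T$, $$\eta_t-\eta_{t-1}=r_t\eta_{t-1}+\Big\langle \sum_{i=0}^{t-1}(N_{i,t-1}-N_{i,t})-N_{t,t},\,S_t\Big\rangle-(\Pi_t-\Pi_{t-1}),$$ where $$G_t:=\sum_{u=1}^t\Big(\eta_{u-1}r_u+\sum_{i=0}^{u-1}\langle N_{i,u-1}-N_{i,u},S_u-S_i\rangle\Big),\qquad \Pi_t:=\alpha\max_{u=0,\dots,t}G_u,\qquad G_0:=0 .$$ The terminal wealth is $V^\alpha(x,N):=\eta_T$. **Reaction functions.** Let $\widetilde\Omega:=\Omega\times\mathbb{R}_+^{dT(T+1)/2}$, where the second component has coordinates $y_{i,s,j}$ for $0\le i\le s\le T-1$, $1\le j\le d$. For $t=0,\dots,T-1$ let $\widetilde{\mathcal F}_t$ be the $\sigma$-algebra on $\widetilde\Omega$ that is the product of $\mathcal F_t$ and the $\sigma$-algebra generated by the coordinates $y_{i,s,j}$ with $s\le t$. A reaction function is a map $R=(R_{i,t,j})_{0\le i\le t\le T-1,\ 1\le j\le d}:\widetilde\Omega\to\mathbb{R}_+^{dT(T+1)/2}$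 such that every $R_{i,t,j}$ is $\widetilde{\mathcal F}_t$-measurable and $R_{i,t,j}\ge R_{i,t+1,j}$ for $t+1\le T-1$. For $N\in\mathcal N$ it yields the strategy $R(N)\in\mathcal N$ with $R_{i,t,j}(N)(\omega):=R_{i,t,j}\big(\omega,(N_{i',s,j'}(\omega))_{i'\le s\le T-1,\,j'}\big)$ for $t\le T-1$ and $R_{i,T,j}(N):=0$. **NUIBR.** A set $\mathcal M$ of real random variables is bounded in $L^0$ if $\sup_{X\in\mathcal M}P(|X|>a)\to0$ as $a\to\infty$. The market satisfies NUIBR (no unbounded non-substitutable investment with bounded risk) if for every $x\in\mathbb{R}$ there exists a reaction function $R$ such that $V^\alpha(x,R(N))\ge V^\alpha(x,N)$ a.s. for all $N\in\mathcal N$ and such that, for all $K\in\mathbb{R}_+$, the set $$\mathrm{conv}\Big\{\max_{i=0,\dots,T-1,\ j=1,\dots,d}R_{i,i,j}(N)\ :\ N\in\mathcal N,\ V^\alpha(x,N)\ge-K\ \text{a.s.}\Big\}$$ is bounded in $L^0$. **Theorem.** Assume that the market satisfies NUIBR, that the stock prices are nonnegative ($S^j_t\ge0$ a.s. for all $t$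 and $j$), and that the random variables $r_1,\dots,r_T$ are (essentially) bounded. Then, for every $x\in\mathbb{R}$, the set $$\mathcal V^\alpha(x):=\{V^\alpha(x,N):N\in\mathcal N\}-L^0(\mathcal F_T;\mathbb{R}_+)$$ is closed with respect to convergence in probability. -/

import Mathlib

open MeasureTheory Filter Topology
open scoped NNReal ENNReal

namespace TaxModel

/-- A discrete time market on the filtered probability space `(Ω, 𝓕, P)` with horizon `T`, `d` risky
assets, a bank account, and a constant tax rate. Only the dates `t ≤ T` matter: `price t j` is
`S^j_t` for `0 ≤ t ≤ T` and `rate t` is `r_t`, the interest rate between `t - 1` and `t`, for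
`1 ≤ t ≤ T`. -/
structure Market {Ω : Type*} [mΩ : MeasurableSpace Ω] (P : Measure Ω) (T d : ℕ) where
  filtration : Filtration ℕ mΩ
  price : ℕ → Fin d → Ω → ℝ
  price_adapted : ∀ t, t ≤ T → ∀ j, Measurable[filtration t] (price t j)
  rate : ℕ → Ω → ℝ
  rate_adapted : ∀ t, 1 ≤ t → t ≤ T → Measurable[filtration t] (rate t)
  rate_nonneg : ∀ t, 1 ≤ t → t ≤ T → ∀ᵐ ω ∂P, 0 ≤ rate t ω
  taxRate : ℝ
  taxRate_nonneg : 0 ≤ taxRate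
  taxRate_lt_one : taxRate < 1

/-- Nonnegative stock positions: `N i t j ω` is the number of shares of asset `j` bought at time `i`
and still in the portfolio after trading at time `t`. Only the entries with `i ≤ t ≤ T` matter. -/
abbrev Positions (Ω : Type*) (d : ℕ) : Type _ := ℕ → ℕ → Fin d → Ω → ℝ≥0

/-- The pairs `(i, t)` with `0 ≤ i ≤ t ≤ T - 1`; there are `T (T + 1) / 2` of them. -/
abbrev TradeIndex (T : ℕ) : Type := {p : ℕ × ℕ // p.1 ≤ p.2 ∧ p.2 < T}

/-- The space `ℝ_+^{T (T + 1) / 2 · d}` of all values of the positions `(N_{i,t,j})`,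
`0 ≤ i ≤ t ≤ T - 1`, with its product (that is, Borel) σ-algebra. -/
abbrev PositionSpace (T d : ℕ) : Type := TradeIndex T → Fin d → ℝ≥0

/-- The coordinates `(y_{i,s,j})` with `i ≤ s ≤ t` of a point of the position space. -/
def observed {T d : ℕ} (t : ℕ) (y : PositionSpace T d) :
    {p : TradeIndex T // p.1.2 ≤ t} → Fin d → ℝ≥0 :=
  fun p => y p.1

section Wealth

variable {Ω : Type*} [mΩ : MeasurableSpace Ω] {P : Measure Ω} {T d : ℕ}

/-- `N` is a trading strategy: `N_{i,t,j}` is `𝓕_t`-measurable, nonincreasing in `t`, and everything is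
liquidated at `T`. The case `i = T` in the last two fields only says that nothing is bought at `T`,
i.e. it is the convention `N_{T,T,j} = 0`. -/
structure IsStrategy (M : Market P T d) (N : Positions Ω d) : Prop where
  adapted : ∀ i t, i ≤ t → t ≤ T → ∀ j, Measurable[M.filtration t] (N i t j)
  antitone : ∀ i t, i ≤ t → t < T → ∀ j, ∀ᵐ ω ∂P, N i (t + 1) j ω ≤ N i t j ω
  liquidated : ∀ i, i ≤ T → ∀ j, ∀ᵐ ω ∂P, N i T j ω = 0

/-- Profits and losses from stock sales realized at time `u`:
`∑_{i < u} ⟨N_{i,u-1} - N_{i,u}, S_u - S_i⟩`. -/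
def stockGain (M : Market P T d) (N : Positions Ω d) (ω : Ω) (u : ℕ) : ℝ :=
  ∑ i ∈ Finset.range u, ∑ j : Fin d,
    ((N i (u - 1) j ω : ℝ) - N i u j ω) * (M.price u j ω - M.price i j ω)

/-- Net cash received from stock trades at time `t`:
`⟨∑_{i < t} (N_{i,t-1} - N_{i,t}) - N_{t,t}, S_t⟩`. -/
def tradeCash (M : Market P T d) (N : Positions Ω d) (ω : Ω) (t : ℕ) : ℝ :=
  ∑ j : Fin d,
    ((∑ i ∈ Finset.range t, ((N i (t - 1) j ω : ℝ) - N i t j ω)) - N t t j ω) * M.price t j ω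

/-- Accumulated realized profits and losses `G_t`, given the bank account process `η`. -/
def realizedGain (M : Market P T d) (N : Positions Ω d) (η : ℕ → ℝ) (ω : Ω) (t : ℕ) : ℝ :=
  ∑ u ∈ Finset.Icc 1 t, (η (u - 1) * M.rate u ω + stockGain M N ω u)

/-- Accumulated tax payments with limited use of losses: `Π_t = α max_{0 ≤ u ≤ t} G_u`. -/
def tax (M : Market P T d) (N : Positions Ω d) (η : ℕ → ℝ) (ω : Ω) (t : ℕ) : ℝ :=
  M.taxRate * (Finset.range (t + 1)).sup' Finset.nonempty_range_add_one
    (realizedGain M N η ω)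

/-- The self-financing condition on the path `ω` for the initial capital `x`. -/
def IsSelfFinancing (M : Market P T d) (x : ℝ) (N : Positions Ω d) (ω : Ω) (η : ℕ → ℝ) : Prop :=
  η 0 - x = tradeCash M N ω 0 ∧
  ∀ t, η (t + 1) - η t =
    M.rate (t + 1) ω * η t + tradeCash M N ω (t + 1) - (tax M N η ω (t + 1) - tax M N η ω t)

/-- The recursive construction of `(η_t, G_t, max_{u ≤ t} G_u)`. -/
def bankState (M : Market P T d) (x : ℝ) (N : Positions Ω d) (ω : Ω) : ℕ → ℝ × ℝ × ℝ
  | 0 => (x + tradeCash M N ω 0, 0, 0)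
  | t + 1 =>
    let s := bankState M x N ω t
    let g := s.2.1 + (s.1 * M.rate (t + 1) ω + stockGain M N ω (t + 1))
    (s.1 + M.rate (t + 1) ω * s.1 + tradeCash M N ω (t + 1)
      - M.taxRate * (max s.2.2 g - s.2.2), g, max s.2.2 g)

/-- `η_t(x, N)`, the number of monetary units on the bank account after paying taxes and trading at
time `t`. It is the unique self-financing one, see `isSelfFinancing_iff`. -/
def bank (M : Market P T d) (x : ℝ) (N : Positions Ω d) (ω : Ω) (t : ℕ) : ℝ :=
  (bankState M x N ω t).1

/-- The terminal wealth `V^α(x, N) = η_T`. -/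
def terminalWealth (M : Market P T d) (x : ℝ) (N : Positions Ω d) (ω : Ω) : ℝ :=
  bank M x N ω T

/-- `𝒱^α(x) = {V^α(x, N) : N a strategy} - L^0(𝓕_T; ℝ_+)`. -/
def attainable (M : Market P T d) (x : ℝ) : Set (Ω →ₘ[P] ℝ) :=
  {f | ∃ N : Positions Ω d, IsStrategy M N ∧ ∃ Y : Ω → ℝ≥0, Measurable[M.filtration T] Y ∧
    ∀ᵐ ω ∂P, f ω = terminalWealth M x N ω - Y ω}

/-- The σ-algebra `𝓕_t ⊗ B(ℝ_+^{(t+1)(t+2)/2 · d}) ⊗ {∅, everything}` on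
`Ω × ℝ_+^{T (T + 1) / 2 · d}`. -/
@[reducible]
def reactionSigma (M : Market P T d) (t : ℕ) : MeasurableSpace (Ω × PositionSpace T d) :=
  (M.filtration t).prod (MeasurableSpace.comap (observed t) inferInstance)

/-- A reaction function: the value `R_{i,t,j}` is nonnegative, nonincreasing in `t`, and depends only on
the information at time `t` and on the positions up to time `t`. -/
structure ReactionFunction (M : Market P T d) where
  toFun : Ω × PositionSpace T d → PositionSpace T d
  measurable_coord : ∀ (p : TradeIndex T) (j : Fin d),
    Measurable[reactionSigma M p.1.2] fun z => toFun z p j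
  antitone : ∀ z (p q : TradeIndex T), p.1.1 = q.1.1 → p.1.2 ≤ q.1.2 →
    ∀ j, toFun z q j ≤ toFun z p j

/-- The values `(N_{i,t,j}(ω))_{0 ≤ i ≤ t ≤ T - 1}` of the positions in the state `ω`. -/
def positionsAt (T : ℕ) (N : Positions Ω d) (ω : Ω) : PositionSpace T d :=
  fun p j => N p.1.1 p.1.2 j ω

open Classical in
/-- The strategy `R(N)`. By measurability, `R_{i,t,j}` does not depend on the positions after `t`, so
that it can be evaluated at all positions `N(ω)`. -/
noncomputable def ReactionFunction.apply {M : Market P T d} (R : ReactionFunction M)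
    (N : Positions Ω d) : Positions Ω d :=
  fun i t j ω => if h : i ≤ t ∧ t < T then R.toFun (ω, positionsAt T N ω) ⟨(i, t), h⟩ j else 0

/-- `max_{0 ≤ i ≤ T - 1, 1 ≤ j ≤ d} N_{i,i,j}`, the maximal number of shares that are purchased. -/
def maxPurchase (T : ℕ) (N : Positions Ω d) (ω : Ω) : ℝ≥0 :=
  (Finset.range T ×ˢ (Finset.univ : Finset (Fin d))).sup fun p => N p.1 p.1 p.2 ω

/-- Boundedness in `L^0`: `sup_{X ∈ A} P(|X| > a) → 0` as `a → ∞`. -/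
def IsBoundedInProbability (P : Measure Ω) (A : Set (Ω → ℝ)) : Prop :=
  Tendsto (fun a : ℝ => ⨆ X ∈ A, P {ω | a < |X ω|}) atTop (𝓝 0)

/-- No unbounded non-substitutable investment with bounded risk (NUIBR). -/
def NUIBR (M : Market P T d) : Prop :=
  ∀ x : ℝ, ∃ R : ReactionFunction M,
    (∀ N, IsStrategy M N →
      ∀ᵐ ω ∂P, terminalWealth M x N ω ≤ terminalWealth M x (R.apply N) ω) ∧
    ∀ K : ℝ, 0 ≤ K → IsBoundedInProbability P (convexHull ℝ
      {X : Ω → ℝ | ∃ N, IsStrategy M N ∧ (∀ᵐ ω ∂P, -K ≤ terminalWealth M x N ω) ∧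
        X = fun ω => (maxPurchase T (R.apply N) ω : ℝ)})

/-- Closedness with respect to convergence in probability. As this convergence is induced by a metric
on `L^0`, closed and sequentially closed sets coincide. -/
def IsClosedInProbability (A : Set (Ω →ₘ[P] ℝ)) : Prop :=
  ∀ (f : ℕ → Ω →ₘ[P] ℝ) (g : Ω →ₘ[P] ℝ), (∀ n, f n ∈ A) →
    TendstoInMeasure P (fun n => (f n : Ω → ℝ)) atTop g → g ∈ A

/-- The recursion indeed produces the unique self-financing bank account process. -/
theorem isSelfFinancing_iff (M : Market P T d) (x : ℝ) (N : Positions Ω d) (ω : Ω) (η : ℕ → ℝ) :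
    IsSelfFinancing M x N ω η ↔ η = bank M x N ω := by
  have tax_succ : ∀ (η : ℕ → ℝ) t, tax M N η ω (t + 1) - tax M N η ω t =
      M.taxRate * (max ((Finset.range (t + 1)).sup' Finset.nonempty_range_add_one
        (realizedGain M N η ω)) (realizedGain M N η ω (t + 1)) -
        (Finset.range (t + 1)).sup' Finset.nonempty_range_add_one (realizedGain M N η ω)) := by
    intro η t
    have h : (Finset.range (t + 1 + 1)).sup' Finset.nonempty_range_add_one
        (realizedGain M N η ω) = max ((Finset.range (t + 1)).sup' Finset.nonempty_range_add_one
        (realizedGain M N η ω)) (realizedGain M N η ω (t + 1)) := by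
      apply le_antisymm
      · refine Finset.sup'_le _ _ fun u hu => ?_
        rcases Nat.lt_succ_iff_lt_or_eq.mp (Finset.mem_range.mp hu) with h | h
        · exact le_max_of_le_left (Finset.le_sup' _ (Finset.mem_range.mpr h))
        · subst h; exact le_max_right _ _
      · refine max_le (Finset.sup'_le _ _ fun u hu => ?_) (Finset.le_sup' _ (by simp))
        exact Finset.le_sup' _ (by simp at hu ⊢; omega)
    rw [tax, tax, h]; ring
  have gain_succ : ∀ (η : ℕ → ℝ) t, realizedGain M N η ω (t + 1) = realizedGain M N η ω t +
      (η t * M.rate (t + 1) ω + stockGain M N ω (t + 1)) := by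
    intro η t
    rw [realizedGain, Finset.sum_Icc_succ_top (by omega)]; rfl
  have key : ∀ (η : ℕ → ℝ) t, (∀ s ≤ t, η s = bank M x N ω s) →
      realizedGain M N η ω t = (bankState M x N ω t).2.1 ∧
      (Finset.range (t + 1)).sup' Finset.nonempty_range_add_one (realizedGain M N η ω) =
        (bankState M x N ω t).2.2 ∧
      realizedGain M N η ω (t + 1) = (bankState M x N ω (t + 1)).2.1 := by
    intro η t
    induction t with
    | zero =>
      intro h
      have h0 := h 0 le_rfl
      refine ⟨by simp [realizedGain, bankState], by simp [realizedGain, bankState], ?_⟩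
      rw [gain_succ, h0]; simp [realizedGain, bankState, bank]
    | succ t ih =>
      intro h
      obtain ⟨h1, h2, h3⟩ := ih fun s hs => h s (by omega)
      refine ⟨h3, ?_, ?_⟩
      · apply le_antisymm
        · refine Finset.sup'_le _ _ fun u hu => ?_
          have e : (bankState M x N ω (t + 1)).2.2 =
            max (bankState M x N ω t).2.2 (bankState M x N ω (t + 1)).2.1 := rfl
          rw [e, ← h2, ← h3]
          rcases Nat.lt_succ_iff_lt_or_eq.mp (Finset.mem_range.mp hu) with h | h
          · exact le_max_of_le_left (Finset.le_sup' _ (Finset.mem_range.mpr h))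
          · subst h; exact le_max_right _ _
        · have e : (bankState M x N ω (t + 1)).2.2 =
            max (bankState M x N ω t).2.2 (bankState M x N ω (t + 1)).2.1 := rfl
          rw [e, ← h2, ← h3]
          refine max_le (Finset.sup'_le _ _ fun u hu => ?_) (Finset.le_sup' _ (by simp))
          exact Finset.le_sup' _ (by simp at hu ⊢; omega)
      · rw [gain_succ, h (t + 1) le_rfl, h3]; rfl
  have step : ∀ (η : ℕ → ℝ) t, (∀ s ≤ t, η s = bank M x N ω s) →
      bank M x N ω (t + 1) = η t + (M.rate (t + 1) ω * η t + tradeCash M N ω (t + 1) -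
        (tax M N η ω (t + 1) - tax M N η ω t)) := by
    intro η t h
    obtain ⟨_, h2, h3⟩ := key η t h
    rw [tax_succ, h2, h3, h t le_rfl]
    simp only [bank, bankState]; ring
  constructor
  · rintro ⟨h0, hs⟩
    funext t
    induction t using Nat.strong_induction_on with
    | _ t ih =>
      cases t with
      | zero => simp only [bank, bankState]; linarith
      | succ t =>
        rw [step η t fun s h => ih s (by omega)]
        linarith [hs t]
  · rintro rfl
    refine ⟨by simp [bank, bankState], fun t => ?_⟩
    linarith [step (bank M x N ω) t fun _ _ => rfl]

/-- A reaction function turns strategies into strategies. -/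
theorem IsStrategy.reaction {M : Market P T d} (R : ReactionFunction M) {N : Positions Ω d}
    (hN : IsStrategy M N) : IsStrategy M (R.apply N) where
  adapted i t hit _ j := by
    by_cases h : i ≤ t ∧ t < T
    · have e : R.apply N i t j =
          fun ω => R.toFun (ω, positionsAt T N ω) ⟨(i, t), h⟩ j := by
        funext ω; simp [ReactionFunction.apply, h]
      rw [e]
      have hm : Measurable[M.filtration t, reactionSigma M t]
          fun ω => (ω, positionsAt T N ω) := by
        refine @Measurable.prodMk _ (M.filtration t) _ _ (M.filtration t)
          (MeasurableSpace.comap (observed t) inferInstance) _ _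
          (@measurable_id _ (M.filtration t)) ?_
        rw [measurable_comap_iff]
        refine @measurable_pi_lambda _ _ _ (M.filtration t) _ _ fun p => ?_
        refine @measurable_pi_lambda _ _ _ (M.filtration t) _ _ fun j => ?_
        exact (hN.adapted p.1.1.1 p.1.1.2 p.1.2.1 p.1.2.2.le j).mono
          (M.filtration.mono p.2) le_rfl
      exact (R.measurable_coord ⟨(i, t), h⟩ j).comp hm
    · have e : R.apply N i t j = fun _ => 0 := by
        funext ω; simp only [ReactionFunction.apply, dif_neg h]
      rw [e]; exact measurable_const
  antitone i t hit htT j := ae_of_all _ fun ω => by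
    by_cases h : t + 1 < T
    · have h1 : i ≤ t + 1 ∧ t + 1 < T := ⟨by omega, h⟩
      have h2 : i ≤ t ∧ t < T := ⟨hit, htT⟩
      simp only [ReactionFunction.apply, dif_pos h1, dif_pos h2]
      exact R.antitone _ ⟨(i, t), h2⟩ ⟨(i, t + 1), h1⟩ rfl (Nat.le_succ t) j
    · have h1 : ¬ (i ≤ t + 1 ∧ t + 1 < T) := by omega
      simp only [ReactionFunction.apply, dif_neg h1]
      exact zero_le
  liquidated i _ j := ae_of_all _ fun ω => by
    have h1 : ¬ (i ≤ T ∧ T < T) := by omega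
    simp only [ReactionFunction.apply, dif_neg h1]

end Wealth

end TaxModel

set_option linter.unusedSectionVars false

namespace TaxModel

variable {Ω : Type*} [mΩ : MeasurableSpace Ω] {P : Measure Ω} {T d : ℕ}

/-! ### Pathwise properties of the wealth recursion -/

/-! The proof is a backward induction over the dates. The induction statement `Attains` at time `t`
says that whatever can be dominated up to small errors by continuations of `N` from `t` on is
dominated exactly by one strategy whose past is a fixed number of reactions to `N`. Changing the
past is harmless: reactions never lower wealth, and being non-anticipating they keep a common past
common. At `T` nothing is left to decide, and at `0` there is no past, so `Attains` at `0` turns a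
limit in probability into a random variable dominated by an attainable wealth.

Three pathwise facts about the tax recursion are used: wealth is superlinear in capital and
positions (`bank_superlinear`), so convex combinations and pooling do no harm; it is Lipschitz on
each path (`abs_bank_sub_le`), so limits of positions give limits of wealth; and with nonnegative
prices and bounded rates debts grow at most by a constant factor once purchases stop
(`bank_ge_of_no_purchase`), so risk can be bounded by cancelling later purchases.

For the step from `t + 1` to `t`, take continuations whose wealth asymptotically dominates `f`.
Shares bought earlier are bounded by the common past; only the purchases at `t` may explode. Where
they stay bounded, forward convex combinations converge (`exists_convexHull_cauchySeq_exp`,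
`exists_limit_of_bounded`). Where they explode, the normalized purchases have a limit `w` that can
be bought without capital and almost without loss, a null direction
(`IsDominatingSeq.exists_nullDirection`). Subtracting from each purchase the largest multiple of `w`
makes a further coordinate vanish, so after at most `d` rounds the remaining purchases are bounded
(`exists_nearlyDominated_of_isDominatingSeq`).

The subtracted multiples are collected in a cone and must finally be put back, although they are
unbounded. Here NUIBR enters (`IsAttainableCone.adjoin`). Adding `n` times `w` does not worsen what
can be dominated, so these strategies share a lower bound. After cancelling purchases on events of
large debts, the induction hypothesis at `t + 1` yields genuine strategies with uniformly bounded
risk, and NUIBR bounds the convex hull of the reactions to them in probability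
(`exists_safe_of_attains`). Hence convex combinations of reactions cannot escape to infinity, and
their limit replaces all multiples of `w` at once (`exists_limit_of_attains`). -/

theorem tradeCash_congr (M : Market P T d) {N N' : Positions Ω d} {ω : Ω} {t : ℕ}
    (h : ∀ i s j, i ≤ s → s ≤ t → N i s j ω = N' i s j ω) :
    tradeCash M N ω t = tradeCash M N' ω t := by
  unfold tradeCash
  refine Finset.sum_congr rfl fun j _ => ?_
  rw [h t t j le_rfl le_rfl]
  congr 2
  refine Finset.sum_congr rfl fun i hi => ?_
  have hi := Finset.mem_range.mp hi
  rw [h i (t - 1) j (by omega) (by omega), h i t j hi.le le_rfl]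

theorem stockGain_congr (M : Market P T d) {N N' : Positions Ω d} {ω : Ω} {t : ℕ}
    (h : ∀ i s j, i ≤ s → s ≤ t → N i s j ω = N' i s j ω) :
    stockGain M N ω t = stockGain M N' ω t := by
  unfold stockGain
  refine Finset.sum_congr rfl fun i hi => Finset.sum_congr rfl fun j _ => ?_
  have hi := Finset.mem_range.mp hi
  rw [h i (t - 1) j (by omega) (by omega), h i t j hi.le le_rfl]

theorem bankState_congr (M : Market P T d) (x : ℝ) {N N' : Positions Ω d} {ω : Ω} {t : ℕ}
    (h : ∀ i s j, i ≤ s → s ≤ t → N i s j ω = N' i s j ω) :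
    bankState M x N ω t = bankState M x N' ω t := by
  induction t with
  | zero => simp only [bankState, tradeCash_congr M h]
  | succ t ih =>
    simp only [bankState, tradeCash_congr M h, stockGain_congr M h,
      ih fun i s j his hst => h i s j his (by omega)]

theorem tradeCash_combo (M : Market P T d) {N N' N'' : Positions Ω d} {ω : Ω} {a b : ℝ} {t : ℕ}
    (h : ∀ i s j, i ≤ s → s ≤ t → (N'' i s j ω : ℝ) = a * N i s j ω + b * N' i s j ω) :
    tradeCash M N'' ω t = a * tradeCash M N ω t + b * tradeCash M N' ω t := by
  unfold tradeCash
  rw [Finset.mul_sum, Finset.mul_sum, ← Finset.sum_add_distrib]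
  refine Finset.sum_congr rfl fun j _ => ?_
  have e : ∑ i ∈ Finset.range t, ((N'' i (t - 1) j ω : ℝ) - N'' i t j ω) =
      a * ∑ i ∈ Finset.range t, ((N i (t - 1) j ω : ℝ) - N i t j ω) +
      b * ∑ i ∈ Finset.range t, ((N' i (t - 1) j ω : ℝ) - N' i t j ω) := by
    rw [Finset.mul_sum, Finset.mul_sum, ← Finset.sum_add_distrib]
    refine Finset.sum_congr rfl fun i hi => ?_
    have hi := Finset.mem_range.mp hi
    rw [h i (t - 1) j (by omega) (by omega), h i t j hi.le le_rfl]; ring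
  rw [e, h t t j le_rfl le_rfl]; ring

theorem stockGain_combo (M : Market P T d) {N N' N'' : Positions Ω d} {ω : Ω} {a b : ℝ} {t : ℕ}
    (h : ∀ i s j, i ≤ s → s ≤ t → (N'' i s j ω : ℝ) = a * N i s j ω + b * N' i s j ω) :
    stockGain M N'' ω t = a * stockGain M N ω t + b * stockGain M N' ω t := by
  unfold stockGain
  rw [Finset.mul_sum, Finset.mul_sum, ← Finset.sum_add_distrib]
  refine Finset.sum_congr rfl fun i hi => ?_
  rw [Finset.mul_sum, Finset.mul_sum, ← Finset.sum_add_distrib]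
  refine Finset.sum_congr rfl fun j _ => ?_
  have hi := Finset.mem_range.mp hi
  rw [h i (t - 1) j (by omega) (by omega), h i t j hi.le le_rfl]; ring

/-- Pooling two portfolios never reduces wealth, because losses of one portfolio can be offset
against gains of the other one. -/
theorem bank_superlinear (M : Market P T d) {N N' N'' : Positions Ω d} {ω : Ω} {a b x x' : ℝ}
    (ha : 0 ≤ a) (hb : 0 ≤ b) (hr : ∀ t, 1 ≤ t → t ≤ T → 0 ≤ M.rate t ω) {t : ℕ} (ht : t ≤ T)
    (h : ∀ i s j, i ≤ s → s ≤ t → (N'' i s j ω : ℝ) = a * N i s j ω + b * N' i s j ω) :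
    a * bank M x N ω t + b * bank M x' N' ω t ≤ bank M (a * x + b * x') N'' ω t := by
  -- `Γ` and `μ` are the excesses of the pooled accumulated gain and of its running maximum. The
  -- pooled wealth exceeds the combination by `Γ - αμ`, and `μ ≤ Γ` with `Γ ≥ 0` makes this at least
  -- `(1 - α)Γ ≥ 0`.
  suffices H : ∃ Γ μ : ℝ, 0 ≤ Γ ∧ μ ≤ Γ ∧
      (bankState M (a * x + b * x') N'' ω t).2.1 =
        a * (bankState M x N ω t).2.1 + b * (bankState M x' N' ω t).2.1 + Γ ∧
      (bankState M (a * x + b * x') N'' ω t).2.2 =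
        a * (bankState M x N ω t).2.2 + b * (bankState M x' N' ω t).2.2 + μ ∧
      (bankState M (a * x + b * x') N'' ω t).1 =
        a * (bankState M x N ω t).1 + b * (bankState M x' N' ω t).1 + (Γ - M.taxRate * μ) by
    obtain ⟨Γ, μ, h0, h1, -, -, h2⟩ := H
    simp only [bank]
    rw [h2]
    nlinarith [mul_le_mul_of_nonneg_left h1 M.taxRate_nonneg, M.taxRate_lt_one,
      mul_le_mul_of_nonneg_right M.taxRate_lt_one.le h0]
  induction t with
  | zero =>
    refine ⟨0, 0, le_rfl, le_rfl, ?_, ?_, ?_⟩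
    · simp [bankState]
    · simp [bankState]
    · simp only [bankState, tradeCash_combo M h]; ring
  | succ t ih =>
    obtain ⟨Γ, μ, h0, h1, hG, hM, hη⟩ := ih (by omega) fun i s j his hst => h i s j his (by omega)
    have hD : 0 ≤ Γ - M.taxRate * μ := by
      nlinarith [mul_le_mul_of_nonneg_left h1 M.taxRate_nonneg, M.taxRate_lt_one,
        mul_le_mul_of_nonneg_right M.taxRate_lt_one.le h0]
    have hr' := hr (t + 1) (by omega) ht
    simp only [bankState, tradeCash_combo M h, stockGain_combo M h]
    set s := bankState M x N ω t
    set s' := bankState M x' N' ω t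
    set s'' := bankState M (a * x + b * x') N'' ω t
    set r := M.rate (t + 1) ω
    set k := stockGain M N ω (t + 1)
    set k' := stockGain M N' ω (t + 1)
    have hΓ : 0 ≤ (Γ - M.taxRate * μ) * r := mul_nonneg hD hr'
    -- Stock gains combine linearly, so the gain excess grows only by interest on the excess wealth.
    -- The second witness is the difference of the maxima; it stays below the first because the
    -- maximum is sublinear.
    refine ⟨Γ + (Γ - M.taxRate * μ) * r,
      max s''.2.2 (s''.2.1 + (s''.1 * r + (a * k + b * k'))) -
      (a * max s.2.2 (s.2.1 + (s.1 * r + k)) + b * max s'.2.2 (s'.2.1 + (s'.1 * r + k'))),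
      by linarith, ?_, ?_, by ring, ?_⟩
    · rw [sub_le_iff_le_add]
      have e1 := mul_le_mul_of_nonneg_left (le_max_left s.2.2 (s.2.1 + (s.1 * r + k))) ha
      have e2 := mul_le_mul_of_nonneg_left (le_max_right s.2.2 (s.2.1 + (s.1 * r + k))) ha
      have e3 := mul_le_mul_of_nonneg_left (le_max_left s'.2.2 (s'.2.1 + (s'.1 * r + k'))) hb
      have e4 := mul_le_mul_of_nonneg_left (le_max_right s'.2.2 (s'.2.1 + (s'.1 * r + k'))) hb
      refine max_le ?_ ?_
      · rw [hM]; linarith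
      · rw [hG, hη]; linarith
    · rw [hG, hη]; ring
    · rw [hη]
      have := hM
      linear_combination M.taxRate * hM + 0 * this

theorem abs_tradeCash_sub_le (M : Market P T d) (ω : Ω) (t : ℕ) :
    ∃ C : ℝ, 0 ≤ C ∧ ∀ (N N' : Positions Ω d) (δ : ℝ),
      (∀ i s j, i ≤ s → s ≤ t → |(N i s j ω : ℝ) - N' i s j ω| ≤ δ) →
      |tradeCash M N ω t - tradeCash M N' ω t| ≤ C * δ := by
  refine ⟨∑ j : Fin d, (∑ _i ∈ Finset.range t, 2 + 1) * |M.price t j ω|,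
    Finset.sum_nonneg fun j _ => by positivity, fun N N' δ h => ?_⟩
  unfold tradeCash
  rw [← Finset.sum_sub_distrib, Finset.sum_mul]
  refine (Finset.abs_sum_le_sum_abs _ _).trans (Finset.sum_le_sum fun j _ => ?_)
  rw [← sub_mul, abs_mul, mul_right_comm]
  refine mul_le_mul_of_nonneg_right ?_ (abs_nonneg _)
  rw [sub_sub_sub_comm, ← Finset.sum_sub_distrib, add_mul, one_mul, Finset.sum_mul]
  refine (abs_sub _ _).trans (add_le_add ((Finset.abs_sum_le_sum_abs _ _).trans
    (Finset.sum_le_sum fun i hi => ?_)) (h t t j le_rfl le_rfl))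
  have hi := Finset.mem_range.mp hi
  have h1 := h i (t - 1) j (by omega) (by omega)
  have h2 := h i t j hi.le le_rfl
  rw [sub_sub_sub_comm]
  linarith [abs_sub ((N i (t - 1) j ω : ℝ) - N' i (t - 1) j ω) ((N i t j ω : ℝ) - N' i t j ω)]

theorem abs_stockGain_sub_le (M : Market P T d) (ω : Ω) (t : ℕ) :
    ∃ C : ℝ, 0 ≤ C ∧ ∀ (N N' : Positions Ω d) (δ : ℝ),
      (∀ i s j, i ≤ s → s ≤ t → |(N i s j ω : ℝ) - N' i s j ω| ≤ δ) →
      |stockGain M N ω t - stockGain M N' ω t| ≤ C * δ := by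
  refine ⟨∑ i ∈ Finset.range t, ∑ j : Fin d, 2 * |M.price t j ω - M.price i j ω|,
    Finset.sum_nonneg fun i _ => Finset.sum_nonneg fun j _ => by positivity, fun N N' δ h => ?_⟩
  unfold stockGain
  rw [← Finset.sum_sub_distrib, Finset.sum_mul]
  refine (Finset.abs_sum_le_sum_abs _ _).trans (Finset.sum_le_sum fun i hi => ?_)
  rw [← Finset.sum_sub_distrib, Finset.sum_mul]
  refine (Finset.abs_sum_le_sum_abs _ _).trans (Finset.sum_le_sum fun j _ => ?_)
  rw [← sub_mul, abs_mul, mul_right_comm]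
  refine mul_le_mul_of_nonneg_right ?_ (abs_nonneg _)
  have hi := Finset.mem_range.mp hi
  have h1 := h i (t - 1) j (by omega) (by omega)
  have h2 := h i t j hi.le le_rfl
  rw [sub_sub_sub_comm]
  linarith [abs_sub ((N i (t - 1) j ω : ℝ) - N' i (t - 1) j ω) ((N i t j ω : ℝ) - N' i t j ω)]

/-- On a fixed path, wealth is Lipschitz continuous in the initial capital and the positions. -/
theorem abs_bank_sub_le (M : Market P T d) (ω : Ω) (t : ℕ) :
    ∃ C : ℝ, 0 ≤ C ∧ ∀ (N N' : Positions Ω d) (x x' δ : ℝ), |x - x'| ≤ δ →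
      (∀ i s j, i ≤ s → s ≤ t → |(N i s j ω : ℝ) - N' i s j ω| ≤ δ) →
      |bank M x N ω t - bank M x' N' ω t| ≤ C * δ := by
  -- Account, gain and running maximum feed into each other, so all three need the estimate
  -- simultaneously.
  suffices H : ∃ C : ℝ, 0 ≤ C ∧ ∀ (N N' : Positions Ω d) (x x' δ : ℝ), |x - x'| ≤ δ →
      (∀ i s j, i ≤ s → s ≤ t → |(N i s j ω : ℝ) - N' i s j ω| ≤ δ) →
      |(bankState M x N ω t).1 - (bankState M x' N' ω t).1| ≤ C * δ ∧
      |(bankState M x N ω t).2.1 - (bankState M x' N' ω t).2.1| ≤ C * δ ∧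
      |(bankState M x N ω t).2.2 - (bankState M x' N' ω t).2.2| ≤ C * δ by
    obtain ⟨C, h0, h⟩ := H
    exact ⟨C, h0, fun N N' x x' δ hx hN => (h N N' x x' δ hx hN).1⟩
  induction t with
  | zero =>
    obtain ⟨C, h0, h⟩ := abs_tradeCash_sub_le M ω 0
    refine ⟨C + 1, by linarith, fun N N' x x' δ hx hN => ?_⟩
    have hδ : 0 ≤ δ := (abs_nonneg _).trans hx
    have h1 := h N N' δ hN
    refine ⟨?_, by simpa [bankState] using by positivity, by simpa [bankState] using by positivity⟩
    simp only [bankState]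
    rw [add_sub_add_comm]
    linarith [abs_add_le (x - x') (tradeCash M N ω 0 - tradeCash M N' ω 0)]
  | succ t ih =>
    obtain ⟨C, h0, h⟩ := ih
    obtain ⟨C1, h01, h1⟩ := abs_tradeCash_sub_le M ω (t + 1)
    obtain ⟨C2, h02, h2⟩ := abs_stockGain_sub_le M ω (t + 1)
    set r := M.rate (t + 1) ω with hr
    set D := C + (C * |r| + C2) with hD
    have hD0 : C ≤ D := by
      have : 0 ≤ C * |r| + C2 := by positivity
      linarith
    refine ⟨C + |r| * C + C1 + M.taxRate * (D + C) + D, by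
      have := M.taxRate_nonneg; positivity, fun N N' x x' δ hx hN => ?_⟩
    have hδ : 0 ≤ δ := (abs_nonneg _).trans hx
    obtain ⟨a1, a2, a3⟩ := h N N' x x' δ hx fun i s j his hst => hN i s j his (by omega)
    have b1 := h1 N N' δ hN
    have b2 := h2 N N' δ hN
    simp only [bankState]
    set s := bankState M x N ω t
    set s' := bankState M x' N' ω t
    set k := stockGain M N ω (t + 1)
    set k' := stockGain M N' ω (t + 1)
    rw [← hr]
    have g : |s.2.1 + (s.1 * r + k) - (s'.2.1 + (s'.1 * r + k'))| ≤ D * δ := by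
      have e : s.2.1 + (s.1 * r + k) - (s'.2.1 + (s'.1 * r + k')) =
        (s.2.1 - s'.2.1) + ((s.1 - s'.1) * r + (k - k')) := by ring
      rw [e]
      refine (abs_add_le _ _).trans ?_
      have e2 := abs_add_le ((s.1 - s'.1) * r) (k - k')
      rw [abs_mul] at e2
      have e3 := mul_le_mul_of_nonneg_right a1 (abs_nonneg r)
      rw [hD]; nlinarith
    have m : |max s.2.2 (s.2.1 + (s.1 * r + k)) - max s'.2.2 (s'.2.1 + (s'.1 * r + k'))| ≤
        D * δ :=
      (abs_max_sub_max_le_max _ _ _ _).trans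
        (max_le (a3.trans (mul_le_mul_of_nonneg_right hD0 hδ)) g)
    have hα := M.taxRate_nonneg
    have hrest : 0 ≤ C + |r| * C + C1 + M.taxRate * (D + C) := by positivity
    have hle : D * δ ≤ (C + |r| * C + C1 + M.taxRate * (D + C) + D) * δ :=
      mul_le_mul_of_nonneg_right (by linarith) hδ
    refine ⟨?_, g.trans hle, m.trans hle⟩
    set m1 := max s.2.2 (s.2.1 + (s.1 * r + k))
    set m2 := max s'.2.2 (s'.2.1 + (s'.1 * r + k'))
    have e : s.1 + r * s.1 + tradeCash M N ω (t + 1) - M.taxRate * (m1 - s.2.2) -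
        (s'.1 + r * s'.1 + tradeCash M N' ω (t + 1) - M.taxRate * (m2 - s'.2.2)) =
        (s.1 - s'.1) + (r * (s.1 - s'.1) + ((tradeCash M N ω (t + 1) - tradeCash M N' ω (t + 1)) -
          M.taxRate * ((m1 - m2) - (s.2.2 - s'.2.2)))) := by ring
    rw [e]
    have f1 := abs_add_le (s.1 - s'.1) (r * (s.1 - s'.1) +
      ((tradeCash M N ω (t + 1) - tradeCash M N' ω (t + 1)) -
          M.taxRate * ((m1 - m2) - (s.2.2 - s'.2.2))))
    have f2 := abs_add_le (r * (s.1 - s'.1))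
      ((tradeCash M N ω (t + 1) - tradeCash M N' ω (t + 1)) -
          M.taxRate * ((m1 - m2) - (s.2.2 - s'.2.2)))
    have f3 := abs_sub (tradeCash M N ω (t + 1) - tradeCash M N' ω (t + 1))
          (M.taxRate * ((m1 - m2) - (s.2.2 - s'.2.2)))
    rw [abs_mul] at f2
    rw [abs_mul, abs_of_nonneg hα] at f3
    have f4 := abs_sub (m1 - m2) (s.2.2 - s'.2.2)
    have f5 := mul_le_mul_of_nonneg_left a1 (abs_nonneg r)
    have f6 : M.taxRate * |m1 - m2 - (s.2.2 - s'.2.2)| ≤ M.taxRate * (D * δ + C * δ) :=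
      mul_le_mul_of_nonneg_left (by linarith) hα
    have hDδ : 0 ≤ D * δ := by positivity
    nlinarith

/-- Without a purchase at time `t + 1`, the debts grow at most by the interest. -/
theorem bank_succ_ge (M : Market P T d) {N : Positions Ω d} {ω : Ω} {x C : ℝ} {t : ℕ}
    (hr : 0 ≤ M.rate (t + 1) ω) (hC : M.rate (t + 1) ω ≤ C)
    (hS : ∀ s j, s ≤ t + 1 → 0 ≤ M.price s j ω)
    (hN : ∀ i j, i ≤ t → N i (t + 1) j ω ≤ N i t j ω) (hbuy : ∀ j, N (t + 1) (t + 1) j ω = 0)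
    {K : ℝ} (hK : 0 ≤ K) (hb : -K ≤ bank M x N ω t) :
    -((1 + C) * K) ≤ bank M x N ω (t + 1) := by
  -- Only sales occur. Their proceeds are nonnegative and, as purchase prices are nonnegative, at
  -- least as large as the realized gains.
  have hcash : 0 ≤ tradeCash M N ω (t + 1) ∧
      stockGain M N ω (t + 1) ≤ tradeCash M N ω (t + 1) := by
    have e : tradeCash M N ω (t + 1) = ∑ i ∈ Finset.range (t + 1), ∑ j : Fin d,
        ((N i t j ω : ℝ) - N i (t + 1) j ω) * M.price (t + 1) j ω := by
      unfold tradeCash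
      rw [Finset.sum_comm]
      refine Finset.sum_congr rfl fun j _ => ?_
      rw [hbuy j, ← Finset.sum_mul]
      simp
    have hd : ∀ i ∈ Finset.range (t + 1), ∀ j, 0 ≤ (N i t j ω : ℝ) - N i (t + 1) j ω := by
      intro i hi j
      have := hN i j (by simpa [Nat.lt_succ_iff] using hi)
      exact sub_nonneg.mpr (by exact_mod_cast this)
    rw [e]
    refine ⟨Finset.sum_nonneg fun i hi => Finset.sum_nonneg fun j _ =>
      mul_nonneg (hd i hi j) (hS _ j le_rfl), ?_⟩
    unfold stockGain
    refine Finset.sum_le_sum fun i hi => Finset.sum_le_sum fun j _ => ?_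
    refine mul_le_mul_of_nonneg_left ?_ (hd i hi j)
    have := hS i j (Finset.mem_range.mp hi).le
    linarith
  have hMG : (bankState M x N ω t).2.1 ≤ (bankState M x N ω t).2.2 := by
    cases t with
    | zero => simp [bankState]
    | succ t => exact le_max_right _ _
  obtain ⟨h1, h2⟩ := hcash
  simp only [bank, bankState] at hb ⊢
  set s := bankState M x N ω t
  set r := M.rate (t + 1) ω
  set c := tradeCash M N ω (t + 1)
  set k := stockGain M N ω (t + 1)
  have hα := M.taxRate_nonneg
  have hα1 := M.taxRate_lt_one
  -- The newly taxable amount is at most the interest earned plus the proceeds. As `α < 1`, the tax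
  -- is covered by these receipts and only debit interest can increase debts.
  have ht : max s.2.2 (s.2.1 + (s.1 * r + k)) - s.2.2 ≤ max 0 (s.1 * r) + c := by
    rw [sub_le_iff_le_add]
    refine max_le ?_ ?_
    · linarith [le_max_left 0 (s.1 * r)]
    · linarith [le_max_right 0 (s.1 * r)]
  have ht' : M.taxRate * (max s.2.2 (s.2.1 + (s.1 * r + k)) - s.2.2) ≤ max 0 (s.1 * r) + c := by
    have h3 : 0 ≤ max 0 (s.1 * r) + c := by
      linarith [le_max_left 0 (s.1 * r)]
    calc _ ≤ M.taxRate * (max 0 (s.1 * r) + c) := mul_le_mul_of_nonneg_left ht hα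
      _ ≤ 1 * (max 0 (s.1 * r) + c) := mul_le_mul_of_nonneg_right hα1.le h3
      _ = _ := one_mul _
  rcases le_total 0 s.1 with hs | hs
  · have : max 0 (s.1 * r) = s.1 * r := max_eq_right (mul_nonneg hs hr)
    rw [this] at ht'
    have : 0 ≤ (1 + C) * K := mul_nonneg (by linarith) hK
    linarith
  · have : max 0 (s.1 * r) = 0 := max_eq_left (mul_nonpos_of_nonpos_of_nonneg hs hr)
    rw [this] at ht'
    have h4 : r * K ≤ C * K := mul_le_mul_of_nonneg_right hC hK
    have h5 : r * (-K) ≤ r * s.1 := mul_le_mul_of_nonneg_left hb hr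
    linarith

/-- If nothing is purchased after time `u`, then wealth is bounded from below by the accrued debts
at time `u`. -/
theorem bank_ge_of_no_purchase (M : Market P T d) {N : Positions Ω d} {ω : Ω} {x C : ℝ}
    (hC0 : 0 ≤ C) (hr : ∀ t, 1 ≤ t → t ≤ T → 0 ≤ M.rate t ω ∧ M.rate t ω ≤ C)
    (hS : ∀ s j, s ≤ T → 0 ≤ M.price s j ω)
    (hN : ∀ i s j, i ≤ s → s < T → N i (s + 1) j ω ≤ N i s j ω) {u : ℕ}
    (hbuy : ∀ i j, u < i → i ≤ T → N i i j ω = 0)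
    {K : ℝ} (hK : 0 ≤ K) (hb : -K ≤ bank M x N ω u) {t : ℕ} (hut : u ≤ t) (ht : t ≤ T) :
    -((1 + C) ^ T * K) ≤ bank M x N ω t := by
  have H : ∀ n, u + n ≤ T → -((1 + C) ^ n * K) ≤ bank M x N ω (u + n) := by
    intro n
    induction n with
    | zero => intro _; simpa using hb
    | succ n ih =>
      intro hn
      have := bank_succ_ge M (t := u + n) (hr (u + n + 1) (by omega) (by omega)).1
        (hr (u + n + 1) (by omega) (by omega)).2 (fun s j hs => hS s j (by omega))
        (fun i j hi => hN i (u + n) j hi (by omega)) (fun j => hbuy _ j (by omega) (by omega))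
        (K := (1 + C) ^ n * K) (by positivity) (ih (by omega))
      rw [pow_succ, mul_comm _ (1 + C), mul_assoc]
      exact this
  obtain ⟨n, rfl⟩ := Nat.exists_eq_add_of_le hut
  refine le_trans ?_ (H n ht)
  have : (1 + C) ^ n ≤ (1 + C) ^ T := pow_le_pow_right₀ (by linarith) (by omega)
  nlinarith [mul_le_mul_of_nonneg_right this hK]

theorem measurable_bank (M : Market P T d) {N : Positions Ω d} (hN : IsStrategy M N) (x : ℝ) {t : ℕ}
    (ht : t ≤ T) : Measurable[M.filtration t] fun ω => bank M x N ω t := by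
  have hpos : ∀ {u} i s j, i ≤ s → s ≤ u → u ≤ T →
      Measurable[M.filtration u] fun ω => (N i s j ω : ℝ) := fun i s j h1 h2 h3 =>
    measurable_coe_nnreal_real.comp ((hN.adapted i s h1 (h2.trans h3) j).mono
      (M.filtration.mono h2) le_rfl)
  have hpr : ∀ {u} s j, s ≤ u → u ≤ T → Measurable[M.filtration u] (M.price s j) :=
    fun s j h1 h2 => (M.price_adapted s (h1.trans h2) j).mono (M.filtration.mono h1) le_rfl
  have hcash : ∀ u, u ≤ T → Measurable[M.filtration u] fun ω => tradeCash M N ω u := by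
    intro u hu
    unfold tradeCash
    refine Finset.measurable_sum _ fun j _ => Measurable.mul (Measurable.sub
      (Finset.measurable_sum _ fun i hi => ?_) (hpos _ _ j le_rfl le_rfl hu)) (hpr u j le_rfl hu)
    have hi := Finset.mem_range.mp hi
    exact (hpos _ _ j (by omega) (by omega) hu).sub (hpos _ _ j (by omega) (by omega) hu)
  have hgain : ∀ u, u ≤ T → Measurable[M.filtration u] fun ω => stockGain M N ω u := by
    intro u hu
    unfold stockGain
    refine Finset.measurable_sum _ fun i hi => Finset.measurable_sum _ fun j _ => ?_
    have hi := Finset.mem_range.mp hi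
    exact ((hpos _ _ j (by omega) (by omega) hu).sub (hpos _ _ j (by omega) (by omega) hu)).mul
      ((hpr u j le_rfl hu).sub (hpr i j (by omega) hu))
  suffices H : Measurable[M.filtration t] fun ω => bankState M x N ω t from measurable_fst.comp H
  induction t with
  | zero =>
    simp only [bankState]
    exact (measurable_const.add (hcash 0 ht)).prodMk measurable_const
  | succ t ih =>
    have h0 := (ih (by omega)).mono (M.filtration.mono (Nat.le_succ t)) le_rfl
    have h1 := measurable_fst.comp h0
    have h2 := measurable_fst.comp (measurable_snd.comp h0)
    have h3 := measurable_snd.comp (measurable_snd.comp h0)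
    have hr := M.rate_adapted (t + 1) (by omega) ht
    have hg := h2.add ((h1.mul hr).add (hgain _ ht))
    have hm := h3.max hg
    simp only [bankState]
    exact ((((h1.add (hr.mul h1)).add (hcash _ ht)).sub
      ((hm.sub h3).const_mul M.taxRate))).prodMk (hg.prodMk hm)

/-! ### Operations on strategies -/

/-- The positions coincide at all times before `t`. -/
def Agree (P : Measure Ω) (t : ℕ) (N N' : Positions Ω d) : Prop :=
  ∀ᵐ ω ∂P, ∀ i s j, i ≤ s → s < t → N i s j ω = N' i s j ω

theorem Agree.refl (t : ℕ) (N : Positions Ω d) : Agree P t N N :=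
  ae_of_all _ fun _ _ _ _ _ _ => rfl

theorem Agree.symm {t : ℕ} {N N' : Positions Ω d} (h : Agree P t N N') : Agree P t N' N := by
  filter_upwards [h] with ω h i s j his hst using (h i s j his hst).symm

theorem Agree.trans {t : ℕ} {N N' N'' : Positions Ω d} (h : Agree P t N N')
    (h' : Agree P t N' N'') : Agree P t N N'' := by
  filter_upwards [h, h'] with ω h h' i s j his hst using
    (h i s j his hst).trans (h' i s j his hst)

theorem Agree.mono {t u : ℕ} {N N' : Positions Ω d} (h : Agree P t N N') (hu : u ≤ t) :
    Agree P u N N' := by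
  filter_upwards [h] with ω h i s j his hst using h i s j his (hst.trans_le hu)

theorem Agree.add {t : ℕ} {N N' K K' : Positions Ω d} (h : Agree P t N N') (h' : Agree P t K K') :
    Agree P t (N + K) (N' + K') := by
  filter_upwards [h, h'] with ω h h' i s j his hst
  simp only [Pi.add_apply, h i s j his hst, h' i s j his hst]

theorem IsStrategy.ae_antitone {M : Market P T d} {N : Positions Ω d} (hN : IsStrategy M N) :
    ∀ᵐ ω ∂P, ∀ i s j, i ≤ s → s < T → N i (s + 1) j ω ≤ N i s j ω := by
  simp only [ae_all_iff]
  exact fun i s j his hs => hN.antitone i s his hs j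

theorem IsStrategy.ae_liquidated {M : Market P T d} {N : Positions Ω d} (hN : IsStrategy M N) :
    ∀ᵐ ω ∂P, ∀ i j, i ≤ T → N i T j ω = 0 := by
  simp only [ae_all_iff]
  exact fun i j hi => hN.liquidated i hi j

theorem le_of_antitone_path {N : Positions Ω d} {ω : Ω}
    (h : ∀ i s j, i ≤ s → s < T → N i (s + 1) j ω ≤ N i s j ω) {i s u : ℕ} (his : i ≤ s)
    (hsu : s ≤ u) (hu : u ≤ T) (j : Fin d) : N i u j ω ≤ N i s j ω := by
  induction u, hsu using Nat.le_induction with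
  | base => exact le_rfl
  | succ u hsu ih => exact (h i u j (his.trans hsu) (by omega)).trans (ih (by omega))

theorem IsStrategy.add {M : Market P T d} {N N' : Positions Ω d} (hN : IsStrategy M N)
    (hN' : IsStrategy M N') : IsStrategy M (N + N') where
  adapted i t h1 h2 j := (hN.adapted i t h1 h2 j).add (hN'.adapted i t h1 h2 j)
  antitone i t h1 h2 j := by
    filter_upwards [hN.antitone i t h1 h2 j, hN'.antitone i t h1 h2 j] with ω a b
    exact add_le_add a b
  liquidated i h j := by
    filter_upwards [hN.liquidated i h j, hN'.liquidated i h j] with ω a b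
    simp [a, b]

/-- Multiply everything that is purchased at time `i` by the factor `c i`. -/
def scale (c : ℕ → Fin d → Ω → ℝ≥0) (N : Positions Ω d) : Positions Ω d :=
  fun i s j ω => c i j ω * N i s j ω

theorem IsStrategy.scale {M : Market P T d} {N : Positions Ω d} (hN : IsStrategy M N)
    {c : ℕ → Fin d → Ω → ℝ≥0} (hc : ∀ i, i ≤ T → ∀ j, Measurable[M.filtration i] (c i j)) :
    IsStrategy M (scale c N) where
  adapted i t h1 h2 j := ((hc i (h1.trans h2) j).mono (M.filtration.mono h1) le_rfl).mul
    (hN.adapted i t h1 h2 j)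
  antitone i t h1 h2 j := by
    filter_upwards [hN.antitone i t h1 h2 j] with ω a
    exact mul_le_mul_right a _
  liquidated i h j := by
    filter_upwards [hN.liquidated i h j] with ω a
    simp [TaxModel.scale, a]

theorem IsStrategy.smul {M : Market P T d} {N : Positions Ω d} (hN : IsStrategy M N) (a : ℝ≥0) :
    IsStrategy M (a • N) :=
  hN.scale (c := fun _ _ _ => a) fun _ _ _ => measurable_const

theorem convex_isStrategy (M : Market P T d) : Convex ℝ≥0 {N | IsStrategy M N} :=
  fun _ hN _ hN' a b _ _ _ => (hN.smul a).add (hN'.smul b)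

theorem convex_agree (t : ℕ) (N : Positions Ω d) : Convex ℝ≥0 {N' | Agree P t N' N} := by
  intro N1 h1 N2 h2 a b _ _ hab
  change Agree P t _ _ at h1 h2 ⊢
  unfold Agree at h1 h2 ⊢
  filter_upwards [h1, h2] with ω h1 h2 i s j his hst
  simp only [Pi.add_apply, Pi.smul_apply, h1 i s j his hst, h2 i s j his hst]
  rw [← add_smul, hab, one_smul]

/-- Buy `y` at time `t` and keep it as long as possible. -/
def hold (T t : ℕ) (y : Fin d → Ω → ℝ≥0) : Positions Ω d :=
  fun i s j ω => if i = t ∧ t ≤ s ∧ s < T then y j ω else 0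

theorem isStrategy_hold (M : Market P T d) {t : ℕ} {y : Fin d → Ω → ℝ≥0}
    (hy : ∀ j, Measurable[M.filtration t] (y j)) : IsStrategy M (hold T t y) where
  adapted i s h1 h2 j := by
    unfold hold
    by_cases h : i = t ∧ t ≤ s ∧ s < T
    · simp only [if_pos h]
      exact (hy j).mono (M.filtration.mono h.2.1) le_rfl
    · simp only [if_neg h]; exact measurable_const
  antitone i s h1 h2 j := ae_of_all _ fun ω => by
    unfold hold
    split_ifs with h h'
    · exact le_rfl
    · omega
    · exact zero_le
    · exact le_rfl
  liquidated i h j := ae_of_all _ fun ω => by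
    unfold hold
    rw [if_neg (by omega)]

theorem hold_add (T t : ℕ) (y z : Fin d → Ω → ℝ≥0) :
    hold T t (y + z) = hold T t y + hold T t z := by
  funext i s j ω
  simp only [hold, Pi.add_apply]
  split_ifs <;> simp

theorem agree_hold (t : ℕ) (y : Fin d → Ω → ℝ≥0) : Agree P t (hold T t y) 0 :=
  ae_of_all _ fun ω i s j _ hst => by
    simp only [hold]
    rw [if_neg (by omega)]; rfl

theorem agree_add_hold (t : ℕ) (N : Positions Ω d) (y : Fin d → Ω → ℝ≥0) :
    Agree P t (N + hold T t y) N := by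
  simpa using (Agree.refl t N).add (agree_hold (P := P) (T := T) t y)

/-- From time `t` on follow the strategy with the number `κ`. -/
def glue (t : ℕ) (κ : Ω → ℕ) (N : ℕ → Positions Ω d) : Positions Ω d :=
  fun i s j ω => if s < t then N 0 i s j ω else N (κ ω) i s j ω

theorem measurable_glue {m : MeasurableSpace Ω} {β : Type*} [MeasurableSpace β] {κ : Ω → ℕ}
    (hκ : Measurable[m] κ) {f : ℕ → Ω → β} (hf : ∀ n, Measurable[m] (f n)) :
    Measurable[m] fun ω => f (κ ω) ω := by
  intro s hs
  have e : (fun ω => f (κ ω) ω) ⁻¹' s = ⋃ n, κ ⁻¹' {n} ∩ f n ⁻¹' s := by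
    ext ω; simp
  rw [e]
  exact MeasurableSet.iUnion fun n => (hκ (measurableSet_singleton n)).inter (hf n hs)

/-- As all strategies share their past, switching at `t` amounts pathwise to following the chosen
strategy from the start. This reduces the wealth of a glued strategy to that of one of its pieces.
-/
theorem glue_path {t : ℕ} {κ : Ω → ℕ} {N : ℕ → Positions Ω d}
    (h : ∀ n, Agree P t (N n) (N 0)) :
    ∀ᵐ ω ∂P, ∀ i s j, i ≤ s → glue t κ N i s j ω = N (κ ω) i s j ω := by
  have h' := ae_all_iff.mpr h
  filter_upwards [h'] with ω h' i s j his
  by_cases hs : s < t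
  · simp only [glue, if_pos hs]; exact (h' _ i s j his hs).symm
  · simp only [glue, if_neg hs]

theorem isStrategy_glue {M : Market P T d} {t : ℕ} {κ : Ω → ℕ}
    (hκ : Measurable[M.filtration t] κ) {N : ℕ → Positions Ω d} (hN : ∀ n, IsStrategy M (N n))
    (h : ∀ n, Agree P t (N n) (N 0)) : IsStrategy M (glue t κ N) where
  adapted i s h1 h2 j := by
    unfold glue
    by_cases hs : s < t
    · simp only [if_pos hs]; exact (hN 0).adapted i s h1 h2 j
    · simp only [if_neg hs]
      exact measurable_glue (hκ.mono (M.filtration.mono (not_lt.mp hs)) le_rfl)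
        fun n => (hN n).adapted i s h1 h2 j
  antitone i s h1 h2 j := by
    filter_upwards [glue_path (κ := κ) h, ae_all_iff.mpr fun n => (hN n).antitone i s h1 h2 j]
      with ω a b
    rw [a i _ j (by omega), a i s j h1]
    exact b _
  liquidated i h1 j := by
    filter_upwards [glue_path (κ := κ) h, ae_all_iff.mpr fun n => (hN n).liquidated i h1 j]
      with ω a b
    rw [a i _ j h1]
    exact b _

theorem agree_glue (t : ℕ) (κ : Ω → ℕ) (N : ℕ → Positions Ω d) : Agree P t (glue t κ N) (N 0) :=
  ae_of_all _ fun ω i s j _ hst => by simp only [glue, if_pos hst]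

/-- Replace the positions up to time `t` by those of `p`; afterwards follow `N` as far as
possible. -/
def graft (t : ℕ) (p N : Positions Ω d) : Positions Ω d :=
  fun i s j ω => if s ≤ t then p i s j ω else
    if i ≤ t then min (N i s j ω) (p i t j ω) else N i s j ω

theorem IsStrategy.graft {M : Market P T d} {t : ℕ} {p N : Positions Ω d} (hp : IsStrategy M p)
    (hN : IsStrategy M N) (ht : t < T) : IsStrategy M (graft t p N) where
  adapted i s h1 h2 j := by
    unfold TaxModel.graft
    split_ifs with h h'
    · exact hp.adapted i s h1 h2 j
    · exact (hN.adapted i s h1 h2 j).min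
        ((hp.adapted i t h' ht.le j).mono (M.filtration.mono (by omega)) le_rfl)
    · exact hN.adapted i s h1 h2 j
  antitone i s h1 h2 j := by
    filter_upwards [hp.antitone i s h1 h2 j, hN.antitone i s h1 h2 j] with ω a b
    unfold TaxModel.graft
    by_cases h : s + 1 ≤ t
    · rw [if_pos h, if_pos (by omega)]; exact a
    rw [if_neg h]
    by_cases h3 : s ≤ t
    · obtain rfl : s = t := by omega
      rw [if_pos h3, if_pos h1]
      exact min_le_right _ _
    rw [if_neg h3]
    split_ifs
    · exact min_le_min_right _ b
    · exact b
  liquidated i h1 j := by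
    filter_upwards [hN.liquidated i h1 j] with ω a
    unfold TaxModel.graft
    rw [if_neg (by omega), a]
    split_ifs <;> simp

theorem agree_graft (t : ℕ) (p N : Positions Ω d) : Agree P (t + 1) (graft t p N) p :=
  ae_of_all _ fun ω i s j _ hst => by simp only [graft, if_pos (Nat.lt_succ_iff.mp hst)]

/-- Capping later holdings by `p i t` costs no more than the error at time `t`, because `N` itself
never holds more at `s ≥ t` than at `t`. -/
theorem abs_graft_sub_le {t : ℕ} {p N : Positions Ω d} {ω : Ω} {δ : ℝ}
    (hanti : ∀ i s j, i ≤ s → s < T → N i (s + 1) j ω ≤ N i s j ω) (hδ : 0 ≤ δ)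
    (h : ∀ i s j, i ≤ s → s ≤ t → |(p i s j ω : ℝ) - N i s j ω| ≤ δ) (i s : ℕ) (j : Fin d)
    (his : i ≤ s) (hs : s ≤ T) : |(graft t p N i s j ω : ℝ) - N i s j ω| ≤ δ := by
  unfold graft
  split_ifs with h1 h2
  · exact h i s j his h1
  · have h3 := h i t j h2 le_rfl
    have h4 : (N i s j ω : ℝ) ≤ N i t j ω := by
      exact_mod_cast le_of_antitone_path hanti h2 (by omega) hs j
    rw [abs_le] at h3 ⊢
    rw [NNReal.coe_min]
    rcases min_choice (N i s j ω : ℝ) (p i t j ω) with h5 | h5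
    · rw [h5]; constructor <;> linarith
    · have h6 := min_le_left (N i s j ω : ℝ) (p i t j ω)
      rw [h5] at h6 ⊢
      constructor <;> linarith
  · simpa using hδ

/-- The limit of the positions up to time `t`, without any further trades before `T`. -/
noncomputable def limitHold (T t : ℕ) (u : ℕ → Positions Ω d) : Positions Ω d :=
  fun i s j ω => if s < T ∧ i ≤ t then
    (limsup (fun n => (u n i (min s t) j ω : ℝ≥0∞)) atTop).toNNReal else 0

/-- The limsup in `limitHold` provides adaptedness without excluding a null set; on paths of
convergence it is the true limit. -/
theorem limitHold_path {t : ℕ} (ht : t < T) {u : ℕ → Positions Ω d} {ω : Ω}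
    (h : ∀ i s j, i ≤ s → s ≤ t → ∃ l : ℝ≥0, Tendsto (fun n => u n i s j ω) atTop (𝓝 l))
    (i s : ℕ) (j : Fin d) (his : i ≤ s) (hst : s ≤ t) :
    Tendsto (fun n => u n i s j ω) atTop (𝓝 (limitHold T t u i s j ω)) := by
  obtain ⟨l, hl⟩ := h i s j his hst
  have : limitHold T t u i s j ω = l := by
    have h2 : Tendsto (fun n => (u n i s j ω : ℝ≥0∞)) atTop (𝓝 (l : ℝ≥0∞)) :=
      ENNReal.tendsto_coe.mpr hl
    simp only [limitHold]
    rw [if_pos (by omega), min_eq_left hst, h2.limsup_eq, ENNReal.toNNReal_coe]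
  rwa [this]

theorem isStrategy_limitHold {M : Market P T d} {t : ℕ} (ht : t < T) {u : ℕ → Positions Ω d}
    (hu : ∀ n, IsStrategy M (u n))
    (h : ∀ᵐ ω ∂P, ∀ i s j, i ≤ s → s ≤ t → ∃ l : ℝ≥0,
      Tendsto (fun n => u n i s j ω) atTop (𝓝 l)) : IsStrategy M (limitHold T t u) where
  adapted i s h1 h2 j := by
    unfold limitHold
    split_ifs with h3
    · refine ENNReal.measurable_toNNReal.comp (Measurable.limsup fun n => ?_)
      exact measurable_coe_nnreal_ennreal.comp (((hu n).adapted i (min s t)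
        (le_min h1 h3.2) ((min_le_left _ _).trans h2) j).mono
          (M.filtration.mono (min_le_left _ _)) le_rfl)
    · exact measurable_const
  antitone i s h1 h2 j := by
    filter_upwards [h, ae_all_iff.mpr fun n => (hu n).antitone i s h1 h2 j] with ω h hu
    by_cases h3 : s + 1 ≤ t
    · exact le_of_tendsto_of_tendsto' (limitHold_path ht h i (s + 1) j (by omega) h3)
        (limitHold_path ht h i s j h1 (by omega)) hu
    · unfold limitHold
      split_ifs with h4 h5 h6
      · rw [min_eq_right (by omega), min_eq_right (by omega)]
      · omega
      · exact zero_le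
      · exact le_rfl
  liquidated i h1 j := ae_of_all _ fun ω => by
    unfold limitHold
    rw [if_neg (by omega)]

/-! ### Reaction functions do not anticipate -/

/-- Measurability forces non-anticipation. `reactionSigma` is contained in the pullback of the power
set under `(ω, y) ↦ (ω, observed t y)`, so the preimage of a single value is a union of fibres of
this map. -/
theorem ReactionFunction.toFun_congr {M : Market P T d} (R : ReactionFunction M) {ω : Ω}
    {y y' : PositionSpace T d} {p : TradeIndex T} (h : observed p.1.2 y = observed p.1.2 y')
    (j : Fin d) : R.toFun (ω, y) p j = R.toFun (ω, y') p j := by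
  have hm := R.measurable_coord p j (measurableSet_singleton (R.toFun (ω, y) p j))
  have hle : reactionSigma M p.1.2 ≤
      MeasurableSpace.comap (Prod.map id (observed (d := d) p.1.2)) ⊤ := by
    refine sup_le ?_ ?_
    · rintro s ⟨u, -, rfl⟩
      exact ⟨Prod.fst ⁻¹' u, trivial, rfl⟩
    · rintro s ⟨u, ⟨v, -, rfl⟩, rfl⟩
      exact ⟨Prod.snd ⁻¹' v, trivial, rfl⟩
  obtain ⟨s, -, hs⟩ := hle _ hm
  have h1 : (ω, y) ∈ (fun z => R.toFun z p j) ⁻¹' {R.toFun (ω, y) p j} := rfl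
  have h2 : (ω, y') ∈ (fun z => R.toFun z p j) ⁻¹' {R.toFun (ω, y) p j} := by
    rw [← hs] at h1 ⊢
    simpa [Set.mem_preimage, Prod.map, h] using h1
  exact h2.symm

theorem ReactionFunction.apply_congr {M : Market P T d} (R : ReactionFunction M) {ω : Ω}
    {N N' : Positions Ω d} {t : ℕ} (h : ∀ i s j, i ≤ s → s < t → N i s j ω = N' i s j ω)
    (i s : ℕ) (j : Fin d) (_ : i ≤ s) (hst : s < t) :
    R.apply N i s j ω = R.apply N' i s j ω := by
  unfold ReactionFunction.apply
  split_ifs with h1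
  · refine R.toFun_congr ?_ j
    funext p j'
    exact h _ _ j' p.1.2.1 (lt_of_le_of_lt p.2 hst)
  · rfl

theorem ReactionFunction.iterate_congr {M : Market P T d} (R : ReactionFunction M) (k : ℕ) {ω : Ω}
    {N N' : Positions Ω d} {t : ℕ} (h : ∀ i s j, i ≤ s → s < t → N i s j ω = N' i s j ω)
    (i s : ℕ) (j : Fin d) (his : i ≤ s) (hst : s < t) :
    R.apply^[k] N i s j ω = R.apply^[k] N' i s j ω := by
  induction k generalizing i s j with
  | zero => exact h i s j his hst
  | succ k ih =>
    rw [Function.iterate_succ_apply', Function.iterate_succ_apply']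
    exact R.apply_congr ih i s j his hst

/-- Non-anticipation lets a whole family of strategies be replaced by reactions without destroying
their common past. -/
theorem Agree.iterate {M : Market P T d} {t : ℕ} {N N' : Positions Ω d} (h : Agree P t N N')
    (R : ReactionFunction M) (k : ℕ) : Agree P t (R.apply^[k] N) (R.apply^[k] N') := by
  filter_upwards [h] with ω h using R.iterate_congr k h

theorem IsStrategy.iterate {M : Market P T d} {N : Positions Ω d} (hN : IsStrategy M N)
    (R : ReactionFunction M) (k : ℕ) : IsStrategy M (R.apply^[k] N) := by
  induction k with
  | zero => exact hN
  | succ k ih => rw [Function.iterate_succ_apply']; exact IsStrategy.reaction R ih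

theorem terminalWealth_le_iterate {M : Market P T d} {R : ReactionFunction M} {x : ℝ}
    (hR : ∀ N, IsStrategy M N →
      ∀ᵐ ω ∂P, terminalWealth M x N ω ≤ terminalWealth M x (R.apply N) ω)
    {N : Positions Ω d} (hN : IsStrategy M N) (k : ℕ) :
    ∀ᵐ ω ∂P, terminalWealth M x N ω ≤ terminalWealth M x (R.apply^[k] N) ω := by
  induction k with
  | zero => exact ae_of_all _ fun _ => le_rfl
  | succ k ih =>
    filter_upwards [ih, hR _ (hN.iterate R k)] with ω h1 h2
    rw [Function.iterate_succ_apply']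
    exact h1.trans h2

/-! ### Convergence of forward convex combinations -/

section Komlos

variable {E : Type*} [AddCommMonoid E] [Module ℝ≥0 E] {ι : Type*}

theorem measurable_of_mem_convexHull {m : MeasurableSpace Ω} (φ : E →ₗ[ℝ≥0] (ι → Ω → ℝ≥0))
    {s : Set E} (hs : ∀ X ∈ s, ∀ k, Measurable[m] (φ X k)) {Y : E} (hY : Y ∈ convexHull ℝ≥0 s)
    (k : ι) : Measurable[m] (φ Y k) := by
  have : Convex ℝ≥0 {Y : E | Measurable[m] (φ Y k)} := by
    intro Y1 h1 Y2 h2 a b _ _ _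
    simp only [Set.mem_ofPred_eq, map_add, map_smul, Pi.add_apply, Pi.smul_apply] at *
    exact (h1.const_mul a).add (h2.const_mul b)
  exact convexHull_min (fun X hX => hs X hX k) this hY

/-- Chebyshev's inequality at level `4⁻ⁿ` gives probabilities at most `3 · 2⁻ⁿ`, so by
Borel–Cantelli the increments are eventually below `2⁻ⁿ`. -/
theorem ae_cauchySeq_of_integral_sq_le [IsProbabilityMeasure P] {g : ℕ → Ω → ℝ}
    (hm : ∀ n, Measurable (g n)) (h0 : ∀ n ω, 0 ≤ g n ω) (h1 : ∀ n ω, g n ω ≤ 1)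
    (hI : ∀ n, ∫ ω, (g n ω - g (n + 1) ω) ^ 2 ∂P ≤ 3 * (1 / 8) ^ n) :
    ∀ᵐ ω ∂P, CauchySeq fun n => g n ω := by
  have hb : ∀ n ω, |g n ω - g (n + 1) ω| ≤ 1 := fun n ω => by
    rw [abs_le]
    constructor <;> linarith [h0 n ω, h1 n ω, h0 (n + 1) ω, h1 (n + 1) ω]
  have hint : ∀ n, Integrable (fun ω => (g n ω - g (n + 1) ω) ^ 2) P := fun n =>
    Integrable.of_bound (((hm n).sub (hm (n + 1))).pow_const 2).aestronglyMeasurable 1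
      (ae_of_all _ fun ω => by
        rw [Real.norm_eq_abs, abs_pow]
        exact pow_le_one₀ (abs_nonneg _) (hb n ω))
  have hP : ∀ n, P {ω | (1 / 4 : ℝ) ^ n ≤ (g n ω - g (n + 1) ω) ^ 2} ≤
      ENNReal.ofReal (3 * (1 / 2) ^ n) := by
    intro n
    have h2 := mul_meas_ge_le_integral_of_nonneg (μ := P)
      (ae_of_all _ fun ω => sq_nonneg (g n ω - g (n + 1) ω)) (hint n) ((1 / 4) ^ n)
    rw [← ENNReal.ofReal_toReal (measure_ne_top P _)]
    refine ENNReal.ofReal_le_ofReal ?_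
    have h3 := h2.trans (hI n)
    have h4 : (3 : ℝ) * (1 / 8) ^ n = (1 / 4) ^ n * (3 * (1 / 2) ^ n) := by
      rw [mul_left_comm, ← mul_pow]; norm_num
    rw [h4] at h3
    exact le_of_mul_le_mul_left h3 (by positivity)
  have hsum : ∑' n, P {ω | (1 / 4 : ℝ) ^ n ≤ (g n ω - g (n + 1) ω) ^ 2} ≠ ∞ := by
    refine ne_top_of_le_ne_top ?_ (ENNReal.tsum_le_tsum hP)
    rw [← ENNReal.ofReal_tsum_of_nonneg (fun n => by positivity)
      ((summable_geometric_of_lt_one (by norm_num) (by norm_num)).mul_left 3)]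
    exact ENNReal.ofReal_ne_top
  filter_upwards [ae_eventually_notMem hsum] with ω hω
  obtain ⟨n0, hn0⟩ := eventually_atTop.mp hω
  -- The factor `2 ^ n0` makes the geometric bound valid also for the first increments, which are at
  -- most `1`.
  refine cauchySeq_of_le_geometric (1 / 2) (2 ^ n0) (by norm_num) fun n => ?_
  rw [Real.dist_eq]
  rcases le_total n0 n with hn | hn
  · have h5 := hn0 n hn
    simp only [not_le] at h5
    have h6 : (1 / 4 : ℝ) ^ n = ((1 / 2) ^ n) ^ 2 := by rw [← pow_mul, mul_comm, pow_mul]; norm_num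
    rw [h6] at h5
    have h7 := (abs_lt_of_sq_lt_sq h5 (by positivity)).le
    refine h7.trans (le_mul_of_one_le_left (by positivity) (one_le_pow₀ (by norm_num)))
  · refine (hb n ω).trans ?_
    obtain ⟨m, rfl⟩ := Nat.exists_eq_add_of_le hn
    rw [pow_add, mul_right_comm, ← mul_pow]
    norm_num
    exact one_le_pow₀ (by norm_num)

/-- For every sequence of nonnegative random vectors there are forward convex combinations which
converge almost surely, possibly to infinity. -/
theorem exists_convexHull_cauchySeq_exp [IsProbabilityMeasure P] [Finite ι]
    (φ : E →ₗ[ℝ≥0] (ι → Ω → ℝ≥0)) (X : ℕ → E) (hX : ∀ n k, Measurable (φ (X n) k)) :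
    ∃ Y : ℕ → E, (∀ n, Y n ∈ convexHull ℝ≥0 (X '' Set.Ici n)) ∧
      ∀ k, ∀ᵐ ω ∂P, CauchySeq fun n => Real.exp (-(φ (Y n) k ω : ℝ) / 2) := by
  have := Fintype.ofFinite ι
  set D : ℕ → Set E := fun n => convexHull ℝ≥0 (X '' Set.Ici n) with hD
  have hDanti : ∀ {m n}, m ≤ n → D n ⊆ D m := fun h =>
    convexHull_mono (Set.image_mono (Set.Ici_subset_Ici.mpr h))
  have hDne : ∀ n, (D n).Nonempty := fun n => ⟨X n, subset_convexHull _ _ ⟨n, Set.self_mem_Ici, rfl⟩⟩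
  have hmeas : ∀ {n Y}, Y ∈ D n → ∀ k, Measurable (φ Y k) := fun hY k =>
    measurable_of_mem_convexHull φ (by rintro _ ⟨m, -, rfl⟩ k; exact hX m k) hY k
  -- `J` integrates the sum of `exp (-Y)`, the squares of `e`. The halved exponent gives `e Q ^ 2 =
  -- e A * e B` at a midpoint `Q`, hence a parallelogram identity: near minimizers of `J` are close
  -- in the `L²` distance of `e`.
  set e : E → ι → Ω → ℝ := fun Y k ω => Real.exp (-(φ Y k ω : ℝ) / 2) with he
  have e0 : ∀ Y k ω, 0 ≤ e Y k ω := fun Y k ω => (Real.exp_pos _).le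
  have e1 : ∀ Y k ω, e Y k ω ≤ 1 := fun Y k ω => by
    rw [he]; simp only [Real.exp_le_one_iff]
    have := (φ Y k ω).2
    simp only [NNReal.val_eq_coe] at this
    linarith
  have em : ∀ {n Y}, Y ∈ D n → ∀ k, Measurable (e Y k) := fun hY k =>
    Real.measurable_exp.comp (((measurable_coe_nnreal_real.comp (hmeas hY k)).neg).div_const 2)
  set J : E → ℝ := fun Y => ∫ ω, ∑ k, e Y k ω ^ 2 ∂P with hJ
  have J0 : ∀ Y, 0 ≤ J Y := fun Y =>
    integral_nonneg fun ω => Finset.sum_nonneg fun k _ => sq_nonneg _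
  have hint : ∀ {n Y}, Y ∈ D n → ∀ k, Integrable (fun ω => e Y k ω ^ 2) P := fun hY k =>
    Integrable.of_bound ((em hY k).pow_const 2).aestronglyMeasurable 1
      (ae_of_all _ fun ω => by
        rw [Real.norm_eq_abs, abs_pow, abs_of_nonneg (e0 _ _ _)]
        exact pow_le_one₀ (e0 _ _ _) (e1 _ _ _))
  have J1 : ∀ {n Y}, Y ∈ D n → J Y ≤ Fintype.card ι := fun {n Y} hY => by
    rw [hJ]; simp only
    rw [integral_finsetSum _ fun k _ => hint hY k]
    calc _ ≤ ∑ _k : ι, (1 : ℝ) := Finset.sum_le_sum fun k _ => by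
            calc _ ≤ ∫ _, (1 : ℝ) ∂P := integral_mono (hint hY k) (integrable_const _)
                  fun ω => pow_le_one₀ (e0 _ _ _) (e1 _ _ _)
              _ = 1 := by simp
      _ = _ := by simp
  have hbdd : ∀ n, BddBelow (J '' D n) := fun n => ⟨0, by rintro _ ⟨Y, -, rfl⟩; exact J0 Y⟩
  -- The infima over the shrinking hulls increase to a finite limit `C`. Each `Y l` is chosen as a
  -- near minimizer in a hull whose infimum is already close to `C`.
  set c : ℕ → ℝ := fun n => sInf (J '' D n) with hc
  have cle : ∀ {n Y}, Y ∈ D n → c n ≤ J Y := fun {n Y} hY => csInf_le (hbdd n) ⟨Y, hY, rfl⟩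
  have cmono : Monotone c := fun m n h =>
    csInf_le_csInf (hbdd m) ((hDne n).image J) (Set.image_mono (hDanti h))
  have cbdd : BddAbove (Set.range c) := ⟨Fintype.card ι, by
    rintro _ ⟨n, rfl⟩
    obtain ⟨Y, hY⟩ := hDne n
    exact (cle hY).trans (J1 hY)⟩
  set C := ⨆ n, c n with hC
  have hcC : ∀ n, c n ≤ C := fun n => le_ciSup cbdd n
  have hex : ∀ l : ℕ, ∃ n Y, l ≤ n ∧ Y ∈ D n ∧ C - (1 / 8) ^ l ≤ c n ∧ J Y ≤ c n + (1 / 8) ^ l := by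
    intro l
    have hpos : (0 : ℝ) < (1 / 8) ^ l := by positivity
    obtain ⟨n, hn⟩ := exists_lt_of_lt_ciSup (show C - (1 / 8) ^ l < ⨆ n, c n by linarith)
    have h2 : c n ≤ c (max n l) := cmono (le_max_left _ _)
    obtain ⟨_, ⟨Y, hY, rfl⟩, h3⟩ := exists_lt_of_csInf_lt ((hDne (max n l)).image J)
      (show sInf (J '' D (max n l)) < c (max n l) + (1 / 8) ^ l by
        change c (max n l) < _; linarith)
    exact ⟨max n l, Y, le_max_right _ _, hY, by linarith, h3.le⟩
  choose n Y hln hY hCn hJY using hex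
  refine ⟨Y, fun l => hDanti (hln l) (hY l), fun k => ?_⟩
  refine ae_cauchySeq_of_integral_sq_le (g := fun l => e (Y l) k) (fun l => em (hY l) k)
    (fun l ω => e0 _ _ _) (fun l ω => e1 _ _ _) fun l => ?_
  -- compare both vectors with their midpoint
  have key : ∀ {p} {A B : E}, A ∈ D p → B ∈ D p →
      ∫ ω, (e A k ω - e B k ω) ^ 2 ∂P ≤ J A + J B - 2 * c p := by
    intro p A B hA hB
    set Q : E := (1 / 2 : ℝ≥0) • A + (1 / 2 : ℝ≥0) • B with hQ
    have hQD : Q ∈ D p := convex_convexHull ℝ≥0 _ hA hB zero_le zero_le (add_halves 1)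
    have eQ : ∀ k ω, e Q k ω ^ 2 = e A k ω * e B k ω := by
      intro k ω
      simp only [he, ← Real.exp_add, ← Real.exp_nat_mul]
      congr 1
      simp only [hQ, map_add, map_smul, Pi.add_apply, Pi.smul_apply, smul_eq_mul]
      push_cast
      ring
    have hQint := hint hQD
    have hAint := hint hA
    have hBint := hint hB
    have e2 : J A + J B - 2 * J Q = ∫ ω, ∑ k, (e A k ω - e B k ω) ^ 2 ∂P := by
      have hA' := integrable_finsetSum Finset.univ fun k _ => hAint k
      have hB' := integrable_finsetSum Finset.univ fun k _ => hBint k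
      have hQ' := (integrable_finsetSum Finset.univ fun k _ => hQint k).const_mul 2
      have hAB : Integrable (fun ω => ∑ k, e A k ω ^ 2 + ∑ k, e B k ω ^ 2) P := hA'.add hB'
      have h1 : ∀ ω, ∑ k, (e A k ω - e B k ω) ^ 2 =
          (∑ k, e A k ω ^ 2 + ∑ k, e B k ω ^ 2) - 2 * ∑ k, e Q k ω ^ 2 := fun ω => by
        rw [Finset.mul_sum, ← Finset.sum_add_distrib, ← Finset.sum_sub_distrib]
        refine Finset.sum_congr rfl fun k _ => ?_
        rw [eQ]; ring
      simp only [h1]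
      rw [integral_sub hAB hQ', integral_add hA' hB', integral_const_mul]
    have hdint : ∀ k, Integrable (fun ω => (e A k ω - e B k ω) ^ 2) P := fun k => by
      refine (((hAint k).add (hBint k)).sub ((hQint k).const_mul 2)).congr
        (ae_of_all _ fun ω => ?_)
      simp only [Pi.add_apply, Pi.sub_apply]
      rw [eQ]; ring
    have e3 : ∫ ω, (e A k ω - e B k ω) ^ 2 ∂P ≤ ∫ ω, ∑ k, (e A k ω - e B k ω) ^ 2 ∂P :=
      integral_mono (hdint k) (integrable_finsetSum _ fun k _ => hdint k) fun ω =>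
        Finset.single_le_sum (f := fun k => (e A k ω - e B k ω) ^ 2)
          (fun k _ => sq_nonneg _) (Finset.mem_univ k)
    have := cle hQD
    linarith
  have h8 : ((1 : ℝ) / 8) ^ (l + 1) ≤ (1 / 8) ^ l :=
    pow_le_pow_of_le_one (by norm_num) (by norm_num) (Nat.le_succ l)
  -- Both vectors lie in the hull with the smaller index. One is within `8⁻ˡ` of that hull's
  -- infimum, the other within `2 · 8⁻ˡ`, whence the constant `3`.
  rcases le_total (n l) (n (l + 1)) with h | h
  · have := key (hY l) (hDanti h (hY (l + 1)))
    linarith [hJY l, hJY (l + 1), hCn l, hcC (n (l + 1))]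
  · have := key (hDanti h (hY l)) (hY (l + 1))
    linarith [hJY l, hJY (l + 1), hCn (l + 1), hcC (n l)]

/-- A zero limit of the exponentials means escape to infinity; a positive one is inverted by the
logarithm. -/
theorem exists_tendsto_of_cauchySeq_exp {a : ℕ → ℝ≥0}
    (h : CauchySeq fun n => Real.exp (-(a n : ℝ) / 2))
    (hb : ¬ Tendsto (fun n => (a n : ℝ)) atTop atTop) : ∃ l : ℝ≥0, Tendsto a atTop (𝓝 l) := by
  obtain ⟨z, hz⟩ := cauchySeq_tendsto_of_complete h
  have hz0 : 0 ≤ z := ge_of_tendsto' hz fun n => (Real.exp_pos _).le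
  rcases hz0.eq_or_lt with rfl | hz0
  · exfalso
    refine hb ?_
    have h1 : Tendsto (fun n => -(a n : ℝ) / 2) atTop atBot := by
      rw [← Real.tendsto_exp_comp_nhds_zero]; exact hz
    have h2 := (tendsto_neg_atBot_atTop.comp h1).const_mul_atTop (show (0 : ℝ) < 2 by norm_num)
    refine h2.congr fun n => ?_
    simp only [Function.comp]; ring
  · have h1 := ((Real.continuousAt_log hz0.ne').tendsto.comp hz).const_mul (-2)
    have h2 : Tendsto (fun n => (a n : ℝ)) atTop (𝓝 (-2 * Real.log z)) := by
      refine h1.congr fun n => ?_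
      simp only [Function.comp, Real.log_exp]; ring
    have h3 := (continuous_real_toNNReal.tendsto _).comp h2
    refine ⟨_, h3.congr fun n => ?_⟩
    simp [Function.comp]

end Komlos

/-! ### Domination up to small errors -/

/-- On the event `B` the random variable `f` is dominated by elements of `𝒲` up to arbitrarily small
errors in probability. -/
def NearlyDominated (P : Measure Ω) (B : Set Ω) (𝒲 : Set (Ω → ℝ)) (f : Ω → ℝ) : Prop :=
  ∀ ε : ℝ, 0 < ε → ∃ W ∈ 𝒲, P {ω | ω ∈ B ∧ W ω < f ω - ε} ≤ ENNReal.ofReal ε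

/-- On the event `B` the random variable `f` is asymptotically dominated by the sequence `W`. -/
def EventuallyDominated (P : Measure Ω) (B : Set Ω) (W : ℕ → Ω → ℝ) (f : Ω → ℝ) : Prop :=
  ∀ᵐ ω ∂P, ω ∈ B → ∀ δ : ℝ, 0 < δ → ∀ᶠ n in atTop, f ω - δ ≤ W n ω

/-- Borel–Cantelli with errors `2⁻ⁿ`. The dominating set may vary with `n`, which is needed when the
pasts form a convergent sequence. -/
theorem NearlyDominated.exists_seq {B : Set Ω} {𝒲 : ℕ → Set (Ω → ℝ)} {f : Ω → ℝ}
    (h : ∀ n, NearlyDominated P B (𝒲 n) f) :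
    ∃ W : ℕ → Ω → ℝ, (∀ n, W n ∈ 𝒲 n) ∧ EventuallyDominated P B W f := by
  have h' : ∀ n : ℕ, ∃ W ∈ 𝒲 n, P {ω | ω ∈ B ∧ W ω < f ω - (1 / 2) ^ n} ≤
      ENNReal.ofReal ((1 / 2) ^ n) := fun n => h n _ (by positivity)
  choose W hW hP using h'
  refine ⟨W, hW, ?_⟩
  have hsum : ∑' n, P {ω | ω ∈ B ∧ W n ω < f ω - (1 / 2) ^ n} ≠ ∞ := by
    refine ne_top_of_le_ne_top ?_ (ENNReal.tsum_le_tsum hP)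
    rw [← ENNReal.ofReal_tsum_of_nonneg (fun n => by positivity)
      (summable_geometric_of_lt_one (by norm_num) (by norm_num))]
    exact ENNReal.ofReal_ne_top
  filter_upwards [ae_eventually_notMem hsum] with ω hω hB δ hδ
  have h2 : ∀ᶠ n : ℕ in atTop, (1 / 2 : ℝ) ^ n < δ :=
    (tendsto_pow_atTop_nhds_zero_of_lt_one (by norm_num) (by norm_num)).eventually_lt_const hδ
  filter_upwards [hω, h2] with n h3 h4
  by_contra h5
  exact h3 ⟨hB, by linarith [not_le.mp h5]⟩

/-- The shortfalls `(f - W n)⁺` on `B` tend to zero almost surely, hence in probability. -/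
theorem EventuallyDominated.nearlyDominated [IsProbabilityMeasure P] {B : Set Ω}
    {𝒲 : Set (Ω → ℝ)} {f : Ω → ℝ} {W : ℕ → Ω → ℝ} (h : EventuallyDominated P B W f)
    (hB : MeasurableSet B) (hf : Measurable f) (hW : ∀ n, W n ∈ 𝒲) (hm : ∀ n, Measurable (W n)) :
    NearlyDominated P B 𝒲 f := by
  intro ε hε
  set g : ℕ → Ω → ℝ := fun n => B.indicator fun ω => max (f ω - W n ω) 0 with hg
  have hgm : ∀ n, AEStronglyMeasurable (g n) P := fun n =>
    (((hf.sub (hm n)).max measurable_const).indicator hB).aestronglyMeasurable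
  have hg0 : ∀ᵐ ω ∂P, Tendsto (fun n => g n ω) atTop (𝓝 0) := by
    filter_upwards [h] with ω hω
    by_cases hωB : ω ∈ B
    · simp only [hg, Set.indicator_of_mem hωB]
      rw [Metric.tendsto_atTop]
      intro δ hδ
      obtain ⟨n0, hn0⟩ := eventually_atTop.mp (hω hωB (δ / 2) (by linarith))
      refine ⟨n0, fun n hn => ?_⟩
      have := hn0 n hn
      rw [Real.dist_eq, sub_zero, abs_of_nonneg (le_max_right _ _)]
      exact max_lt (by linarith) hδ
    · simp only [hg, Set.indicator_of_notMem hωB, tendsto_const_nhds]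
  have ht := tendstoInMeasure_of_tendsto_ae hgm hg0 (ENNReal.ofReal ε) (by simpa using hε)
  obtain ⟨n, hn⟩ := (ht.eventually_le_const (u := ENNReal.ofReal ε) (by simpa using hε)).exists
  refine ⟨W n, hW n, (measure_mono ?_).trans hn⟩
  rintro ω ⟨h1, h2⟩
  change ENNReal.ofReal ε ≤ edist (g n ω) 0
  rw [edist_dist, Real.dist_eq, sub_zero]
  refine ENNReal.ofReal_le_ofReal ?_
  simp only [hg, Set.indicator_of_mem h1]
  exact (by linarith : ε ≤ f ω - W n ω).trans ((le_max_left _ _).trans (le_abs_self _))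

theorem NearlyDominated.of_mem {B : Set Ω} {𝒲 : Set (Ω → ℝ)} {f W : Ω → ℝ} (hW : W ∈ 𝒲)
    (h : ∀ᵐ ω ∂P, ω ∈ B → f ω ≤ W ω) : NearlyDominated P B 𝒲 f := by
  refine fun ε hε => ⟨W, hW, ?_⟩
  have : P {ω | ω ∈ B ∧ W ω < f ω - ε} = 0 := by
    refine measure_mono_null ?_ (ae_iff.mp h)
    rintro ω ⟨h1, h2⟩ h3
    have := h3 h1
    linarith
  rw [this]; exact zero_le

theorem NearlyDominated.mono {B B' : Set Ω} {𝒲 : Set (Ω → ℝ)} {f : Ω → ℝ}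
    (h : NearlyDominated P B 𝒲 f) (hB : B' ⊆ B) : NearlyDominated P B' 𝒲 f := fun ε hε => by
  obtain ⟨W, hW, h1⟩ := h ε hε
  refine ⟨W, hW, (measure_mono ?_).trans h1⟩
  rintro ω ⟨h2, h3⟩
  exact ⟨hB h2, h3⟩

theorem measure_lt_sub_le_add {B : Set Ω} {f g W : Ω → ℝ} {ε : ℝ} (hε : 0 < ε)
    (h1 : P {ω | ω ∈ B ∧ g ω < f ω - ε / 2} ≤ ENNReal.ofReal (ε / 2))
    (h2 : P {ω | ω ∈ B ∧ W ω < g ω - ε / 2} ≤ ENNReal.ofReal (ε / 2)) :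
    P {ω | ω ∈ B ∧ W ω < f ω - ε} ≤ ENNReal.ofReal ε := by
  have : ENNReal.ofReal ε = ENNReal.ofReal (ε / 2) + ENNReal.ofReal (ε / 2) := by
    rw [← ENNReal.ofReal_add (by linarith) (by linarith)]; congr 1; ring
  rw [this]
  refine (measure_mono ?_).trans ((measure_union_le _ _).trans (add_le_add h1 h2))
  rintro ω ⟨hB, h⟩
  by_cases h3 : g ω < f ω - ε / 2
  · exact Or.inl ⟨hB, h3⟩
  · exact Or.inr ⟨hB, by linarith [not_lt.mp h3]⟩

theorem NearlyDominated.of_approx {B : Set Ω} {𝒲 : Set (Ω → ℝ)} {f : Ω → ℝ}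
    (h : ∀ ε : ℝ, 0 < ε → ∃ g, NearlyDominated P B 𝒲 g ∧
      P {ω | ω ∈ B ∧ g ω < f ω - ε} ≤ ENNReal.ofReal ε) : NearlyDominated P B 𝒲 f := by
  intro ε hε
  obtain ⟨g, hg, h1⟩ := h (ε / 2) (by linarith)
  obtain ⟨W, hW, h2⟩ := hg (ε / 2) (by linarith)
  exact ⟨W, hW, measure_lt_sub_le_add hε h1 h2⟩

theorem NearlyDominated.trans {B : Set Ω} {𝒲 𝒲' : Set (Ω → ℝ)} {f : Ω → ℝ}
    (h : NearlyDominated P B 𝒲 f) (h' : ∀ W ∈ 𝒲, NearlyDominated P Set.univ 𝒲' W) :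
    NearlyDominated P B 𝒲' f :=
  NearlyDominated.of_approx fun ε hε => by
    obtain ⟨W, hW, h1⟩ := h ε hε
    exact ⟨W, (h' W hW).mono (Set.subset_univ _), h1⟩

/-! ### Wealth of the continuations of a strategy -/

theorem Market.ae_rate_nonneg (M : Market P T d) :
    ∀ᵐ ω ∂P, ∀ t, 1 ≤ t → t ≤ T → 0 ≤ M.rate t ω := by
  simp only [ae_all_iff]
  exact M.rate_nonneg

/-- The terminal wealths of the strategies that coincide with `N` before time `t`. -/
def futureWealth (M : Market P T d) (t : ℕ) (x : ℝ) (N : Positions Ω d) : Set (Ω → ℝ) :=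
  {W | ∃ N', IsStrategy M N' ∧ Agree P t N' N ∧ W = terminalWealth M x N'}

/-- The terminal wealths of the strategies that coincide with `N` up to time `t` apart from an
additional purchase from `𝒞` at time `t`. -/
def pooledWealth (M : Market P T d) (t : ℕ) (𝒞 : Set (Fin d → Ω → ℝ≥0)) (x : ℝ)
    (N : Positions Ω d) : Set (Ω → ℝ) :=
  {W | ∃ z ∈ 𝒞, ∃ N', IsStrategy M N' ∧ Agree P (t + 1) N' (N + hold T t z) ∧
    W = terminalWealth M x N'}

theorem measurable_terminalWealth {M : Market P T d} {N : Positions Ω d} (hN : IsStrategy M N)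
    (x : ℝ) : Measurable (terminalWealth M x N) :=
  (measurable_bank M hN x le_rfl).mono (M.filtration.le T) le_rfl

/-- Reacting to a continuation of `N` yields a continuation of the reaction to `N`, with no less
wealth. -/
theorem nearlyDominated_futureWealth_iterate {M : Market P T d} {R : ReactionFunction M} {x : ℝ}
    (hR : ∀ N, IsStrategy M N →
      ∀ᵐ ω ∂P, terminalWealth M x N ω ≤ terminalWealth M x (R.apply N) ω) (k : ℕ) {t : ℕ}
    {N : Positions Ω d} {B : Set Ω} {f : Ω → ℝ}
    (h : NearlyDominated P B (futureWealth M t x N) f) :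
    NearlyDominated P B (futureWealth M t x (R.apply^[k] N)) f := by
  refine h.trans ?_
  rintro _ ⟨N', h1, h2, rfl⟩
  refine NearlyDominated.of_mem (W := terminalWealth M x (R.apply^[k] N'))
    ⟨_, h1.iterate R k, h2.iterate R k, rfl⟩ ?_
  filter_upwards [terminalWealth_le_iterate hR h1 k] with ω h _ using h

/-- By superlinearity, a convex combination of two continuations reaches `f - ε / 2` wherever both
of them do, and its past is the convex combination of the pasts. -/
theorem convex_futureWealth (M : Market P T d) (t : ℕ) (x : ℝ) (B : Set Ω) (f : Ω → ℝ) :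
    Convex ℝ≥0 {N | NearlyDominated P B (futureWealth M t x N) f} := by
  intro N1 h1 N2 h2 a b _ _ hab ε hε
  obtain ⟨_, ⟨K1, s1, a1, rfl⟩, p1⟩ := h1 (ε / 2) (by linarith)
  obtain ⟨_, ⟨K2, s2, a2, rfl⟩, p2⟩ := h2 (ε / 2) (by linarith)
  have hab' : (a : ℝ) + b = 1 := by exact_mod_cast hab
  have hsum : ENNReal.ofReal ε = ENNReal.ofReal (ε / 2) + ENNReal.ofReal (ε / 2) := by
    rw [← ENNReal.ofReal_add (by linarith) (by linarith)]; congr 1; ring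
  refine ⟨_, ⟨a • K1 + b • K2, (s1.smul a).add (s2.smul b), ?_, rfl⟩, ?_⟩
  · filter_upwards [a1, a2] with ω a1 a2 i s j his hst
    simp only [Pi.add_apply, Pi.smul_apply, a1 i s j his hst, a2 i s j his hst]
  rw [hsum]
  have hnull := ae_iff.mp M.ae_rate_nonneg
  rw [← add_zero (ENNReal.ofReal (ε / 2) + _), ← hnull]
  refine (measure_mono ?_).trans ((measure_union_le _ _).trans
    (add_le_add ((measure_union_le _ _).trans (add_le_add p1 p2)) le_rfl))
  rintro ω ⟨hB, h⟩
  by_cases hr : ∀ t, 1 ≤ t → t ≤ T → 0 ≤ M.rate t ω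
  swap
  · exact Or.inr hr
  left
  by_contra h3
  have h4 : f ω - ε / 2 ≤ terminalWealth M x K1 ω := by
    by_contra h; exact h3 (Or.inl ⟨hB, not_le.mp h⟩)
  have h5 : f ω - ε / 2 ≤ terminalWealth M x K2 ω := by
    by_contra h; exact h3 (Or.inr ⟨hB, not_le.mp h⟩)
  have h6 := bank_superlinear M (N := K1) (N' := K2) (N'' := a • K1 + b • K2) (x := x) (x' := x)
    a.2 b.2 hr le_rfl (fun i s j _ _ => by simp)
  have e : (a : ℝ) * x + b * x = x := by rw [← add_mul, hab', one_mul]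
  simp only [NNReal.val_eq_coe, e] at h6
  change _ ≤ terminalWealth M x _ ω at h6
  have h7 := mul_le_mul_of_nonneg_left h4 a.2
  have h8 := mul_le_mul_of_nonneg_left h5 b.2
  simp only [NNReal.val_eq_coe] at h7 h8
  have h9 : (a : ℝ) * (f ω - ε / 2) + b * (f ω - ε / 2) = f ω - ε / 2 := by
    rw [← add_mul, hab', one_mul]
  simp only [terminalWealth] at *
  linarith

/-- Pool the given portfolio with one started from zero capital whose wealth is almost nonnegative.
By superlinearity the purchase of `w` then costs only a small error; the auxiliary purchases add up
within `𝒞`. -/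
theorem nearlyDominated_pooledWealth_add {M : Market P T d} {t : ℕ} {𝒞 : Set (Fin d → Ω → ℝ≥0)}
    (hadd : ∀ z ∈ 𝒞, ∀ z' ∈ 𝒞, z + z' ∈ 𝒞) {x : ℝ} {N : Positions Ω d} {w : Fin d → Ω → ℝ≥0}
    (hw : NearlyDominated P Set.univ (pooledWealth M t 𝒞 0 (hold T t w)) 0) {B : Set Ω}
    {f : Ω → ℝ} (h : NearlyDominated P B (pooledWealth M t 𝒞 x N) f) :
    NearlyDominated P B (pooledWealth M t 𝒞 x (N + hold T t w)) f := by
  refine h.trans ?_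
  rintro _ ⟨z, hz, K, s, a, rfl⟩ ε hε
  obtain ⟨_, ⟨z', hz', K', s', a', rfl⟩, p⟩ := hw ε hε
  refine ⟨_, ⟨z + z', hadd z hz z' hz', K + K', s.add s', ?_, rfl⟩, ?_⟩
  · rw [hold_add, add_add_add_comm]
    exact a.add a'
  have hnull := ae_iff.mp M.ae_rate_nonneg
  rw [← add_zero (ENNReal.ofReal ε), ← hnull]
  refine (measure_mono ?_).trans ((measure_union_le _ _).trans (add_le_add p le_rfl))
  rintro ω ⟨-, h⟩
  by_cases hr : ∀ t, 1 ≤ t → t ≤ T → 0 ≤ M.rate t ω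
  swap
  · exact Or.inr hr
  refine Or.inl ⟨trivial, ?_⟩
  have h6 := bank_superlinear M (N := K) (N' := K') (N'' := K + K') (x := x) (x' := 0) (a := 1)
    (b := 1) zero_le_one zero_le_one hr le_rfl (fun i s j _ _ => by simp)
  simp only [one_mul, add_zero] at h6
  simp only [terminalWealth, Pi.zero_apply] at *
  linarith

/-- A strategy without positions before time `t` does not hold shares that were purchased
before `t`. -/
theorem IsStrategy.eq_zero_of_agree_zero {M : Market P T d} {N : Positions Ω d}
    (hN : IsStrategy M N) {t : ℕ} (h : Agree P t N 0) :
    ∀ᵐ ω ∂P, ∀ i s j, i ≤ s → s ≤ T → i < t → N i s j ω = 0 := by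
  filter_upwards [h, hN.ae_antitone] with ω h ha i s j his hs hit
  rcases lt_or_ge s t with hst | hst
  · exact h i s j his hst
  · have h1 := le_of_antitone_path ha (i := i) (s := t - 1) (u := s) (by omega) (by omega) hs j
    rw [h i (t - 1) j (by omega) (by omega)] at h1
    exact le_antisymm h1 zero_le

theorem EventuallyDominated.mono_seq {B : Set Ω} {f : Ω → ℝ} {W W' : ℕ → Ω → ℝ}
    (h : EventuallyDominated P B W f)
    (h' : ∀ᵐ ω ∂P, ω ∈ B → ∀ δ : ℝ, 0 < δ → ∀ᶠ n in atTop, W n ω - δ ≤ W' n ω) :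
    EventuallyDominated P B W' f := by
  filter_upwards [h, h'] with ω h h' hB δ hδ
  filter_upwards [h hB (δ / 2) (by linarith), h' hB (δ / 2) (by linarith)] with n h1 h2
  linarith

/-- Adjusting the positions up to time `t` by asymptotically vanishing amounts does not change the
limit of the wealth. -/
theorem EventuallyDominated.graft {M : Market P T d} {t : ℕ} {x : ℝ}
    {p N : ℕ → Positions Ω d} (hN : ∀ n, IsStrategy M (N n)) {B : Set Ω} {f : Ω → ℝ}
    (h : EventuallyDominated P B (fun n => terminalWealth M x (N n)) f)
    (hp : ∀ᵐ ω ∂P, ω ∈ B → ∀ i s j, i ≤ s → s ≤ t →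
      Tendsto (fun n => (p n i s j ω : ℝ) - N n i s j ω) atTop (𝓝 0)) :
    EventuallyDominated P B (fun n => terminalWealth M x (graft t (p n) (N n))) f := by
  refine h.mono_seq ?_
  filter_upwards [hp, ae_all_iff.mpr fun n => (hN n).ae_antitone] with ω hp ha hB δ hδ
  obtain ⟨C, hC, hL⟩ := abs_bank_sub_le M ω T
  set D : ℕ → ℝ := fun n => ∑ i ∈ Finset.range (t + 1), ∑ s ∈ Finset.range (t + 1), ∑ j : Fin d,
    if i ≤ s then |(p n i s j ω : ℝ) - N n i s j ω| else 0 with hD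
  have hD0 : Tendsto D atTop (𝓝 0) := by
    have : (0 : ℝ) = ∑ i ∈ Finset.range (t + 1), ∑ s ∈ Finset.range (t + 1), ∑ j : Fin d, 0 := by
      simp
    rw [this]
    refine tendsto_finsetSum _ fun i hi => tendsto_finsetSum _ fun s hs =>
      tendsto_finsetSum _ fun j _ => ?_
    split_ifs with his
    · simpa using (hp hB i s j his (Nat.lt_succ_iff.mp (Finset.mem_range.mp hs))).abs
    · exact tendsto_const_nhds
  have hDle : ∀ n i s j, i ≤ s → s ≤ t → |(p n i s j ω : ℝ) - N n i s j ω| ≤ D n := by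
    intro n i s j his hst
    have hnn : ∀ i s (j : Fin d),
        0 ≤ if i ≤ s then |(p n i s j ω : ℝ) - N n i s j ω| else 0 := fun i s j => by
      split_ifs <;> positivity
    calc |(p n i s j ω : ℝ) - N n i s j ω|
        = if i ≤ s then |(p n i s j ω : ℝ) - N n i s j ω| else 0 := by rw [if_pos his]
      _ ≤ ∑ j : Fin d, if i ≤ s then |(p n i s j ω : ℝ) - N n i s j ω| else 0 :=
        Finset.single_le_sum (f := fun j =>
          if i ≤ s then |(p n i s j ω : ℝ) - N n i s j ω| else 0)
          (fun j _ => hnn i s j) (Finset.mem_univ j)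
      _ ≤ ∑ s ∈ Finset.range (t + 1), ∑ j : Fin d,
          if i ≤ s then |(p n i s j ω : ℝ) - N n i s j ω| else 0 :=
        Finset.single_le_sum (f := fun s => ∑ j : Fin d,
          if i ≤ s then |(p n i s j ω : ℝ) - N n i s j ω| else 0)
          (fun s _ => Finset.sum_nonneg fun j _ => hnn i s j) (Finset.mem_range.mpr (by omega))
      _ ≤ D n := Finset.single_le_sum (f := fun i => ∑ s ∈ Finset.range (t + 1), ∑ j : Fin d,
          if i ≤ s then |(p n i s j ω : ℝ) - N n i s j ω| else 0)
          (fun i _ => Finset.sum_nonneg fun s _ => Finset.sum_nonneg fun j _ => hnn i s j)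
          (Finset.mem_range.mpr (by omega))
  have hD00 : ∀ n, 0 ≤ D n := fun n => Finset.sum_nonneg fun i _ => Finset.sum_nonneg fun s _ =>
    Finset.sum_nonneg fun j _ => by split_ifs <;> positivity
  have hCD : Tendsto (fun n => C * D n) atTop (𝓝 0) := by simpa using hD0.const_mul C
  filter_upwards [hCD.eventually_le_const hδ] with n hn
  have h1 := hL (TaxModel.graft t (p n) (N n)) (N n) x x (D n) (by simpa using hD00 n)
    fun i s j his hs => abs_graft_sub_le (ha n) (hD00 n) (hDle n) i s j his hs
  have h2 := (abs_le.mp h1).1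
  simp only [terminalWealth]
  linarith

/-- Near-optimal continuations of `Y n` are grafted onto the limiting past `q`; by Lipschitz
continuity the loss vanishes. -/
theorem nearlyDominated_futureWealth_of_tendsto [IsProbabilityMeasure P] {M : Market P T d} {t : ℕ}
    (ht : t < T) {x : ℝ} {Y : ℕ → Positions Ω d} {q : Positions Ω d} (hq : IsStrategy M q)
    (hY : ∀ᵐ ω ∂P, ∀ i s j, i ≤ s → s ≤ t →
      Tendsto (fun n => Y n i s j ω) atTop (𝓝 (q i s j ω))) {f : Ω → ℝ} (hf : Measurable f)
    (h : ∀ n, NearlyDominated P Set.univ (futureWealth M (t + 1) x (Y n)) f) :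
    NearlyDominated P Set.univ (futureWealth M (t + 1) x q) f := by
  obtain ⟨W, hW, hd⟩ := NearlyDominated.exists_seq h
  choose N hN hag hWN using hW
  obtain rfl : W = fun n => terminalWealth M x (N n) := funext hWN
  have hg := hd.graft (t := t) (p := fun _ => q) hN (by
    filter_upwards [hY, ae_all_iff.mpr hag] with ω hY hag _ i s j his hst
    have h1 := (NNReal.tendsto_coe.mpr (hY i s j his hst)).const_sub (q i s j ω : ℝ)
    rw [sub_self] at h1
    refine h1.congr fun n => ?_
    rw [hag n i s j his (by omega)])
  exact hg.nearlyDominated MeasurableSet.univ hf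
    (fun n => ⟨_, hq.graft (hN n) ht, agree_graft t q (N n), rfl⟩)
    fun n => measurable_terminalWealth (hq.graft (hN n) ht) x

/-! ### Limits of strategies with bounded risk -/

/-- If `Y n → ∞` on part of `G`, then for every level `a` the probability of that part is at most
the supremum of `P(|X| > a)`, which tends to zero. -/
theorem ae_not_tendsto_atTop_of_isBoundedInProbability {A : Set (Ω → ℝ)}
    (hA : IsBoundedInProbability P A) {Y : ℕ → Ω → ℝ≥0} {G : Set Ω}
    (h : ∀ n, ∃ X ∈ A, ∀ᵐ ω ∂P, ω ∈ G → (Y n ω : ℝ) ≤ X ω) :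
    ∀ᵐ ω ∂P, ω ∈ G → ¬ Tendsto (fun n => (Y n ω : ℝ)) atTop atTop := by
  have key : ∀ a : ℝ, P {ω | ω ∈ G ∧ Tendsto (fun n => (Y n ω : ℝ)) atTop atTop} ≤
      ⨆ X ∈ A, P {ω | a < |X ω|} := by
    intro a
    set S : ℕ → Set Ω := fun m => {ω | ω ∈ G ∧ ∀ n, m ≤ n → a < (Y n ω : ℝ)} with hS
    have hmono : Monotone S := fun m m' hm ω hω => ⟨hω.1, fun n hn => hω.2 n (hm.trans hn)⟩
    have hsub : {ω | ω ∈ G ∧ Tendsto (fun n => (Y n ω : ℝ)) atTop atTop} ⊆ ⋃ m, S m := by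
      rintro ω ⟨hG, ht⟩
      obtain ⟨m, hm⟩ := eventually_atTop.mp (ht.eventually_gt_atTop a)
      exact Set.mem_iUnion.mpr ⟨m, hG, hm⟩
    refine (measure_mono hsub).trans ?_
    rw [hmono.measure_iUnion]
    refine iSup_le fun m => ?_
    obtain ⟨X, hX, hYX⟩ := h m
    refine le_trans (measure_mono_ae ?_) (le_iSup₂ (f := fun X _ => P {ω | a < |X ω|}) X hX)
    filter_upwards [hYX] with ω hω
    rintro ⟨hG, hm⟩
    exact (hm m le_rfl).trans_le ((hω hG).trans (le_abs_self _))
  have h0 := le_of_tendsto_of_tendsto' tendsto_const_nhds hA key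
  rw [ae_iff]
  refine measure_mono_null ?_ (le_antisymm h0 zero_le)
  intro ω hω
  simpa using hω

instance (t : ℕ) : Finite (TradeIndex t) :=
  Finite.of_injective
    (fun p : TradeIndex t => ((⟨p.1.1, p.2.1.trans_lt p.2.2⟩, ⟨p.1.2, p.2.2⟩) : Fin t × Fin t))
    fun p q h => by
      simp only [Prod.mk.injEq, Fin.mk.injEq] at h
      exact Subtype.ext (Prod.ext h.1 h.2)

/-- The positions before time `t`. -/
def positionsBefore (Ω : Type*) (t d : ℕ) :
    Positions Ω d →ₗ[ℝ≥0] (TradeIndex t × Fin d → Ω → ℝ≥0) where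
  toFun N k := N k.1.1.1 k.1.1.2 k.2
  map_add' _ _ := rfl
  map_smul' _ _ := rfl

/-! ### Bounding risk by cancelling purchases -/

/-- Every purchase at a time `i` is cancelled outside of the event `B i`. -/
noncomputable def cancel (B : ℕ → Set Ω) (N : Positions Ω d) : Positions Ω d :=
  scale (fun i _ => (B i).indicator 1) N

theorem cancel_of_mem {B : ℕ → Set Ω} {N : Positions Ω d} {i : ℕ} {ω : Ω} (h : ω ∈ B i) (s : ℕ)
    (j : Fin d) : cancel B N i s j ω = N i s j ω := by
  simp [cancel, scale, Set.indicator_of_mem h]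

theorem cancel_of_notMem {B : ℕ → Set Ω} {N : Positions Ω d} {i : ℕ} {ω : Ω} (h : ω ∉ B i) (s : ℕ)
    (j : Fin d) : cancel B N i s j ω = 0 := by
  simp [cancel, scale, Set.indicator_of_notMem h]

theorem IsStrategy.cancel {M : Market P T d} {N : Positions Ω d} (hN : IsStrategy M N)
    {B : ℕ → Set Ω} (hB : ∀ i, i ≤ T → MeasurableSet[M.filtration i] (B i)) :
    IsStrategy M (cancel B N) :=
  hN.scale fun i hi _ => Measurable.indicator measurable_const (hB i hi)

theorem Agree.cancel {t : ℕ} {N N' : Positions Ω d} (h : Agree P t N N') (B : ℕ → Set Ω) :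
    Agree P t (cancel B N) (cancel B N') := by
  filter_upwards [h] with ω h i s j his hst
  simp only [TaxModel.cancel, TaxModel.scale, h i s j his hst]

/-- The standing assumptions on prices and interest rates in the state `ω`, with bound `C` on the
rates. -/
def RegularAt (M : Market P T d) (C : ℝ) (ω : Ω) : Prop :=
  (∀ t, 1 ≤ t → t ≤ T → 0 ≤ M.rate t ω ∧ M.rate t ω ≤ C) ∧ ∀ s j, s ≤ T → 0 ≤ M.price s j ω

theorem exists_ae_regularAt (M : Market P T d)
    (hprice : ∀ t, t ≤ T → ∀ j, ∀ᵐ ω ∂P, 0 ≤ M.price t j ω)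
    (hrate : ∀ t, 1 ≤ t → t ≤ T → ∃ C : ℝ, ∀ᵐ ω ∂P, |M.rate t ω| ≤ C) :
    ∃ C : ℝ, 0 ≤ C ∧ ∀ᵐ ω ∂P, RegularAt M C ω := by
  have h1 : ∀ t, ∃ C : ℝ, 1 ≤ t → t ≤ T → ∀ᵐ ω ∂P, |M.rate t ω| ≤ C := by
    intro t
    by_cases h : 1 ≤ t ∧ t ≤ T
    · obtain ⟨C, hC⟩ := hrate t h.1 h.2
      exact ⟨C, fun _ _ => hC⟩
    · exact ⟨0, fun h2 h3 => absurd ⟨h2, h3⟩ h⟩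
  choose C hC using h1
  refine ⟨∑ t ∈ Finset.range (T + 1), |C t|, Finset.sum_nonneg fun _ _ => abs_nonneg _, ?_⟩
  have h2 : ∀ᵐ ω ∂P, ∀ t, 1 ≤ t → t ≤ T → |M.rate t ω| ≤ C t := by
    simp only [ae_all_iff]; exact hC
  have h3 : ∀ᵐ ω ∂P, ∀ t, t ≤ T → ∀ j, 0 ≤ M.price t j ω := by
    simp only [ae_all_iff]; exact hprice
  filter_upwards [h2, h3, M.ae_rate_nonneg] with ω h2 h3 h4
  refine ⟨fun t ht1 htT => ⟨h4 t ht1 htT, ?_⟩, fun s j hs => h3 s hs j⟩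
  refine (le_abs_self _).trans ((h2 t ht1 htT).trans ((le_abs_self _).trans ?_))
  exact Finset.single_le_sum (f := fun t => |C t|) (fun _ _ => abs_nonneg _)
    (Finset.mem_range.mpr (by omega))

/-- If purchases are cancelled once the debts exceed `K`, then wealth is bounded from below. -/
theorem terminalWealth_cancel_ge (M : Market P T d) {C x K : ℝ} (hC : 0 ≤ C) (hK : |x| ≤ K)
    {ω : Ω} (hω : RegularAt M C ω) {N : Positions Ω d}
    (hN : ∀ i s j, i ≤ s → s < T → N i (s + 1) j ω ≤ N i s j ω) {B : ℕ → Set Ω} (hB : Antitone B)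
    {t : ℕ} (ht : t ≤ T) (hBK : ∀ u, u < t → ω ∈ B u → -K ≤ bank M x N ω u) (hωB : ω ∉ B t) :
    -((1 + C) ^ T * K) ≤ terminalWealth M x (cancel B N) ω := by
  classical
  have hK0 : 0 ≤ K := (abs_nonneg x).trans hK
  have hanti : ∀ i s j, i ≤ s → s < T → cancel B N i (s + 1) j ω ≤ cancel B N i s j ω :=
    fun i s j his hs => mul_le_mul_right (hN i s j his hs) _
  -- Let `i0` be the first date whose event fails. Nothing is purchased from then on, and before
  -- then the strategy is `N`, with debts at most `K` at time `i0 - 1`. If `i0 = 0`, the initial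
  -- account is `x` itself.
  have hex : ∃ i, ω ∉ B i := ⟨t, hωB⟩
  have hi0 : ω ∉ B (Nat.find hex) := Nat.find_spec hex
  have hit : Nat.find hex ≤ t := Nat.find_min' hex hωB
  have hmin : ∀ i, i < Nat.find hex → ω ∈ B i := fun i hi => not_not.mp (Nat.find_min hex hi)
  have hge : ∀ i, Nat.find hex ≤ i → ∀ s j, cancel B N i s j ω = 0 := fun i hi s j =>
    cancel_of_notMem (fun h => hi0 (hB hi h)) s j
  generalize Nat.find hex = i0 at *
  cases i0 with
  | zero =>
    refine bank_ge_of_no_purchase M hC hω.1 hω.2 hanti (u := 0)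
      (fun i j hi _ => hge i (by omega) i j) hK0 ?_ (Nat.zero_le T) le_rfl
    have : tradeCash M (cancel B N) ω 0 = 0 := by
      simp [tradeCash, hge 0 le_rfl]
    simp only [bank, bankState, this, add_zero]
    exact (abs_le.mp hK).1
  | succ u =>
    refine bank_ge_of_no_purchase M hC hω.1 hω.2 hanti (u := u)
      (fun i j hi _ => hge i hi i j) hK0 ?_ (by omega) le_rfl
    have h1 := hBK u (by omega) (hmin u (by omega))
    rwa [bank, bankState_congr M x (N' := N) fun i s j his hs =>
      cancel_of_mem (hmin i (by omega)) s j]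

/-! ### The induction statement and limits under NUIBR -/

/-- Every random variable that is nearly dominated by continuations of `N` after the time `t` is
dominated by the wealth of a strategy starting with the `k`-fold reaction to `N`. -/
def Attains (M : Market P T d) (x : ℝ) (R : ReactionFunction M) (t k : ℕ) : Prop :=
  ∀ N, IsStrategy M N → ∀ f : Ω → ℝ, Measurable f →
    NearlyDominated P Set.univ (futureWealth M t x N) f →
      ∃ N', IsStrategy M N' ∧ Agree P t N' (R.apply^[k] N) ∧
        ∀ᵐ ω ∂P, f ω ≤ terminalWealth M x N' ω

/-- The properties of the reaction function in NUIBR. -/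
structure IsSubstitution (M : Market P T d) (x : ℝ) (R : ReactionFunction M) : Prop where
  le : ∀ N, IsStrategy M N → ∀ᵐ ω ∂P, terminalWealth M x N ω ≤ terminalWealth M x (R.apply N) ω
  bounded : ∀ K : ℝ, 0 ≤ K → IsBoundedInProbability P (convexHull ℝ
    {X : Ω → ℝ | ∃ N, IsStrategy M N ∧ (∀ᵐ ω ∂P, -K ≤ terminalWealth M x N ω) ∧
      X = fun ω => (maxPurchase T (R.apply N) ω : ℝ)})

/-- Connects NUIBR with strategies whose risk is unbounded and whose wealth bound is only nearly
attained. Cancellation bounds the risk off `B t`; `Attains` replaces near domination by a genuine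
strategy `N`, bounded from below everywhere. Since `N` starts with `k` reactions to the cancelled
`q`, one more reaction is controlled by NUIBR and equals `k + 1` reactions to `q` on `B t`. -/
theorem exists_safe_of_attains {M : Market P T d} {x C : ℝ} {R : ReactionFunction M} {t k : ℕ}
    (ht : t < T) (hC : 0 ≤ C) (hreg : ∀ᵐ ω ∂P, RegularAt M C ω) (hatt : Attains M x R (t + 1) k)
    {ν q : Positions Ω d} (hq : IsStrategy M q) (hqν : Agree P t q ν)
    {h : Ω → ℝ} (hm : Measurable h)
    (hd : NearlyDominated P Set.univ (futureWealth M (t + 1) x q) h)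
    {K : ℝ} (hK : |x| ≤ K) {B : ℕ → Set Ω} (hB : Antitone B)
    (hBm : ∀ i, i ≤ T → MeasurableSet[M.filtration i] (B i)) (hBt : ∀ i, t ≤ i → B i = B t)
    (hBK : ∀ u, u < t → ∀ ω ∈ B u, -K ≤ bank M x ν ω u)
    (hhK : ∀ᵐ ω ∂P, ω ∈ B t → -K ≤ h ω) :
    ∃ N, IsStrategy M N ∧ (∀ᵐ ω ∂P, -((1 + C) ^ T * K) ≤ terminalWealth M x N ω) ∧
      ∀ᵐ ω ∂P, ω ∈ B t → ∀ i s j, i ≤ s → s ≤ t →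
        R.apply^[k + 1] q i s j ω = R.apply N i s j ω := by
  classical
  have hK0 : 0 ≤ K := (abs_nonneg x).trans hK
  set L := (1 + C) ^ T * K with hL
  have hKL : K ≤ L := le_mul_of_one_le_left hK0 (one_le_pow₀ (by linarith))
  have hBtm : MeasurableSet (B t) := M.filtration.le t _ (hBm t ht.le)
  -- On `B t` no purchase of a continuation is cancelled, so it still nearly dominates `h`; off `B
  -- t` the cancelled continuation has wealth at least `-L`.
  set hK' : Ω → ℝ := (B t).piecewise h fun _ => -L with hhK'
  have hdom : NearlyDominated P Set.univ (futureWealth M (t + 1) x (cancel B q)) hK' := by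
    intro ε hε
    obtain ⟨_, ⟨N, hN, hag, rfl⟩, hP⟩ := hd ε hε
    refine ⟨_, ⟨cancel B N, hN.cancel hBm, hag.cancel B, rfl⟩, le_trans (measure_mono_ae ?_) hP⟩
    filter_upwards [hreg, hN.ae_antitone, hag, hqν] with ω h1 h2 h3 h4
    rintro ⟨-, h5⟩
    by_cases hω : ω ∈ B t
    · refine ⟨trivial, ?_⟩
      have e : terminalWealth M x (cancel B N) ω = terminalWealth M x N ω := by
        rw [terminalWealth, bank, bankState_congr M x (N' := N)]; rfl
        intro i s j _ _
        refine cancel_of_mem ?_ s j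
        rcases le_total t i with h | h
        · rwa [hBt i h]
        · exact hB h hω
      rwa [e, hhK', Set.piecewise_eq_of_mem _ _ _ hω] at h5
    · exfalso
      have h6 := terminalWealth_cancel_ge M hC hK h1 h2 hB ht.le (fun u hu hωu => by
        have := hBK u hu ω hωu
        rwa [bank, bankState_congr M x (N' := ν) fun i s j his hs =>
          (h3 i s j his (by omega)).trans (h4 i s j his (by omega))]) hω
      rw [hhK', Set.piecewise_eq_of_notMem _ _ _ hω] at h5
      linarith
  obtain ⟨N, hN, hag, hle⟩ := hatt _ (hq.cancel hBm) hK' (hm.piecewise hBtm measurable_const) hdom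
  refine ⟨N, hN, ?_, ?_⟩
  · filter_upwards [hle, hhK] with ω h1 h2
    refine le_trans ?_ h1
    by_cases hω : ω ∈ B t
    · rw [hhK', Set.piecewise_eq_of_mem _ _ _ hω]; linarith [h2 hω]
    · rw [hhK', Set.piecewise_eq_of_notMem _ _ _ hω]
  · filter_upwards [hag] with ω h1 hω i s j his hst
    rw [R.apply_congr h1 i s j his (by omega), ← Function.iterate_succ_apply' R.apply]
    refine R.iterate_congr (k + 1) (t := t + 1) ?_ i s j his (by omega)
    intro i s j his hs
    exact (cancel_of_mem (hB (by omega) hω) s j).symm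

/-- A single past `q'` does asymptotically at least as well as the whole sequence `q n`. The common
lower bound `h` gives bounded risk on events exhausting `Ω`, so by NUIBR convex combinations of the
reactions `R^[k + 1] (q n)` are kept from infinity and converge; convexity of near domination passes
to the limit. -/
theorem exists_limit_of_attains [IsProbabilityMeasure P] {M : Market P T d} {x C : ℝ}
    {R : ReactionFunction M} (hR : IsSubstitution M x R) {t k : ℕ} (ht : t < T) (hC : 0 ≤ C)
    (hreg : ∀ᵐ ω ∂P, RegularAt M C ω) (hatt : Attains M x R (t + 1) k)
    {ν : Positions Ω d} (hν : IsStrategy M ν) {q : ℕ → Positions Ω d}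
    (hq : ∀ n, IsStrategy M (q n)) (hqν : ∀ n, Agree P t (q n) ν) {h H : Ω → ℝ}
    (hm : Measurable h) (hH : Measurable[M.filtration t] H) (hHh : ∀ᵐ ω ∂P, -H ω ≤ h ω)
    (hd : ∀ n, NearlyDominated P Set.univ (futureWealth M (t + 1) x (q n)) h) :
    ∃ q', IsStrategy M q' ∧ Agree P t q' (R.apply^[k + 1] ν) ∧
      ∀ f : Ω → ℝ, Measurable f →
        (∀ᶠ n in atTop, NearlyDominated P Set.univ (futureWealth M (t + 1) x (q n)) f) →
        NearlyDominated P Set.univ (futureWealth M (t + 1) x q') f := by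
  set p : ℕ → Positions Ω d := fun n => R.apply^[k + 1] (q n) with hp
  have hps : ∀ n, IsStrategy M (p n) := fun n => (hq n).iterate R (k + 1)
  have hpν : ∀ n, Agree P t (p n) (R.apply^[k + 1] ν) := fun n => (hqν n).iterate R (k + 1)
  obtain ⟨Y, hY, hYc⟩ := exists_convexHull_cauchySeq_exp (P := P) (positionsBefore Ω (t + 1) d) p
    fun n k => ((hps n).adapted _ _ k.1.2.1 ((Nat.lt_succ_iff.mp k.1.2.2).trans ht.le) k.2).mono
      (M.filtration.le _) le_rfl
  have hYs : ∀ n, IsStrategy M (Y n) := fun n =>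
    convexHull_min (by rintro _ ⟨m, -, rfl⟩; exact hps m) (convex_isStrategy M) (hY n)
  have hYν : ∀ n, Agree P t (Y n) (R.apply^[k + 1] ν) := fun n =>
    convexHull_min (by rintro _ ⟨m, -, rfl⟩; exact hpν m) (convex_agree t _) (hY n)
  -- the events on which debts are bounded
  set B : ℝ → ℕ → Set Ω := fun K s =>
    {ω | (∀ u, u ≤ s → u < t → -K ≤ bank M x ν ω u) ∧ (t ≤ s → H ω ≤ K)} with hBdef
  have hBanti : ∀ K, Antitone (B K) := fun K s s' hs ω hω =>
    ⟨fun u hu hut => hω.1 u (hu.trans hs) hut, fun hts => hω.2 (hts.trans hs)⟩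
  have hBm : ∀ K i, i ≤ T → MeasurableSet[M.filtration i] (B K i) := by
    intro K i hi
    have e : B K i = (⋂ u, ⋂ (_ : u ≤ i ∧ u < t), {ω | -K ≤ bank M x ν ω u}) ∩
        ⋂ (_ : t ≤ i), {ω | H ω ≤ K} := by
      ext ω
      rw [Set.mem_inter_iff, Set.mem_iInter₂, Set.mem_iInter]
      exact ⟨fun h => ⟨fun u hu => h.1 u hu.1 hu.2, h.2⟩,
        fun h => ⟨fun u hu hut => h.1 u ⟨hu, hut⟩, h.2⟩⟩
    rw [e]
    refine MeasurableSet.inter (MeasurableSet.iInter fun u => MeasurableSet.iInter fun hu => ?_)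
      (MeasurableSet.iInter fun hti => ?_)
    · exact M.filtration.mono hu.1 _ (measurableSet_le measurable_const
        (measurable_bank M hν x (hu.1.trans hi)))
    · exact M.filtration.mono hti _ (measurableSet_le hH measurable_const)
  have hBt : ∀ K i, t ≤ i → B K i = B K t := by
    intro K i hi
    ext ω
    exact ⟨fun hω => hBanti K hi hω, fun hω => ⟨fun u _ hut => hω.1 u hut.le hut,
      fun _ => hω.2 le_rfl⟩⟩
  have hBex : ∀ ω, ∃ n : ℕ, ω ∈ B (|x| + n) t := by
    intro ω
    obtain ⟨n, hn⟩ := exists_nat_ge (∑ u ∈ Finset.range t, |bank M x ν ω u| + |H ω|)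
    have h0 : 0 ≤ ∑ u ∈ Finset.range t, |bank M x ν ω u| :=
      Finset.sum_nonneg fun _ _ => abs_nonneg _
    refine ⟨n, fun u _ hut => ?_, fun _ => ?_⟩
    · have h1 := Finset.single_le_sum (f := fun u => |bank M x ν ω u|)
        (fun _ _ => abs_nonneg _) (Finset.mem_range.mpr hut)
      linarith [abs_nonneg x, abs_nonneg (H ω), neg_abs_le (bank M x ν ω u)]
    · linarith [abs_nonneg x, le_abs_self (H ω)]
  have hbounded : ∀ (K : ℝ), |x| ≤ K → ∀ᵐ ω ∂P, ω ∈ B K t → ∀ i s j, i ≤ s → s ≤ t →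
      ¬ Tendsto (fun n => (Y n i s j ω : ℝ)) atTop atTop := by
    intro K hK
    have hL : 0 ≤ (1 + C) ^ T * K := by
      have := (abs_nonneg x).trans hK
      positivity
    have hsafe := fun n => exists_safe_of_attains ht hC hreg hatt (hq n) (hqν n) hm (hd n) hK
      (hBanti K) (hBm K) (hBt K) (fun u hu ω hω => hω.1 u le_rfl hu) (by
        filter_upwards [hHh] with ω h1 hω
        linarith [hω.2 le_rfl])
    choose S hS hSK hSp using hsafe
    have hXex : ∀ n, ∃ X ∈ convexHull ℝ {X : Ω → ℝ | ∃ N, IsStrategy M N ∧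
        (∀ᵐ ω ∂P, -((1 + C) ^ T * K) ≤ terminalWealth M x N ω) ∧
          X = fun ω => (maxPurchase T (R.apply N) ω : ℝ)},
        ∀ᵐ ω ∂P, ω ∈ B K t → ∀ i s j, i ≤ s → s ≤ t → (Y n i s j ω : ℝ) ≤ X ω := by
      intro n
      refine convexHull_min (t := {N : Positions Ω d | ∃ X ∈ convexHull ℝ {X : Ω → ℝ |
        ∃ N, IsStrategy M N ∧ (∀ᵐ ω ∂P, -((1 + C) ^ T * K) ≤ terminalWealth M x N ω) ∧
          X = fun ω => (maxPurchase T (R.apply N) ω : ℝ)},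
        ∀ᵐ ω ∂P, ω ∈ B K t → ∀ i s j, i ≤ s → s ≤ t → (N i s j ω : ℝ) ≤ X ω}) ?_ ?_ (hY n)
      · rintro _ ⟨m, -, rfl⟩
        refine ⟨_, subset_convexHull _ _ ⟨S m, hS m, hSK m, rfl⟩, ?_⟩
        filter_upwards [hSp m, (hps m).ae_antitone] with ω h1 h2 hω i s j his hst
        have h3 : p m i s j ω ≤ p m i i j ω :=
          le_of_antitone_path h2 le_rfl his (hst.trans ht.le) j
        have h4 : p m i i j ω = R.apply (S m) i i j ω := h1 hω i i j le_rfl (his.trans hst)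
        have h5 : R.apply (S m) i i j ω ≤ maxPurchase T (R.apply (S m)) ω := by
          unfold maxPurchase
          exact Finset.le_sup (f := fun p : ℕ × Fin d => R.apply (S m) p.1 p.1 p.2 ω)
            (show (i, j) ∈ _ from Finset.mem_product.mpr
              ⟨Finset.mem_range.mpr (his.trans_lt (hst.trans_lt ht)), Finset.mem_univ _⟩)
        exact_mod_cast h3.trans (h4.le.trans h5)
      · rintro N1 ⟨X1, hX1, h1⟩ N2 ⟨X2, hX2, h2⟩ a b _ _ hab
        refine ⟨(a : ℝ) • X1 + (b : ℝ) • X2, convex_convexHull ℝ _ hX1 hX2 a.2 b.2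
          (by exact_mod_cast hab), ?_⟩
        filter_upwards [h1, h2] with ω h1 h2 hω i s j his hst
        simp only [Pi.add_apply, Pi.smul_apply, smul_eq_mul, NNReal.coe_add, NNReal.coe_mul]
        exact add_le_add (mul_le_mul_of_nonneg_left (h1 hω i s j his hst) a.2)
          (mul_le_mul_of_nonneg_left (h2 hω i s j his hst) b.2)
    have hnt : ∀ i s j, i ≤ s → s ≤ t → ∀ᵐ ω ∂P, ω ∈ B K t →
        ¬ Tendsto (fun n => (Y n i s j ω : ℝ)) atTop atTop := fun i s j his hst =>
      ae_not_tendsto_atTop_of_isBoundedInProbability (hR.bounded _ hL) fun n => by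
        obtain ⟨X, hX, h1⟩ := hXex n
        exact ⟨X, hX, by filter_upwards [h1] with ω h1 hω using h1 hω i s j his hst⟩
    have hnt' : ∀ᵐ ω ∂P, ∀ i s j, i ≤ s → s ≤ t → ω ∈ B K t →
        ¬ Tendsto (fun n => (Y n i s j ω : ℝ)) atTop atTop := by
      simp only [ae_all_iff]; exact hnt
    filter_upwards [hnt'] with ω h1 hω i s j his hst using h1 i s j his hst hω
  have hconv : ∀ᵐ ω ∂P, ∀ i s j, i ≤ s → s ≤ t →
      ∃ l : ℝ≥0, Tendsto (fun n => Y n i s j ω) atTop (𝓝 l) := by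
    have h1 : ∀ᵐ ω ∂P, ∀ n : ℕ, ω ∈ B (|x| + n) t → ∀ i s j, i ≤ s → s ≤ t →
        ¬ Tendsto (fun n => (Y n i s j ω : ℝ)) atTop atTop :=
      ae_all_iff.mpr fun n => hbounded _ (by simp)
    filter_upwards [h1, ae_all_iff.mpr hYc] with ω h1 h2 i s j his hst
    obtain ⟨n, hn⟩ := hBex ω
    exact exists_tendsto_of_cauchySeq_exp (h2 (⟨(i, s), his, Nat.lt_succ_iff.mpr hst⟩, j))
      (h1 n hn i s j his hst)
  have hq' := isStrategy_limitHold ht hYs hconv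
  refine ⟨limitHold T t Y, hq', ?_, fun f hf hev => ?_⟩
  · filter_upwards [hconv, ae_all_iff.mpr hYν] with ω h1 h2 i s j his hst
    refine tendsto_nhds_unique (limitHold_path ht h1 i s j his hst.le) ?_
    simp only [h2 _ i s j his hst, tendsto_const_nhds]
  · obtain ⟨n0, hn0⟩ := eventually_atTop.mp hev
    refine nearlyDominated_futureWealth_of_tendsto (Y := fun n => Y (n + n0)) ht hq' ?_ hf
      fun n => ?_
    · filter_upwards [hconv] with ω h1 i s j his hst
      exact (limitHold_path ht h1 i s j his hst).comp (tendsto_add_atTop_nat n0)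
    · refine convexHull_min ?_ (convex_futureWealth M (t + 1) x Set.univ f) (hY (n + n0))
      rintro _ ⟨m, hm, rfl⟩
      have hm : n + n0 ≤ m := hm
      exact nearlyDominated_futureWealth_iterate hR.le (k + 1) (hn0 m (by omega))

/-! ### Cones of asymptotically worthless purchases -/

/-- A set of purchases at time `t` which is stable under addition, under scaling with
`𝓕_t`-measurable factors and under countable `𝓕_t`-measurable gluing. -/
structure IsScaleCone (M : Market P T d) (t : ℕ) (𝒞 : Set (Fin d → Ω → ℝ≥0)) : Prop where
  measurable : ∀ z ∈ 𝒞, ∀ j, Measurable[M.filtration t] (z j)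
  zero_mem : 0 ∈ 𝒞
  add_mem : ∀ z ∈ 𝒞, ∀ z' ∈ 𝒞, z + z' ∈ 𝒞
  smul_mem : ∀ z ∈ 𝒞, ∀ c : Ω → ℝ≥0, Measurable[M.filtration t] c → (fun j => c * z j) ∈ 𝒞
  glue_mem : ∀ z : ℕ → Fin d → Ω → ℝ≥0, (∀ n, z n ∈ 𝒞) → ∀ κ : Ω → ℕ,
    Measurable[M.filtration t] κ → (fun j ω => z (κ ω) j ω) ∈ 𝒞

theorem isScaleCone_zero (M : Market P T d) (t : ℕ) : IsScaleCone M t {0} where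
  measurable := by rintro _ rfl j; exact measurable_const
  zero_mem := rfl
  add_mem := by rintro _ rfl _ rfl; simp
  smul_mem := by
    rintro _ rfl c _
    funext j ω; simp
  glue_mem := by
    intro z hz κ _
    funext j ω
    rw [Set.mem_singleton_iff.mp (hz (κ ω))]

/-- Add the multiples of `w` to the cone `𝒞`. -/
def adjoin (M : Market P T d) (t : ℕ) (𝒞 : Set (Fin d → Ω → ℝ≥0)) (w : Fin d → Ω → ℝ≥0) :
    Set (Fin d → Ω → ℝ≥0) :=
  {z' | ∃ z ∈ 𝒞, ∃ c : Ω → ℝ≥0, Measurable[M.filtration t] c ∧ z' = fun j => z j + c * w j}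

theorem IsScaleCone.adjoin {M : Market P T d} {t : ℕ} {𝒞 : Set (Fin d → Ω → ℝ≥0)}
    (h𝒞 : IsScaleCone M t 𝒞) {w : Fin d → Ω → ℝ≥0} (hw : ∀ j, Measurable[M.filtration t] (w j)) :
    IsScaleCone M t (adjoin M t 𝒞 w) where
  measurable := by
    rintro _ ⟨z, hz, c, hc, rfl⟩ j
    exact (h𝒞.measurable z hz j).add (hc.mul (hw j))
  zero_mem := ⟨0, h𝒞.zero_mem, 0, measurable_const, by funext j; simp⟩
  add_mem := by
    rintro _ ⟨z, hz, c, hc, rfl⟩ _ ⟨z', hz', c', hc', rfl⟩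
    refine ⟨z + z', h𝒞.add_mem z hz z' hz', c + c', hc.add hc', ?_⟩
    funext j
    simp only [Pi.add_apply]; ring
  smul_mem := by
    rintro _ ⟨z, hz, c, hc, rfl⟩ a ha
    refine ⟨_, h𝒞.smul_mem z hz a ha, a * c, ha.mul hc, ?_⟩
    funext j
    ring
  glue_mem := by
    intro z hz κ hκ
    choose u hu c hc huc using hz
    refine ⟨_, h𝒞.glue_mem u hu κ hκ, fun ω => c (κ ω) ω, measurable_glue hκ hc, ?_⟩
    funext j ω
    rw [huc]; rfl

theorem pooledWealth_zero (M : Market P T d) (t : ℕ) (x : ℝ) (N : Positions Ω d) :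
    pooledWealth M t {0} x N = futureWealth M (t + 1) x N := by
  have h0 : hold T t (0 : Fin d → Ω → ℝ≥0) = 0 := by
    funext i s j ω; simp [hold]
  ext W
  constructor
  · rintro ⟨_, rfl, N', h1, h2, h3⟩
    rw [h0, add_zero] at h2
    exact ⟨N', h1, h2, h3⟩
  · rintro ⟨N', h1, h2, h3⟩
    exact ⟨0, rfl, N', h1, by rwa [h0, add_zero], h3⟩

/-- Starting without capital and buying `w` at time `t`, one almost does not lose money if one
additionally chooses suitable purchases from `𝒞`. -/
def NullDirection (M : Market P T d) (t : ℕ) (𝒞 : Set (Fin d → Ω → ℝ≥0)) (w : Fin d → Ω → ℝ≥0) :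
    Prop :=
  NearlyDominated P Set.univ (pooledWealth M t 𝒞 0 (hold T t w)) 0

theorem agree_zero_of_agree_hold {t : ℕ} {N : Positions Ω d} {w z : Fin d → Ω → ℝ≥0}
    (h : Agree P (t + 1) N (hold T t w + hold T t z)) : Agree P t N 0 := by
  have h1 := (agree_hold (P := P) (T := T) t w).add (agree_hold (P := P) (T := T) t z)
  rw [add_zero] at h1
  exact (h.mono (Nat.le_succ t)).trans h1

/-- Multiply all purchases from time `t` on by `c` and cancel the earlier ones. -/
noncomputable def scaleFrom (t : ℕ) (c : Ω → ℝ≥0) (N : Positions Ω d) : Positions Ω d :=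
  scale (fun i _ => if t ≤ i then c else 0) N

theorem IsStrategy.scaleFrom {M : Market P T d} {N : Positions Ω d} (hN : IsStrategy M N) {t : ℕ}
    {c : Ω → ℝ≥0} (hc : Measurable[M.filtration t] c) : IsStrategy M (scaleFrom t c N) :=
  hN.scale fun i _ _ => by
    split_ifs with h
    · exact hc.mono (M.filtration.mono h) le_rfl
    · exact measurable_const

/-- Wealth from zero capital scales pathwise at least linearly, so even a random `𝓕_t`-measurable
factor keeps losses asymptotically nonpositive. Almost-sure domination is essential here, since the
factor may be unbounded. -/
theorem NullDirection.smul [IsProbabilityMeasure P] {M : Market P T d} {t : ℕ}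
    {𝒞 : Set (Fin d → Ω → ℝ≥0)} (h𝒞 : IsScaleCone M t 𝒞) {w : Fin d → Ω → ℝ≥0}
    (h : NullDirection M t 𝒞 w) {c : Ω → ℝ≥0} (hc : Measurable[M.filtration t] c) :
    NullDirection M t 𝒞 (fun j => c * w j) := by
  obtain ⟨W, hW, hd⟩ := NearlyDominated.exists_seq (𝒲 := fun _ => _) fun _ : ℕ => h
  choose z hz N hN hag hWN using hW
  obtain rfl : W = fun n => terminalWealth M 0 (N n) := funext hWN
  have hs := fun n => (hN n).scaleFrom hc
  refine EventuallyDominated.nearlyDominated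
    (W := fun n => terminalWealth M 0 (scaleFrom t c (N n))) ?_ MeasurableSet.univ
    measurable_const (fun n => ⟨_, h𝒞.smul_mem _ (hz n) c hc, _, hs n, ?_, rfl⟩)
    fun n => measurable_terminalWealth (hs n) 0
  · filter_upwards [hd, M.ae_rate_nonneg, ae_all_iff.mpr fun n =>
      (hN n).eq_zero_of_agree_zero (agree_zero_of_agree_hold (hag n))] with ω h1 h2 h3 _ δ hδ
    have hpos : (0 : ℝ) < c ω + 1 := by positivity
    -- The tolerance is divided by `c ω + 1` rather than `c ω`, which may vanish.
    filter_upwards [h1 trivial (δ / (c ω + 1)) (by positivity)] with n hn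
    have h6 := bank_superlinear M (N := N n) (N' := N n) (N'' := scaleFrom t c (N n)) (x := 0)
      (x' := 0) (a := c ω) (b := 0) (c ω).2 le_rfl h2 le_rfl (fun i s j his hs => by
        simp only [scaleFrom, scale]
        split_ifs with h
        · simp
        · simp [h3 n i s j his hs (not_le.mp h)])
    simp only [mul_zero, zero_mul, add_zero] at h6
    simp only [Pi.zero_apply, zero_sub, terminalWealth] at hn ⊢
    have h7 := mul_le_mul_of_nonneg_left hn (c ω).2
    simp only [NNReal.val_eq_coe] at h7
    have h8 : (c ω : ℝ) * -(δ / (c ω + 1)) ≥ -δ := by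
      have e : (c ω : ℝ) * -(δ / (c ω + 1)) = -δ + δ / (c ω + 1) := by field_simp; ring
      rw [e]
      have : 0 ≤ δ / (c ω + 1) := by positivity
      linarith
    linarith
  · filter_upwards [hag n] with ω h1 i s j his hst
    simp only [scaleFrom, scale, h1 i s j his hst, Pi.add_apply, hold, Pi.mul_apply]
    split_ifs <;> first | omega | simp [mul_add]

/-- Whatever is nearly dominated with the help of purchases from `𝒞` at time `t` is nearly dominated
by the continuations of a single strategy starting with the `k`-fold reaction. -/
def IsAttainableCone (M : Market P T d) (x : ℝ) (R : ReactionFunction M) (t k : ℕ)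
    (𝒞 : Set (Fin d → Ω → ℝ≥0)) : Prop :=
  ∀ N, IsStrategy M N → ∃ q, IsStrategy M q ∧ Agree P t q (R.apply^[k] N) ∧
    ∀ f : Ω → ℝ, Measurable f → NearlyDominated P Set.univ (pooledWealth M t 𝒞 x N) f →
      NearlyDominated P Set.univ (futureWealth M (t + 1) x q) f

theorem isAttainableCone_zero (M : Market P T d) (x : ℝ) (R : ReactionFunction M) (t : ℕ) :
    IsAttainableCone M x R t 0 {0} := fun N hN =>
  ⟨N, hN, Agree.refl t N, fun f _ h => by rwa [pooledWealth_zero] at h⟩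

/-- The cone property concerns domination on all of `Ω`. It is applied to the dominating wealths
themselves, with one `q` serving all of them, which localizes it to the event `B`. -/
theorem IsAttainableCone.exists_nearlyDominated {M : Market P T d} {x : ℝ} {R : ReactionFunction M}
    {t k : ℕ} {𝒞 : Set (Fin d → Ω → ℝ≥0)} (h : IsAttainableCone M x R t k 𝒞)
    {N : Positions Ω d} (hN : IsStrategy M N) {B : Set Ω} {f : Ω → ℝ}
    (hf : NearlyDominated P B (pooledWealth M t 𝒞 x N) f) :
    ∃ q, IsStrategy M q ∧ Agree P t q (R.apply^[k] N) ∧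
      NearlyDominated P B (futureWealth M (t + 1) x q) f := by
  obtain ⟨q, h1, h2, h3⟩ := h N hN
  refine ⟨q, h1, h2, hf.trans ?_⟩
  rintro _ ⟨z, hz, N', s, a, rfl⟩
  exact h3 _ (measurable_terminalWealth s x)
    (NearlyDominated.of_mem ⟨z, hz, N', s, a, rfl⟩ (ae_of_all _ fun _ _ => le_rfl))

theorem exists_nat_measure_lt_le [IsFiniteMeasure P] {c : Ω → ℝ≥0} (hc : Measurable c) {ε : ℝ}
    (hε : 0 < ε) : ∃ n : ℕ, P {ω | (n : ℝ≥0) < c ω} ≤ ENNReal.ofReal ε := by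
  have h := tendsto_measure_iInter_atTop (μ := P) (s := fun n : ℕ => {ω | (n : ℝ≥0) < c ω})
    (fun n => (measurableSet_lt measurable_const hc).nullMeasurableSet)
    (fun m n hmn ω (hω : (n : ℝ≥0) < c ω) =>
      show (m : ℝ≥0) < c ω from lt_of_le_of_lt (by exact_mod_cast hmn) hω)
    ⟨0, measure_ne_top _ _⟩
  have e : (⋂ n : ℕ, {ω | (n : ℝ≥0) < c ω}) = ∅ := by
    refine Set.eq_empty_of_forall_notMem fun ω hω => ?_
    obtain ⟨n, hn⟩ := exists_nat_ge (c ω)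
    exact absurd (Set.mem_iInter.mp hω n) (not_lt.mpr hn)
  rw [e, measure_empty] at h
  exact (h.eventually_le_const (by simpa using hε)).exists

/-- A cone of worthless purchases can be enlarged by a null direction. -/
theorem IsAttainableCone.adjoin [IsProbabilityMeasure P] {M : Market P T d} {x C : ℝ}
    {R : ReactionFunction M} (hR : IsSubstitution M x R) {t k : ℕ} (ht : t < T) (hC : 0 ≤ C)
    (hreg : ∀ᵐ ω ∂P, RegularAt M C ω) (hatt : Attains M x R (t + 1) k)
    {𝒞 : Set (Fin d → Ω → ℝ≥0)} (h𝒞 : IsScaleCone M t 𝒞) {l : ℕ}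
    (hl : IsAttainableCone M x R t l 𝒞) {w : Fin d → Ω → ℝ≥0}
    (hw : ∀ j, Measurable[M.filtration t] (w j)) (hnull : NullDirection M t 𝒞 w) :
    IsAttainableCone M x R t (k + 1 + l) (adjoin M t 𝒞 w) := by
  intro N hN
  have hcm : ∀ n : ℕ, Measurable[M.filtration t] fun _ : Ω => (n : ℝ≥0) := fun n =>
    measurable_const
  set u : ℕ → Fin d → Ω → ℝ≥0 := fun n j => (fun _ => (n : ℝ≥0)) * w j with hu
  have hum : ∀ n j, Measurable[M.filtration t] (u n j) := fun n j => (hcm n).mul (hw j)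
  have hNs : ∀ n, IsStrategy M (N + hold T t (u n)) := fun n => hN.add (isStrategy_hold M (hum n))
  choose q hq hqN hqf using fun n => hl _ (hNs n)
  have hqν : ∀ n, Agree P t (q n) (R.apply^[l] N) := fun n =>
    (hqN n).trans ((agree_add_hold t N (u n)).iterate R l)
  -- without further purchases, the risk of `N` is bounded
  set S : ℕ → Set Ω := fun i => if i ≤ t then Set.univ else ∅ with hS
  have hSs : IsStrategy M (cancel S N) := hN.cancel fun i _ => by
    simp only [hS]; split_ifs
    exacts [@MeasurableSet.univ _ (M.filtration i), @MeasurableSet.empty _ (M.filtration i)]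
  have hSpath : ∀ ω i s j, i ≤ t → cancel S N i s j ω = N i s j ω := fun ω i s j hi =>
    cancel_of_mem (by simp [hS, hi]) s j
  have hd : ∀ n, NearlyDominated P Set.univ (futureWealth M (t + 1) x (q n))
      (terminalWealth M x (cancel S N)) := by
    -- Buying the null direction `n w` costs almost nothing, so the wealth of `N` without later
    -- purchases is a lower bound common to all `n`.
    intro n
    refine hqf n _ (measurable_terminalWealth hSs x) ?_
    refine nearlyDominated_pooledWealth_add h𝒞.add_mem (hnull.smul h𝒞 (hcm n)) ?_
    refine NearlyDominated.of_mem ⟨0, h𝒞.zero_mem, _, hSs, ?_, rfl⟩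
      (ae_of_all _ fun _ _ => le_rfl)
    refine ae_of_all _ fun ω i s j his hst => ?_
    rw [hSpath ω i s j (by omega)]
    simp [hold]
  have hH : Measurable[M.filtration t] fun ω => (1 + C) ^ T * |bank M x N ω t| :=
    (continuous_abs.measurable.comp (measurable_bank M hN x ht.le)).const_mul _
  obtain ⟨q', hq', hq'ν, hq'f⟩ := exists_limit_of_attains hR ht hC hreg hatt (hN.iterate R l) hq
    hqν (measurable_terminalWealth hSs x) hH (by
      filter_upwards [hreg, hSs.ae_antitone] with ω h1 h2
      refine bank_ge_of_no_purchase M hC h1.1 h1.2 h2 (u := t) (fun i j hi _ =>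
        cancel_of_notMem (by simp [hS, hi]) i j) (abs_nonneg _) ?_ ht.le le_rfl
      have e : bank M x (cancel S N) ω t = bank M x N ω t := by
        rw [bank, bankState_congr M x fun i s j his hs => hSpath ω i s j (his.trans hs)]; rfl
      rw [e]
      exact neg_abs_le _) hd
  refine ⟨q', hq', by rwa [Function.iterate_add_apply], fun f hf hfd => ?_⟩
  refine NearlyDominated.of_approx fun ε hε => ?_
  obtain ⟨_, ⟨_, ⟨z, hz, c, hc, rfl⟩, N', hN', hag, rfl⟩, hP⟩ := hfd (ε / 2) (by linarith)
  obtain ⟨n, hn⟩ := exists_nat_measure_lt_le (P := P) (hc.mono (M.filtration.le t) le_rfl)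
    (show 0 < ε / 2 by linarith)
  -- follow `N'` only where the multiple of `w` is at most `n`
  classical
  have hset : MeasurableSet[M.filtration t] {ω | c ω ≤ n} :=
    measurableSet_le hc measurable_const
  set κ : Ω → ℕ := fun ω => if c ω ≤ n then 1 else 0 with hκ
  have hκm : Measurable[M.filtration t] κ := Measurable.ite hset measurable_const measurable_const
  set K : ℕ → Positions Ω d := fun m => if m = 0 then N else N' with hK
  have hKs : ∀ m, IsStrategy M (K m) := fun m => by simp only [hK]; split_ifs <;> assumption
  have hKa : ∀ m, Agree P t (K m) (K 0) := fun m => by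
    simp only [hK, if_true]
    split_ifs
    · exact Agree.refl t N
    · exact (hag.mono (Nat.le_succ t)).trans (agree_add_hold t N _)
  have hKpath := glue_path (κ := κ) hKa
  have hgs := isStrategy_glue hκm hKs hKa
  set I : Ω → ℝ≥0 := fun ω => if c ω ≤ n then 1 else 0 with hI
  have hIm : Measurable[M.filtration t] I := Measurable.ite hset measurable_const measurable_const
  refine ⟨terminalWealth M x (glue t κ K), hq'f _ (measurable_terminalWealth hgs x) ?_, ?_⟩
  · filter_upwards [eventually_ge_atTop n] with m hm
    refine hqf m _ (measurable_terminalWealth hgs x) ?_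
    have e : N + hold T t (u m) = (N + hold T t fun j => (I * c) * w j) +
        hold T t fun j => (fun ω => (m : ℝ≥0) - (I * c) ω) * w j := by
      rw [add_assoc, ← hold_add]
      congr 2
      funext j ω
      simp only [hu, Pi.add_apply, Pi.mul_apply]
      rw [← add_mul, add_tsub_cancel_of_le]
      simp only [hI]
      split_ifs with h
      · rw [one_mul]; exact h.trans (by exact_mod_cast hm)
      · simp
    rw [e]
    refine nearlyDominated_pooledWealth_add h𝒞.add_mem
      (hnull.smul h𝒞 (measurable_const.sub (hIm.mul hc))) ?_
    refine NearlyDominated.of_mem ⟨fun j => I * z j, h𝒞.smul_mem z hz I hIm, _, hgs, ?_, rfl⟩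
      (ae_of_all _ fun _ _ => le_rfl)
    filter_upwards [hag, hKpath] with ω h1 h2 i s j his hst
    rw [h2 i s j his]
    by_cases h : c ω ≤ n
    · simp only [hK, hκ, if_pos h, one_ne_zero, if_false, h1 i s j his hst, Pi.add_apply, hold, hI,
        Pi.mul_apply, one_mul]
      split_ifs
      · rw [add_assoc, add_comm (z j ω)]
      · simp
    · simp [hK, hκ, if_neg h, hold, hI]
  · have hsum : ENNReal.ofReal ε = ENNReal.ofReal (ε / 2) + ENNReal.ofReal (ε / 2) := by
      rw [← ENNReal.ofReal_add (by linarith) (by linarith)]; congr 1; ring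
    rw [hsum]
    refine le_trans (measure_mono_ae ?_) ((measure_union_le _ _).trans (add_le_add hP hn))
    filter_upwards [hKpath] with ω h2
    rintro ⟨-, h3⟩
    by_cases h : c ω ≤ n
    · left
      refine ⟨trivial, ?_⟩
      have e : terminalWealth M x (glue t κ K) ω = terminalWealth M x N' ω := by
        rw [terminalWealth, bank, bankState_congr M x (N' := N')]; rfl
        intro i s j his _
        rw [h2 i s j his]
        simp [hK, hκ, if_pos h]
      rw [e] at h3
      linarith
    · exact Or.inr (not_le.mp h)

/-! ### Sequences with bounded purchases -/

theorem convex_terminalWealth_ge (M : Market P T d) {ω : Ω}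
    (hr : ∀ t, 1 ≤ t → t ≤ T → 0 ≤ M.rate t ω) (x v : ℝ) :
    Convex ℝ≥0 {N : Positions Ω d | v ≤ terminalWealth M x N ω} := by
  intro N1 h1 N2 h2 a b _ _ hab
  change v ≤ _ at h1 h2
  change v ≤ terminalWealth M x (a • N1 + b • N2) ω
  have hab' : (a : ℝ) + b = 1 := by exact_mod_cast hab
  have h6 := bank_superlinear M (N := N1) (N' := N2) (N'' := a • N1 + b • N2) (x := x) (x' := x)
    a.2 b.2 hr le_rfl (fun i s j _ _ => by simp)
  have e : (a : ℝ) * x + b * x = x := by rw [← add_mul, hab', one_mul]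
  simp only [NNReal.val_eq_coe, e] at h6
  have h7 := mul_le_mul_of_nonneg_left h1 a.2
  have h8 := mul_le_mul_of_nonneg_left h2 b.2
  simp only [NNReal.val_eq_coe] at h7 h8
  have h9 : (a : ℝ) * v + b * v = v := by rw [← add_mul, hab', one_mul]
  simp only [terminalWealth] at *
  linarith

/-- The positions up to time `t` if `N` is followed before time `t` and its purchase at time `t` is
replaced by `y` on the event `B`, as a linear map. -/
noncomputable def replacePurchase (Ω : Type*) (T d t : ℕ) (B : Set Ω) :
    (Positions Ω d × (Fin d → Ω → ℝ≥0)) →ₗ[ℝ≥0] Positions Ω d where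
  toFun X := scale (fun i _ _ => if i < t then 1 else 0) X.1 +
    hold T t fun j => B.indicator 1 * X.2 j
  map_add' X X' := by
    funext i s j ω
    simp only [scale, hold, Pi.add_apply, Prod.fst_add, Prod.snd_add, Pi.mul_apply]
    split_ifs <;> ring
  map_smul' a X := by
    funext i s j ω
    simp only [scale, hold, Pi.add_apply, Prod.smul_fst, Prod.smul_snd, Pi.mul_apply,
      Pi.smul_apply, smul_eq_mul, RingHom.id_apply]
    split_ifs <;> ring

theorem replacePurchase_of_lt {t : ℕ} {B : Set Ω} (X : Positions Ω d × (Fin d → Ω → ℝ≥0)) {i : ℕ}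
    (hi : i < t) (s : ℕ) (j : Fin d) (ω : Ω) :
    replacePurchase Ω T d t B X i s j ω = X.1 i s j ω := by
  simp [replacePurchase, scale, hold, hi, hi.ne]

theorem replacePurchase_self {t : ℕ} (ht : t < T) {B : Set Ω}
    (X : Positions Ω d × (Fin d → Ω → ℝ≥0)) (j : Fin d) (ω : Ω) :
    replacePurchase Ω T d t B X t t j ω = B.indicator 1 ω * X.2 j ω := by
  simp [replacePurchase, scale, hold, ht]

/-- If, up to elements of a cone, the purchases at time `t` are bounded, then suitable convex
combinations converge. -/
theorem exists_limit_of_bounded [IsProbabilityMeasure P] {M : Market P T d} {x : ℝ} {t : ℕ}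
    (ht : t < T) {𝒞 : Set (Fin d → Ω → ℝ≥0)} (h𝒞 : IsScaleCone M t 𝒞) {ν : Positions Ω d}
    {N : ℕ → Positions Ω d} (hN : ∀ n, IsStrategy M (N n)) (hNν : ∀ n, Agree P t (N n) ν)
    {y z : ℕ → Fin d → Ω → ℝ≥0} (hy : ∀ n j, Measurable[M.filtration t] (y n j))
    (hz : ∀ n, z n ∈ 𝒞) (hyz : ∀ n, ∀ᵐ ω ∂P, ∀ j, N n t t j ω = y n j ω + z n j ω)
    {B : Set Ω} (hB : MeasurableSet[M.filtration t] B)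
    (hbdd : ∀ᵐ ω ∂P, ω ∈ B → ∀ j, BddAbove (Set.range fun n => y n j ω)) {f : Ω → ℝ}
    (hf : Measurable f)
    (hd : EventuallyDominated P B (fun n => terminalWealth M x (N n)) f) :
    ∃ q, IsStrategy M q ∧ Agree P t q ν ∧ NearlyDominated P B (pooledWealth M t 𝒞 x q) f ∧
      ∃ Y : ℕ → Fin d → Ω → ℝ≥0, (∀ n, Y n ∈ convexHull ℝ≥0 (y '' Set.Ici n)) ∧
        ∀ᵐ ω ∂P, ω ∈ B → ∀ j, Tendsto (fun n => Y n j ω) atTop (𝓝 (q t t j ω)) := by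
  -- The purchases at `t` may be unbounded through their part in `𝒞`. `U` retains only what must
  -- converge, the shares bought before `t` and `y` on `B`, while convex combinations are taken of
  -- the pairs `(N n, y n)`.
  set U := replacePurchase Ω T d t B with hU
  set X : ℕ → Positions Ω d × (Fin d → Ω → ℝ≥0) := fun n => (N n, y n) with hX
  have hUs : ∀ X : Positions Ω d × (Fin d → Ω → ℝ≥0), IsStrategy M X.1 →
      (∀ j, Measurable[M.filtration t] (X.2 j)) → IsStrategy M (U X) := fun X h1 h2 =>
    (h1.scale (c := fun i _ _ => if i < t then 1 else 0) fun i _ _ => measurable_const).add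
      (isStrategy_hold M fun j => (Measurable.indicator measurable_const hB).mul (h2 j))
  obtain ⟨Y, hY, hYc⟩ := exists_convexHull_cauchySeq_exp (P := P)
    ((positionsBefore Ω (t + 1) d).comp U) X fun n k =>
      ((hUs (X n) (hN n) (hy n)).adapted _ _ k.1.2.1
        ((Nat.lt_succ_iff.mp k.1.2.2).trans ht.le) k.2).mono (M.filtration.le _) le_rfl
  have hprop : ∀ n, IsStrategy M (Y n).1 ∧ Agree P t (Y n).1 ν ∧
      (∀ j, Measurable[M.filtration t] ((Y n).2 j)) ∧
      ∃ z ∈ 𝒞, ∀ᵐ ω ∂P, ∀ j, (Y n).1 t t j ω = (Y n).2 j ω + z j ω := by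
    intro n
    refine convexHull_min (t := {X : Positions Ω d × (Fin d → Ω → ℝ≥0) |
      IsStrategy M X.1 ∧ Agree P t X.1 ν ∧ (∀ j, Measurable[M.filtration t] (X.2 j)) ∧
      ∃ z ∈ 𝒞, ∀ᵐ ω ∂P, ∀ j, X.1 t t j ω = X.2 j ω + z j ω}) ?_ ?_ (hY n)
    · rintro _ ⟨m, -, rfl⟩
      exact ⟨hN m, hNν m, hy m, z m, hz m, hyz m⟩
    · rintro X1 ⟨a1, b1, c1, z1, hz1, d1⟩ X2 ⟨a2, b2, c2, z2, hz2, d2⟩ a b ha hb hab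
      refine ⟨convex_isStrategy M a1 a2 ha hb hab, convex_agree t ν b1 b2 ha hb hab,
        fun j => ((c1 j).const_mul a).add ((c2 j).const_mul b), _,
        h𝒞.add_mem _ (h𝒞.smul_mem z1 hz1 (fun _ => a) measurable_const) _
          (h𝒞.smul_mem z2 hz2 (fun _ => b) measurable_const), ?_⟩
      filter_upwards [d1, d2] with ω d1 d2 j
      simp only [Prod.fst_add, Prod.snd_add, Prod.smul_fst, Prod.smul_snd, Pi.add_apply,
        Pi.smul_apply, Pi.mul_apply, smul_eq_mul, d1 j, d2 j]
      ring
  choose hYs hYν hYm z' hz' hYz using hprop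
  have hconv : ∀ᵐ ω ∂P, ∀ i s j, i ≤ s → s ≤ t →
      ∃ l : ℝ≥0, Tendsto (fun n => U (Y n) i s j ω) atTop (𝓝 l) := by
    filter_upwards [ae_all_iff.mpr hYc, ae_all_iff.mpr fun n => (hYs n).ae_antitone,
      ae_all_iff.mpr hYν, hbdd] with ω h1 h2 h3 h4 i s j his hst
    refine exists_tendsto_of_cauchySeq_exp (h1 (⟨(i, s), his, Nat.lt_succ_iff.mpr hst⟩, j)) ?_
    suffices H : ∃ b : ℝ≥0, ∀ n, U (Y n) i s j ω ≤ b by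
      obtain ⟨b, hb⟩ := H
      intro h
      obtain ⟨n, hn⟩ := (h.eventually_gt_atTop (b : ℝ)).exists
      exact absurd (NNReal.coe_lt_coe.mp hn) (not_lt.mpr (hb n))
    -- Shares bought before `t` never exceed the purchase in the common past `ν`; those bought at
    -- `t` are bounded by hypothesis on `B` and vanish off it.
    rcases lt_or_ge i t with hit | hit
    · refine ⟨ν i i j ω, fun n => ?_⟩
      rw [hU, replacePurchase_of_lt _ hit]
      have h5 := le_of_antitone_path (h2 n) le_rfl his (hst.trans ht.le) j
      rwa [h3 n i i j le_rfl hit] at h5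
    · obtain rfl : i = t := by omega
      obtain rfl : s = i := by omega
      by_cases hω : ω ∈ B
      · obtain ⟨b, hb⟩ := h4 hω j
        refine ⟨b, fun n => ?_⟩
        rw [hU, replacePurchase_self ht, Set.indicator_of_mem hω, Pi.one_apply, one_mul]
        refine convexHull_min (t := {X : Positions Ω d × (Fin d → Ω → ℝ≥0) | X.2 j ω ≤ b})
          ?_ ?_ (hY n)
        · rintro _ ⟨m, -, rfl⟩
          exact hb ⟨m, rfl⟩
        · intro X1 h1 X2 h2 a c _ _ hac
          change X1.2 j ω ≤ b at h1
          change X2.2 j ω ≤ b at h2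
          change a * X1.2 j ω + c * X2.2 j ω ≤ b
          calc a * X1.2 j ω + c * X2.2 j ω ≤ a * b + c * b :=
                add_le_add (mul_le_mul_right h1 a) (mul_le_mul_right h2 c)
            _ = b := by rw [← add_mul, hac, one_mul]
      · refine ⟨0, fun n => ?_⟩
        rw [hU, replacePurchase_self ht, Set.indicator_of_notMem hω, zero_mul]
  have hUYs : ∀ n, IsStrategy M (U (Y n)) := fun n => hUs _ (hYs n) (hYm n)
  have hq := isStrategy_limitHold ht hUYs hconv
  set q := limitHold T t fun n => U (Y n) with hqdef
  have hYd : EventuallyDominated P B (fun n => terminalWealth M x (Y n).1) f := by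
    filter_upwards [hd, M.ae_rate_nonneg] with ω h1 h2 hω δ hδ
    obtain ⟨n0, hn0⟩ := eventually_atTop.mp (h1 hω δ hδ)
    filter_upwards [eventually_ge_atTop n0] with n hn
    refine convexHull_min (t := {X : Positions Ω d × (Fin d → Ω → ℝ≥0) |
      f ω - δ ≤ terminalWealth M x X.1 ω}) ?_ ?_ (hY n)
    · rintro _ ⟨m, hm, rfl⟩
      exact hn0 m (hn.trans hm)
    · intro X1 a1 X2 a2 a b ha hb hab
      exact convex_terminalWealth_ge M h2 x _ a1 a2 ha hb hab
  have hps : ∀ n, IsStrategy M (q + hold T t (z' n)) := fun n =>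
    hq.add (isStrategy_hold M (h𝒞.measurable _ (hz' n)))
  -- Put the unconverged element `z' n` of `𝒞` back: on `B` the positions of `q` plus this purchase
  -- differ from those of `Y n` by amounts tending to zero.
  have hg := hYd.graft (t := t) (p := fun n => q + hold T t (z' n)) hYs (by
    filter_upwards [hconv, ae_all_iff.mpr hYz] with ω h1 h2 hω i s j his hst
    have h3 := NNReal.tendsto_coe.mpr (limitHold_path ht h1 i s j his hst)
    rw [← hqdef] at h3
    have h4 := h3.const_sub (q i s j ω : ℝ)
    rw [sub_self] at h4
    refine h4.congr fun n => ?_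
    rcases lt_or_ge i t with hit | hit
    · rw [hU, replacePurchase_of_lt _ hit]
      simp [hold, hit.ne]
    · obtain rfl : i = t := by omega
      obtain rfl : s = i := by omega
      rw [hU, replacePurchase_self ht, Set.indicator_of_mem hω, h2 n j]
      simp [hold, ht])
  refine ⟨q, hq, ?_, ?_, fun n => (Y n).2, fun n => ?_, ?_⟩
  · filter_upwards [hconv, ae_all_iff.mpr hYν] with ω h1 h2 i s j his hst
    refine tendsto_nhds_unique (limitHold_path ht h1 i s j his hst.le) ?_
    simp only [hU, replacePurchase_of_lt _ (his.trans_lt hst), h2 _ i s j his hst,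
      tendsto_const_nhds]
  · exact hg.nearlyDominated (M.filtration.le t _ hB) hf
      (fun n => ⟨z' n, hz' n, _, (hps n).graft (hYs n) ht, agree_graft t _ _, rfl⟩)
      fun n => measurable_terminalWealth ((hps n).graft (hYs n) ht) x
  · refine convexHull_min (t := {X : Positions Ω d × (Fin d → Ω → ℝ≥0) |
      X.2 ∈ convexHull ℝ≥0 (y '' Set.Ici n)}) ?_ ?_ (hY n)
    · rintro _ ⟨m, hm, rfl⟩
      exact subset_convexHull _ _ ⟨m, hm, rfl⟩
    · intro X1 h1 X2 h2 a b ha hb hab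
      exact convex_convexHull ℝ≥0 _ h1 h2 ha hb hab
  · filter_upwards [hconv] with ω h1 hω j
    refine (limitHold_path ht h1 t t j le_rfl le_rfl).congr fun n => ?_
    rw [hU, replacePurchase_self ht, Set.indicator_of_mem hω, Pi.one_apply, one_mul]

/-! ### Reduction to bounded purchases -/

theorem NearlyDominated.mono_ae {B B' : Set Ω} {𝒲 : Set (Ω → ℝ)} {f : Ω → ℝ}
    (h : NearlyDominated P B 𝒲 f) (hB : ∀ᵐ ω ∂P, ω ∈ B' → ω ∈ B) :
    NearlyDominated P B' 𝒲 f := fun ε hε => by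
  obtain ⟨W, hW, h1⟩ := h ε hε
  refine ⟨W, hW, (measure_mono_ae ?_).trans h1⟩
  filter_upwards [hB] with ω h2
  rintro ⟨h3, h4⟩
  exact ⟨h2 h3, h4⟩

/-- The pasts agree and `B₁` is known at time `t`, so one may switch between the two strategies at
`t`, and likewise between their continuations. -/
theorem exists_nearlyDominated_union {M : Market P T d} {x : ℝ} {t : ℕ}
    {ν q₁ q₂ : Positions Ω d} (hq₁ : IsStrategy M q₁) (hq₂ : IsStrategy M q₂)
    (hν₁ : Agree P t q₁ ν) (hν₂ : Agree P t q₂ ν) {B₁ B₂ : Set Ω}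
    (hB₁ : MeasurableSet[M.filtration t] B₁) {f : Ω → ℝ}
    (h₁ : NearlyDominated P B₁ (futureWealth M (t + 1) x q₁) f)
    (h₂ : NearlyDominated P B₂ (futureWealth M (t + 1) x q₂) f) :
    ∃ q, IsStrategy M q ∧ Agree P t q ν ∧
      NearlyDominated P (B₁ ∪ B₂) (futureWealth M (t + 1) x q) f := by
  classical
  set κ : Ω → ℕ := fun ω => if ω ∈ B₁ then 0 else 1 with hκ
  have hκm : Measurable[M.filtration t] κ := Measurable.ite hB₁ measurable_const measurable_const
  set S : Positions Ω d → Positions Ω d → ℕ → Positions Ω d :=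
    fun p₁ p₂ m => if m = 0 then p₁ else p₂ with hS
  have hSs : ∀ p₁ p₂, IsStrategy M p₁ → IsStrategy M p₂ → ∀ m, IsStrategy M (S p₁ p₂ m) :=
    fun p₁ p₂ h1 h2 m => by simp only [hS]; split_ifs <;> assumption
  have hSa : ∀ p₁ p₂, Agree P t p₁ ν → Agree P t p₂ ν →
      ∀ m, Agree P t (S p₁ p₂ m) (S p₁ p₂ 0) := fun p₁ p₂ h1 h2 m => by
    simp only [hS, if_true]; split_ifs
    · exact Agree.refl t _
    · exact h2.trans h1.symm
  refine ⟨glue t κ (S q₁ q₂), isStrategy_glue hκm (hSs _ _ hq₁ hq₂) (hSa _ _ hν₁ hν₂),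
    (agree_glue t κ _).trans hν₁, fun ε hε => ?_⟩
  obtain ⟨_, ⟨N₁, s₁, a₁, rfl⟩, p₁⟩ := h₁ (ε / 2) (by linarith)
  obtain ⟨_, ⟨N₂, s₂, a₂, rfl⟩, p₂⟩ := h₂ (ε / 2) (by linarith)
  have b₁ := (a₁.mono (Nat.le_succ t)).trans hν₁
  have b₂ := (a₂.mono (Nat.le_succ t)).trans hν₂
  have hpath := glue_path (κ := κ) (hSa _ _ b₁ b₂)
  refine ⟨_, ⟨glue t κ (S N₁ N₂), isStrategy_glue hκm (hSs _ _ s₁ s₂) (hSa _ _ b₁ b₂), ?_, rfl⟩, ?_⟩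
  · filter_upwards [hpath, glue_path (κ := κ) (hSa _ _ hν₁ hν₂), a₁, a₂] with ω h1 h2 h3 h4 i s j
      his hst
    rw [h1 i s j his, h2 i s j his]
    simp only [hS]
    split_ifs
    · exact h3 i s j his hst
    · exact h4 i s j his hst
  · have hsum : ENNReal.ofReal ε = ENNReal.ofReal (ε / 2) + ENNReal.ofReal (ε / 2) := by
      rw [← ENNReal.ofReal_add (by linarith) (by linarith)]; congr 1; ring
    rw [hsum]
    refine le_trans (measure_mono_ae ?_) ((measure_union_le _ _).trans (add_le_add p₁ p₂))
    filter_upwards [hpath] with ω h1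
    rintro ⟨h2, h3⟩
    have e : terminalWealth M x (glue t κ (S N₁ N₂)) ω =
        terminalWealth M x (S N₁ N₂ (κ ω)) ω := by
      rw [terminalWealth, bank, bankState_congr M x fun i s j his _ => h1 i s j his]; rfl
    rw [e] at h3
    by_cases hω : ω ∈ B₁
    · simp only [hS, hκ, if_pos hω, if_true] at h3
      exact Or.inl ⟨hω, by linarith⟩
    · simp only [hS, hκ, if_neg hω, one_ne_zero, if_false] at h3
      exact Or.inr ⟨h2.resolve_left hω, by linarith⟩

theorem exists_nearlyDominated_biUnion {M : Market P T d} {x : ℝ} {t : ℕ} {ν : Positions Ω d}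
    (hν : IsStrategy M ν) {ι : Type*} (s : Finset ι) {B : ι → Set Ω}
    (hB : ∀ j, MeasurableSet[M.filtration t] (B j)) {f : Ω → ℝ}
    (h : ∀ j ∈ s, ∃ q, IsStrategy M q ∧ Agree P t q ν ∧
      NearlyDominated P (B j) (futureWealth M (t + 1) x q) f) :
    ∃ q, IsStrategy M q ∧ Agree P t q ν ∧
      NearlyDominated P (⋃ j ∈ s, B j) (futureWealth M (t + 1) x q) f := by
  classical
  induction s using Finset.induction_on with
  | empty =>
    exact ⟨ν, hν, Agree.refl t ν, NearlyDominated.of_mem ⟨ν, hν, Agree.refl _ ν, rfl⟩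
      (ae_of_all _ fun ω hω => by simp at hω)⟩
  | insert j s hj ih =>
    obtain ⟨q₁, a1, b1, c1⟩ := h j (Finset.mem_insert_self j s)
    obtain ⟨q₂, a2, b2, c2⟩ := ih fun i hi => h i (Finset.mem_insert_of_mem hi)
    rw [Finset.set_biUnion_insert]
    exact exists_nearlyDominated_union a1 a2 b1 b2 (hB j) c1 c2

/-! ### Elimination of exploding purchases -/

/-- A sequence of strategies whose purchases at time `t` are `y n`, apart from elements of `𝒞`, and
whose wealth asymptotically dominates `f` on `B`. -/
structure IsDominatingSeq (M : Market P T d) (x : ℝ) (t : ℕ) (𝒞 : Set (Fin d → Ω → ℝ≥0))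
    (ν : Positions Ω d) (B : Set Ω) (f : Ω → ℝ) (N : ℕ → Positions Ω d)
    (y z : ℕ → Fin d → Ω → ℝ≥0) : Prop where
  strategy : ∀ n, IsStrategy M (N n)
  agree : ∀ n, Agree P t (N n) ν
  measurable : ∀ n j, Measurable[M.filtration t] (y n j)
  mem : ∀ n, z n ∈ 𝒞
  purchase : ∀ n, ∀ᵐ ω ∂P, ∀ j, N n t t j ω = y n j ω + z n j ω
  dominated : EventuallyDominated P B (fun n => terminalWealth M x (N n)) f

/-- Passing to a random subsequence chosen with the information at time `t`; indices with `n ≤ κ n`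
preserve asymptotic domination. -/
theorem IsDominatingSeq.reindex {M : Market P T d} {x : ℝ} {t : ℕ} {𝒞 : Set (Fin d → Ω → ℝ≥0)}
    (h𝒞 : IsScaleCone M t 𝒞) {ν : Positions Ω d} {B : Set Ω} {f : Ω → ℝ} {N : ℕ → Positions Ω d}
    {y z : ℕ → Fin d → Ω → ℝ≥0} (h : IsDominatingSeq M x t 𝒞 ν B f N y z) {B' : Set Ω}
    (hB' : B' ⊆ B) {κ : ℕ → Ω → ℕ} (hκ : ∀ n, Measurable[M.filtration t] (κ n))
    (hle : ∀ ω ∈ B', ∀ n, n ≤ κ n ω) :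
    IsDominatingSeq M x t 𝒞 ν B' f (fun n => glue t (κ n) N) (fun n j ω => y (κ n ω) j ω)
      (fun n j ω => z (κ n ω) j ω) := by
  have ha : ∀ n, Agree P t (N n) (N 0) := fun n => (h.agree n).trans (h.agree 0).symm
  have hpath : ∀ n, ∀ᵐ ω ∂P, ∀ i s j, i ≤ s → glue t (κ n) N i s j ω = N (κ n ω) i s j ω :=
    fun n => glue_path ha
  refine ⟨fun n => isStrategy_glue (hκ n) h.strategy ha, fun n => (agree_glue t _ N).trans (h.agree 0),
    fun n j => measurable_glue (hκ n) fun m => h.measurable m j,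
    fun n => h𝒞.glue_mem z h.mem _ (hκ n), fun n => ?_, ?_⟩
  · filter_upwards [hpath n, ae_all_iff.mpr h.purchase] with ω h1 h2 j
    rw [h1 t t j le_rfl]
    exact h2 _ j
  · filter_upwards [ae_all_iff.mpr hpath, h.dominated] with ω h1 h2 hω δ hδ
    obtain ⟨n0, hn0⟩ := eventually_atTop.mp (h2 (hB' hω) δ hδ)
    filter_upwards [eventually_ge_atTop n0] with n hn
    have e : terminalWealth M x (glue t (κ n) N) ω = terminalWealth M x (N (κ n ω)) ω := by
      rw [terminalWealth, bank, bankState_congr M x fun i s j his _ => h1 n i s j his]; rfl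
    rw [e]
    exact hn0 _ (hn.trans (hle ω hω n))

/-- Take the smallest admissible index; outside `B` every index is declared admissible to make the
choice total. -/
theorem exists_measurable_selection {m : MeasurableSpace Ω} {B : Set Ω} (hB : MeasurableSet[m] B)
    {S : ℕ → ℕ → Set Ω} (hS : ∀ k l, MeasurableSet[m] (S k l))
    (h : ∀ ω ∈ B, ∀ k, ∃ l, k ≤ l ∧ ω ∈ S k l) :
    ∃ κ : ℕ → Ω → ℕ, (∀ k, Measurable[m] (κ k)) ∧
      ∀ ω ∈ B, ∀ k, k ≤ κ k ω ∧ ω ∈ S k (κ k ω) := by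
  classical
  have hex : ∀ k ω, ∃ l, (k ≤ l ∧ ω ∈ S k l) ∨ ω ∉ B := by
    intro k ω
    by_cases hω : ω ∈ B
    · obtain ⟨l, hl⟩ := h ω hω k
      exact ⟨l, Or.inl hl⟩
    · exact ⟨0, Or.inr hω⟩
  refine ⟨fun k ω => Nat.find (hex k ω), fun k => ?_, fun ω hω k => ?_⟩
  · refine @measurable_find _ m _ _ (hex k) fun l => ?_
    exact MeasurableSet.union ((MeasurableSet.const (k ≤ l)).inter (hS k l)) hB.compl
  · exact (Nat.find_spec (hex k ω)).resolve_right (not_not.mpr hω)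

/-- The largest multiple of `w` that can be subtracted from `y`. -/
noncomputable def maxMultiple (y w : Fin d → ℝ≥0) : ℝ≥0 :=
  (⨅ j, if w j = 0 then (∞ : ℝ≥0∞) else ((y j / w j : ℝ≥0) : ℝ≥0∞)).toNNReal

theorem maxMultiple_mul_le (y w : Fin d → ℝ≥0) (j : Fin d) : maxMultiple y w * w j ≤ y j := by
  by_cases h : w j = 0
  · simp [h]
  · have h1 : (⨅ j, if w j = 0 then (∞ : ℝ≥0∞) else ((y j / w j : ℝ≥0) : ℝ≥0∞)) ≤
        ((y j / w j : ℝ≥0) : ℝ≥0∞) := by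
      refine (iInf_le _ j).trans ?_
      rw [if_neg h]
    have h2 := ENNReal.toNNReal_mono ENNReal.coe_ne_top h1
    rw [ENNReal.toNNReal_coe] at h2
    exact (mul_le_mul_left h2 (w j)).trans (div_mul_cancel₀ _ h).le

/-- Coordinates with `w j = 0` contribute `∞`, so the minimal ratio is attained on the support of
`w`. -/
theorem exists_maxMultiple_mul_eq {y w : Fin d → ℝ≥0} (h : ∃ j, w j ≠ 0) :
    ∃ j, w j ≠ 0 ∧ maxMultiple y w * w j = y j := by
  obtain ⟨j0, h0⟩ := h
  have : Nonempty (Fin d) := ⟨j0⟩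
  obtain ⟨j, hj⟩ := exists_eq_ciInf_of_finite
    (f := fun j => if w j = 0 then (∞ : ℝ≥0∞) else ((y j / w j : ℝ≥0) : ℝ≥0∞))
  have hne : w j ≠ 0 := by
    intro hj0
    rw [if_pos hj0] at hj
    have h1 := iInf_le (fun j => if w j = 0 then (∞ : ℝ≥0∞) else ((y j / w j : ℝ≥0) : ℝ≥0∞)) j0
    rw [← hj, if_neg h0] at h1
    exact absurd h1 (not_le.mpr ENNReal.coe_lt_top)
  refine ⟨j, hne, ?_⟩
  rw [if_neg hne] at hj
  rw [maxMultiple, ← hj, ENNReal.toNNReal_coe]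
  exact div_mul_cancel₀ _ hne

theorem measurable_maxMultiple {m : MeasurableSpace Ω} {y w : Fin d → Ω → ℝ≥0}
    (hy : ∀ j, Measurable[m] (y j)) (hw : ∀ j, Measurable[m] (w j)) :
    Measurable[m] fun ω => maxMultiple (fun j => y j ω) fun j => w j ω := by
  refine ENNReal.measurable_toNNReal.comp (Measurable.iInf fun j => ?_)
  exact Measurable.ite (hw j (measurableSet_singleton 0)) measurable_const
    (measurable_coe_nnreal_ennreal.comp ((hy j).div (hw j)))

theorem pooledWealth_congr {M : Market P T d} {t : ℕ} {𝒞 : Set (Fin d → Ω → ℝ≥0)} {x : ℝ}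
    {N N' : Positions Ω d} (h : Agree P (t + 1) N N') :
    pooledWealth M t 𝒞 x N = pooledWealth M t 𝒞 x N' := by
  ext W
  exact ⟨fun ⟨z, hz, K, h1, h2, h3⟩ => ⟨z, hz, K, h1, h2.trans (h.add (Agree.refl _ _)), h3⟩,
    fun ⟨z, hz, K, h1, h2, h3⟩ => ⟨z, hz, K, h1, h2.trans (h.symm.add (Agree.refl _ _)), h3⟩⟩

/-- If the purchases tend to infinity, then the normalized purchases have a limit point, and it is
a null direction. -/
theorem IsDominatingSeq.exists_nullDirection [IsProbabilityMeasure P] {M : Market P T d} {x : ℝ}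
    {t : ℕ} (ht : t < T) {𝒞 : Set (Fin d → Ω → ℝ≥0)} (h𝒞 : IsScaleCone M t 𝒞)
    {ν : Positions Ω d} {A : Set Ω} (hA : MeasurableSet[M.filtration t] A) {f : Ω → ℝ}
    {N : ℕ → Positions Ω d} {y z : ℕ → Fin d → Ω → ℝ≥0}
    (h : IsDominatingSeq M x t 𝒞 ν A f N y z)
    (hinf : ∀ ω ∈ A, ∀ n : ℕ, (n : ℝ≥0) + 1 ≤ ∑ j, y n j ω) :
    ∃ w : Fin d → Ω → ℝ≥0, (∀ j, Measurable[M.filtration t] (w j)) ∧ NullDirection M t 𝒞 w ∧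
      ∀ᵐ ω ∂P, ω ∈ A → (∑ j, w j ω = 1 ∧ ∀ j, (∀ n, y n j ω = 0) → w j ω = 0) := by
  -- Normalizing factors: on `A` they give the purchases total size one, and `hinf` makes them at
  -- most `1 / (n + 1)`.
  set c : ℕ → Ω → ℝ≥0 := fun n => A.indicator fun ω => (∑ j, y n j ω)⁻¹ with hc
  have hcm : ∀ n, Measurable[M.filtration t] (c n) := fun n =>
    Measurable.indicator ((Finset.measurable_sum _ fun j _ => h.measurable n j).inv) hA
  have hcy : ∀ n j ω, c n ω * y n j ω ≤ 1 := by
    intro n j ω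
    by_cases hω : ω ∈ A
    · simp only [hc, Set.indicator_of_mem hω]
      rw [inv_mul_le_iff₀ (lt_of_lt_of_le (by positivity) (hinf ω hω n)), mul_one]
      exact Finset.single_le_sum (f := fun j => y n j ω) (fun _ _ => zero_le) (Finset.mem_univ j)
    · simp [hc, Set.indicator_of_notMem hω]
  have hcA : ∀ ω ∈ A, ∀ n, (c n ω : ℝ) ≤ 1 / ((n : ℝ) + 1) := by
    intro ω hω n
    simp only [hc, Set.indicator_of_mem hω, NNReal.coe_inv]
    rw [← one_div]
    exact one_div_le_one_div_of_le (by positivity) (by exact_mod_cast hinf ω hω n)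
  have hs := fun n => (h.strategy n).scaleFrom (hcm n)
  have hdom : EventuallyDominated P Set.univ
      (fun n => terminalWealth M 0 (scaleFrom t (c n) (N n))) 0 := by
    filter_upwards [h.dominated, M.ae_rate_nonneg, ae_all_iff.mpr h.agree,
      ae_all_iff.mpr fun n => (h.strategy n).ae_antitone] with ω h1 h2 h3 h4 _ δ hδ
    by_cases hω : ω ∈ A
    · obtain ⟨C, hC, hL⟩ := abs_bank_sub_le M ω T
      set D : ℝ := |x| + ∑ i ∈ Finset.range t, ∑ j : Fin d, (ν i i j ω : ℝ) with hD
      have hD0 : 0 ≤ ∑ i ∈ Finset.range t, ∑ j : Fin d, (ν i i j ω : ℝ) := by positivity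
      -- Scaling by `c n` makes the bound `f - 1` negligible. Discarding the scaled initial capital
      -- and earlier positions, of size at most `c n * D`, costs at most `C * (c n * D)`, which
      -- vanishes too.
      have hlim : Tendsto (fun n : ℕ => 1 / ((n : ℝ) + 1) * |f ω - 1 - C * D|) atTop (𝓝 0) := by
        simpa using tendsto_one_div_add_atTop_nhds_zero_nat.mul_const |f ω - 1 - C * D|
      filter_upwards [h1 hω 1 one_pos, hlim.eventually_le_const hδ] with n hn hn'
      have h6 := bank_superlinear M (N := N n) (N' := N n) (N'' := c n ω • N n) (x := x)
        (x' := 0) (a := c n ω) (b := 0) (c n ω).2 le_rfl h2 le_rfl (fun i s j his hs => by simp)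
      have h7 := hL (c n ω • N n) (scaleFrom t (c n) (N n)) (c n ω * x + 0 * 0) 0 (c n ω * D)
        (by
          rw [mul_zero, add_zero, sub_zero, abs_mul, abs_of_nonneg (NNReal.coe_nonneg (c n ω))]
          exact mul_le_mul_of_nonneg_left (by rw [hD]; linarith) (c n ω).2)
        (fun i s j his hs => by
          simp only [scaleFrom, scale, Pi.smul_apply, smul_eq_mul, NNReal.coe_mul]
          split_ifs with hti
          · simp only [sub_self, abs_zero]
            have := abs_nonneg x
            positivity
          · rw [Pi.zero_apply, NNReal.coe_zero, zero_mul, sub_zero, abs_of_nonneg (by positivity)]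
            refine mul_le_mul_of_nonneg_left ?_ (c n ω).2
            have e1 := le_of_antitone_path (h4 n) le_rfl his hs j
            rw [h3 n i i j le_rfl (not_le.mp hti)] at e1
            have e2 : (ν i i j ω : ℝ) ≤ ∑ j : Fin d, (ν i i j ω : ℝ) :=
              Finset.single_le_sum (f := fun j => (ν i i j ω : ℝ)) (fun _ _ => NNReal.coe_nonneg _)
                (Finset.mem_univ j)
            have e3 : ∑ j : Fin d, (ν i i j ω : ℝ) ≤
                ∑ i ∈ Finset.range t, ∑ j : Fin d, (ν i i j ω : ℝ) :=
              Finset.single_le_sum (f := fun i => ∑ j : Fin d, (ν i i j ω : ℝ))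
                (fun _ _ => by positivity) (Finset.mem_range.mpr (not_le.mp hti))
            have e4 : (N n i s j ω : ℝ) ≤ ν i i j ω := by exact_mod_cast e1
            linarith [abs_nonneg x])
      have h8 := (abs_le.mp h7).2
      have h9 := mul_le_mul_of_nonneg_left hn (c n ω).2
      have h10 : -((c n ω : ℝ) * |f ω - 1 - C * D|) ≤ c n ω * (f ω - 1 - C * D) := by
        rw [← mul_neg]
        exact mul_le_mul_of_nonneg_left (neg_abs_le _) (c n ω).2
      have h11 := mul_le_mul_of_nonneg_right (hcA ω hω n) (abs_nonneg (f ω - 1 - C * D))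
      have h12 : (c n ω : ℝ) * (f ω - 1 - C * D) = c n ω * (f ω - 1) - C * (c n ω * D) := by ring
      simp only [NNReal.val_eq_coe] at h9
      simp only [terminalWealth, Pi.zero_apply, zero_mul, add_zero, mul_zero] at *
      linarith
    · refine Eventually.of_forall fun n => ?_
      have h6 := bank_superlinear M (N := N n) (N' := N n) (N'' := scaleFrom t (c n) (N n))
        (x := 0) (x' := 0) (a := 0) (b := 0) (ω := ω) le_rfl le_rfl h2 le_rfl
        (fun i s j his hs => by
          simp only [scaleFrom, scale]
          split_ifs <;> simp [hc, Set.indicator_of_notMem hω])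
      simp only [zero_mul, add_zero] at h6
      simp only [terminalWealth, Pi.zero_apply]
      linarith
  obtain ⟨q, hq, hq0, hqd, Y, hY, hYq⟩ := exists_limit_of_bounded (x := 0) (f := 0) (ν := 0)
    (B := Set.univ) ht h𝒞 hs
    (fun n => ae_of_all _ fun ω i s j his hst => by
      simp only [scaleFrom, scale]
      rw [if_neg (by omega)]; simp)
    (y := fun n j => c n * y n j) (fun n j => (hcm n).mul (h.measurable n j))
    (fun n => h𝒞.smul_mem _ (h.mem n) _ (hcm n))
    (fun n => by
      filter_upwards [h.purchase n] with ω h1 j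
      simp only [scaleFrom, scale, le_refl, if_true, h1 j, Pi.mul_apply, mul_add])
    (@MeasurableSet.univ _ (M.filtration t))
    (ae_of_all _ fun ω _ j => ⟨1, by rintro _ ⟨n, rfl⟩; exact hcy n j ω⟩)
    measurable_const hdom
  refine ⟨q t t, hq.adapted t t le_rfl ht.le, ?_, ?_⟩
  · unfold NullDirection
    rwa [pooledWealth_congr (N' := q)]
    filter_upwards [hq0, hq.eq_zero_of_agree_zero hq0] with ω h1 h2 i s j his hst
    simp only [hold]
    split_ifs with h3
    · rw [show i = t by omega, show s = t by omega]
    · rcases lt_or_ge i t with hit | hit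
      · exact (h2 i s j his (by omega) hit).symm
      · omega
  · filter_upwards [hYq] with ω h1 hω
    have h1 := h1 trivial
    refine ⟨?_, fun j hj => ?_⟩
    · refine tendsto_nhds_unique (tendsto_finsetSum _ fun j _ => h1 j) ?_
      have e : ∀ n, ∑ j, Y n j ω = 1 := by
        intro n
        refine convexHull_min (t := {v : Fin d → Ω → ℝ≥0 | ∑ j, v j ω = 1}) ?_ ?_ (hY n)
        · rintro _ ⟨m, -, rfl⟩
          change ∑ j, c m ω * y m j ω = 1
          rw [← Finset.mul_sum]
          simp only [hc, Set.indicator_of_mem hω]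
          exact inv_mul_cancel₀ (lt_of_lt_of_le (by positivity) (hinf ω hω m)).ne'
        · intro v1 e1 v2 e2 a b _ _ hab
          change ∑ j, v1 j ω = 1 at e1
          change ∑ j, v2 j ω = 1 at e2
          change ∑ j, (a * v1 j ω + b * v2 j ω) = 1
          rw [Finset.sum_add_distrib, ← Finset.mul_sum, ← Finset.mul_sum, e1, e2, mul_one, mul_one,
            hab]
      simp only [e, tendsto_const_nhds]
    · refine tendsto_nhds_unique (h1 j) ?_
      have e : ∀ n, Y n j ω = 0 := by
        intro n
        refine convexHull_min (t := {v : Fin d → Ω → ℝ≥0 | v j ω = 0}) ?_ ?_ (hY n)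
        · rintro _ ⟨m, -, rfl⟩
          change c m ω * y m j ω = 0
          rw [hj m, mul_zero]
        · intro v1 e1 v2 e2 a b _ _ hab
          change v1 j ω = 0 at e1
          change v2 j ω = 0 at e2
          change a * v1 j ω + b * v2 j ω = 0
          rw [e1, e2, mul_zero, mul_zero, add_zero]
      simp only [e, tendsto_const_nhds]

/-- Induction on the number of coordinates of `y` not yet known to vanish. Each elimination enlarges
the cone by one null direction, at the price of `k + 1` further reactions; this explains the
exponent. -/
theorem exists_nearlyDominated_of_isDominatingSeq [IsProbabilityMeasure P] {M : Market P T d}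
    {x C : ℝ} {R : ReactionFunction M} (hR : IsSubstitution M x R) {t k : ℕ} (ht : t < T)
    (hC : 0 ≤ C) (hreg : ∀ᵐ ω ∂P, RegularAt M C ω) (hatt : Attains M x R (t + 1) k)
    {ν : Positions Ω d} (hν : IsStrategy M ν) {f : Ω → ℝ} (hf : Measurable f) (m : ℕ)
    {𝒞 : Set (Fin d → Ω → ℝ≥0)} (h𝒞 : IsScaleCone M t 𝒞) {l : ℕ}
    (hl : IsAttainableCone M x R t l 𝒞) {Z : Finset (Fin d)} (hZ : Zᶜ.card = m) {B : Set Ω}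
    (hB : MeasurableSet[M.filtration t] B) {N : ℕ → Positions Ω d} {y z : ℕ → Fin d → Ω → ℝ≥0}
    (h : IsDominatingSeq M x t 𝒞 ν B f N y z)
    (hyZ : ∀ᵐ ω ∂P, ω ∈ B → ∀ n, ∀ j ∈ Z, y n j ω = 0) :
    ∃ q, IsStrategy M q ∧ Agree P t q (R.apply^[m * (k + 1) + l] ν) ∧
      NearlyDominated P B (futureWealth M (t + 1) x q) f := by
  induction m generalizing 𝒞 l Z B N y z with
  | zero =>
    have hZu : ∀ j, j ∈ Z := fun j => by
      by_contra hj
      exact absurd (Finset.card_eq_zero.mp hZ)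
        (Finset.ne_empty_of_mem (Finset.mem_compl.mpr hj))
    obtain ⟨q, hq, hqν, hqd, -⟩ := exists_limit_of_bounded ht h𝒞 h.strategy h.agree h.measurable
      h.mem h.purchase hB (by
        filter_upwards [hyZ] with ω h1 hω j
        exact ⟨0, by rintro _ ⟨n, rfl⟩; exact (h1 hω n j (hZu j)).le⟩) hf h.dominated
    obtain ⟨q', h1, h2, h3⟩ := hl.exists_nearlyDominated hq hqd
    refine ⟨q', h1, ?_, h3⟩
    rw [zero_mul, zero_add]
    exact h2.trans (hqν.iterate R l)
  | succ m ih =>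
    have hsum : ∀ n, Measurable[M.filtration t] fun ω => ∑ j, y n j ω := fun n =>
      Finset.measurable_sum _ fun j _ => h.measurable n j
    -- the event on which the purchases are unbounded
    set A : Set Ω := B ∩ ⋂ n : ℕ, ⋃ i : ℕ, ⋃ (_ : n ≤ i), {ω | (n : ℝ≥0) + 1 ≤ ∑ j, y i j ω}
      with hAdef
    have hA : MeasurableSet[M.filtration t] A := hB.inter (MeasurableSet.iInter fun n =>
      MeasurableSet.iUnion fun i => MeasurableSet.iUnion fun _ =>
        measurableSet_le measurable_const (hsum i))
    have hAB : A ⊆ B := Set.inter_subset_left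
    have hAex : ∀ ω ∈ A, ∀ n : ℕ, ∃ i, n ≤ i ∧ ω ∈ {ω | (n : ℝ≥0) + 1 ≤ ∑ j, y i j ω} := by
      intro ω hω n
      obtain ⟨i, hi⟩ := Set.mem_iUnion.mp (Set.mem_iInter.mp hω.2 n)
      obtain ⟨hni, hi⟩ := Set.mem_iUnion.mp hi
      exact ⟨i, hni, hi⟩
    have hbdd : ∀ ω ∈ B \ A, ∀ j, BddAbove (Set.range fun n => y n j ω) := by
      rintro ω ⟨hωB, hωA⟩ j
      have h1 : ∃ n : ℕ, ∀ i, n ≤ i → ∑ j, y i j ω < (n : ℝ≥0) + 1 := by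
        by_contra hcon
        push Not at hcon
        refine hωA ⟨hωB, Set.mem_iInter.mpr fun n => ?_⟩
        obtain ⟨i, hi, hle⟩ := hcon n
        exact Set.mem_iUnion.mpr ⟨i, Set.mem_iUnion.mpr ⟨hi, hle⟩⟩
      obtain ⟨n, hn⟩ := h1
      have h2 : ∀ i, y i j ω ≤ ∑ j, y i j ω := fun i =>
        Finset.single_le_sum (f := fun j => y i j ω) (fun _ _ => zero_le) (Finset.mem_univ j)
      refine ⟨(n : ℝ≥0) + 1 + ∑ i ∈ Finset.range n, y i j ω, ?_⟩
      rintro _ ⟨i, rfl⟩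
      rcases lt_or_ge i n with hi | hi
      · exact (Finset.single_le_sum (f := fun i => y i j ω) (fun _ _ => zero_le)
          (Finset.mem_range.mpr hi)).trans le_add_self
      · exact (h2 i).trans ((hn i hi).le.trans le_self_add)
    have hBA : MeasurableSet[M.filtration t] (B \ A) := hB.diff hA
    have hbounded : ∃ q, IsStrategy M q ∧ Agree P t q (R.apply^[(m + 1) * (k + 1) + l] ν) ∧
        NearlyDominated P (B \ A) (futureWealth M (t + 1) x q) f := by
      obtain ⟨q, hq, hqν, hqd, -⟩ := exists_limit_of_bounded ht h𝒞 h.strategy h.agree h.measurable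
        h.mem h.purchase hBA (ae_of_all _ hbdd) hf (by
          filter_upwards [h.dominated] with ω h1 hω using h1 hω.1)
      obtain ⟨q', h1, h2, h3⟩ := hl.exists_nearlyDominated hq hqd
      -- Superfluous reactions are applied so that the past matches the one obtained on the
      -- unbounded event, as gluing requires.
      refine ⟨_, h1.iterate R ((m + 1) * (k + 1)), ?_,
        nearlyDominated_futureWealth_iterate hR.le _ h3⟩
      rw [Function.iterate_add_apply]
      exact (h2.trans (hqν.iterate R l)).iterate R _
    obtain ⟨κ, hκm, hκ⟩ := exists_measurable_selection hA
      (fun n i => measurableSet_le measurable_const (hsum i)) hAex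
    have hseq := h.reindex h𝒞 hAB hκm fun ω hω n => (hκ ω hω n).1
    obtain ⟨w, hwm, hwnull, hw⟩ := hseq.exists_nullDirection ht h𝒞 hA fun ω hω n => (hκ ω hω n).2
    set 𝒞' := adjoin M t 𝒞 w with h𝒞'
    have h𝒞'c : IsScaleCone M t 𝒞' := h𝒞.adjoin hwm
    have hl' : IsAttainableCone M x R t (k + 1 + l) 𝒞' :=
      hl.adjoin hR ht hC hreg hatt h𝒞 hwm hwnull
    -- subtract the largest multiple of the null direction
    set s : ℕ → Ω → ℝ≥0 := fun n ω => maxMultiple (fun j => y (κ n ω) j ω) fun j => w j ω with hs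
    have hsm : ∀ n, Measurable[M.filtration t] (s n) := fun n =>
      measurable_maxMultiple (hseq.measurable n) hwm
    set y' : ℕ → Fin d → Ω → ℝ≥0 := fun n j ω => y (κ n ω) j ω - s n ω * w j ω with hy'
    have hseq' : IsDominatingSeq M x t 𝒞' ν A f (fun n => glue t (κ n) N) y'
        (fun n j => (fun ω => z (κ n ω) j ω) + s n * w j) := by
      refine ⟨hseq.strategy, hseq.agree,
        fun n j => (hseq.measurable n j).sub ((hsm n).mul (hwm j)),
        fun n => ⟨_, hseq.mem n, s n, hsm n, rfl⟩, fun n => ?_, hseq.dominated⟩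
      filter_upwards [hseq.purchase n] with ω h1 j
      rw [h1 j]
      simp only [hy', Pi.add_apply, Pi.mul_apply]
      have h2 : s n ω * w j ω ≤ y (κ n ω) j ω :=
        maxMultiple_mul_le (fun j => y (κ n ω) j ω) (fun j => w j ω) j
      rw [add_comm (z (κ n ω) j ω), ← add_assoc, tsub_add_cancel_of_le h2]
    -- On `D j` the coordinate `j` of the reduced purchases vanishes infinitely often, hence always
    -- along a measurable random subsequence.
    set D : Fin d → Set Ω := fun j => A ∩ ⋂ n : ℕ, ⋃ i : ℕ, ⋃ (_ : n ≤ i), {ω | y' i j ω = 0}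
      with hD
    have hDm : ∀ j, MeasurableSet[M.filtration t] (D j) := fun j => hA.inter
      (MeasurableSet.iInter fun n => MeasurableSet.iUnion fun i => MeasurableSet.iUnion fun _ =>
        hseq'.measurable i j (measurableSet_singleton 0))
    have hDA : ∀ j, D j ⊆ A := fun j => Set.inter_subset_left
    have hDq : ∀ j ∈ Zᶜ, ∃ q, IsStrategy M q ∧
        Agree P t q (R.apply^[(m + 1) * (k + 1) + l] ν) ∧
        NearlyDominated P (D j) (futureWealth M (t + 1) x q) f := by
      intro j hj
      have hDex : ∀ ω ∈ D j, ∀ n : ℕ, ∃ i, n ≤ i ∧ ω ∈ {ω | y' i j ω = 0} := by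
        intro ω hω n
        obtain ⟨i, hi⟩ := Set.mem_iUnion.mp (Set.mem_iInter.mp hω.2 n)
        obtain ⟨hni, hi⟩ := Set.mem_iUnion.mp hi
        exact ⟨i, hni, hi⟩
      obtain ⟨κ', hκm', hκ'⟩ := exists_measurable_selection (hDm j)
        (S := fun _ i => {ω | y' i j ω = 0})
        (fun _ i => hseq'.measurable i j (measurableSet_singleton 0)) hDex
      have hseq'' := hseq'.reindex h𝒞'c (hDA j) hκm' fun ω hω n => (hκ' ω hω n).1
      have hcard : (insert j Z)ᶜ.card = m := by
        rw [Finset.compl_insert, Finset.card_erase_of_mem hj, hZ, Nat.add_sub_cancel]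
      obtain ⟨q, h1, h2, h3⟩ := ih h𝒞'c hl' hcard (hDm j) hseq'' (by
        filter_upwards [hyZ] with ω h1 hω n i hi
        rcases Finset.mem_insert.mp hi with rfl | hi
        · exact (hκ' ω hω n).2
        · simp only [hy', h1 (hAB (hDA j hω)) _ i hi, zero_tsub])
      refine ⟨q, h1, ?_, h3⟩
      rwa [show (m + 1) * (k + 1) + l = m * (k + 1) + (k + 1 + l) by ring]
    obtain ⟨q₁, a1, b1, c1⟩ := hbounded
    obtain ⟨q₂, a2, b2, c2⟩ := exists_nearlyDominated_biUnion (hν.iterate R _) Zᶜ hDm hDq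
    obtain ⟨q, a, b, c⟩ := exists_nearlyDominated_union a1 a2 b1 b2 hBA c1 c2
    refine ⟨q, a, b, c.mono_ae ?_⟩
    filter_upwards [hw, hyZ] with ω h1 h2 hω
    by_cases hωA : ω ∈ A
    swap
    · exact Or.inl ⟨hω, hωA⟩
    refine Or.inr ?_
    obtain ⟨h3, h4⟩ := h1 hωA
    have hwne : ∃ j, w j ω ≠ 0 := by
      by_contra hcon
      push Not at hcon
      simp [hcon] at h3
    by_contra hcon
    -- Pigeonhole: outside all `D j` with `j ∉ Z`, no such coordinate vanishes beyond some index,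
    -- yet the maximal subtraction annihilates one at every index. That coordinate is outside `Z`
    -- because `w` vanishes on `Z`.
    have h5 : ∀ j, ∃ n : ℕ, j ∈ Zᶜ → ∀ i, n ≤ i → y' i j ω ≠ 0 := by
      intro j
      by_contra hj
      push Not at hj
      refine hcon (Set.mem_iUnion₂.mpr ⟨j, (hj 0).1, hωA, Set.mem_iInter.mpr fun n => ?_⟩)
      obtain ⟨-, i, hi, h6⟩ := hj n
      exact Set.mem_iUnion₂.mpr ⟨i, hi, h6⟩
    choose n hn using h5
    obtain ⟨j, hj, hj'⟩ := exists_maxMultiple_mul_eq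
      (y := fun j => y (κ (∑ j, n j) ω) j ω) (w := fun j => w j ω) hwne
    have hjZ : j ∈ Zᶜ := by
      rw [Finset.mem_compl]
      exact fun hjZ => hj (h4 j fun n => h2 hω _ j hjZ)
    refine hn j hjZ (∑ j, n j) (Finset.single_le_sum (f := n) (fun _ _ => Nat.zero_le _)
      (Finset.mem_univ j)) ?_
    simp only [hy', hs]
    rw [hj', tsub_self]

/-! ### Closedness -/

/-- The elimination starts with the trivial cone and all `d` coordinates, which fixes the positions
through time `t`; the induction hypothesis then attains the future. -/
theorem Attains.of_succ [IsProbabilityMeasure P] {M : Market P T d} {x C : ℝ}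
    {R : ReactionFunction M} (hR : IsSubstitution M x R) {t k : ℕ} (ht : t < T)
    (hC : 0 ≤ C) (hreg : ∀ᵐ ω ∂P, RegularAt M C ω) (hatt : Attains M x R (t + 1) k) :
    Attains M x R t (k + d * (k + 1)) := by
  intro ν hν f hf hd
  obtain ⟨W, hW, hWd⟩ := NearlyDominated.exists_seq (𝒲 := fun _ => _) fun _ : ℕ => hd
  choose N hN hag hWN using hW
  obtain rfl : W = fun n => terminalWealth M x (N n) := funext hWN
  obtain ⟨q, hq, hqν, hqd⟩ := exists_nearlyDominated_of_isDominatingSeq hR ht hC hreg hatt hν hf d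
    (isScaleCone_zero M t) (isAttainableCone_zero M x R t) (Z := ∅) (by simp)
    (@MeasurableSet.univ _ (M.filtration t)) (N := N) (y := fun n => N n t t) (z := fun _ => 0)
    ⟨hN, hag, fun n => (hN n).adapted t t le_rfl ht.le, fun _ => rfl,
      fun n => ae_of_all _ fun ω j => by simp, hWd⟩ (by simp)
  obtain ⟨N', h1, h2, h3⟩ := hatt q hq f hf hqd
  refine ⟨N', h1, ?_, h3⟩
  rw [Function.iterate_add_apply]
  exact (h2.mono (Nat.le_succ t)).trans (hqν.iterate R k)

/-- Liquidation leaves only one continuation at `T`, so near domination is domination. -/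
theorem attains_horizon (M : Market P T d) (x : ℝ) (R : ReactionFunction M) : Attains M x R T 0 := by
  intro ν hν f hf hd
  refine ⟨ν, hν, Agree.refl T ν, ?_⟩
  obtain ⟨W, hW, hWd⟩ := NearlyDominated.exists_seq (𝒲 := fun _ => _) fun _ : ℕ => hd
  choose N hN hag hWN using hW
  filter_upwards [hWd, ae_all_iff.mpr hag, hν.ae_liquidated,
    ae_all_iff.mpr fun n => (hN n).ae_liquidated] with ω h1 h2 h3 h4
  refine le_of_forall_pos_sub_le fun δ hδ => ?_
  obtain ⟨n, hn⟩ := (h1 trivial δ hδ).exists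
  have e : terminalWealth M x (N n) ω = terminalWealth M x ν ω := by
    rw [terminalWealth, bank, bankState_congr M x (N' := ν)]; rfl
    intro i s j his hs
    rcases hs.lt_or_eq with hs | rfl
    · exact h2 n i s j his hs
    · rw [h4 n i j his, h3 i j his]
  rwa [hWN n, e] at hn

theorem exists_attains_zero [IsProbabilityMeasure P] {M : Market P T d} {x C : ℝ}
    {R : ReactionFunction M} (hR : IsSubstitution M x R) (hC : 0 ≤ C)
    (hreg : ∀ᵐ ω ∂P, RegularAt M C ω) : ∃ k, Attains M x R 0 k :=
  Nat.decreasingInduction (motive := fun t _ => ∃ k, Attains M x R t k)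
    (fun _ ht ⟨_, hk⟩ => ⟨_, hk.of_succ hR ht hC hreg⟩) ⟨0, attains_horizon M x R⟩ (Nat.zero_le T)

/-- Provides an `𝓕_T`-measurable version of the limit, which the discarded amount `Y` in
`attainable` must respect. -/
theorem exists_measurable_ae_eq_of_tendsto {m : MeasurableSpace Ω} {F : ℕ → Ω → ℝ}
    (hF : ∀ n, Measurable[m] (F n)) {g : Ω → ℝ}
    (h : ∀ᵐ ω ∂P, Tendsto (fun n => F n ω) atTop (𝓝 (g ω))) :
    ∃ g', Measurable[m] g' ∧ ∀ᵐ ω ∂P, g ω = g' ω := by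
  refine ⟨fun ω => (limsup (fun n => (F n ω : EReal)) atTop).toReal,
    measurable_ereal_toReal.comp (Measurable.limsup fun n => measurable_coe_real_ereal.comp (hF n)),
    ?_⟩
  filter_upwards [h] with ω hω
  have h1 : Tendsto (fun n => (F n ω : EReal)) atTop (𝓝 (g ω : EReal)) :=
    (continuous_coe_real_ereal.tendsto _).comp hω
  simp only [h1.limsup_eq, EReal.toReal_coe]

theorem isClosedInProbability_attainable [IsProbabilityMeasure P] {M : Market P T d} {x C : ℝ}
    {R : ReactionFunction M} (hR : IsSubstitution M x R) (hC : 0 ≤ C)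
    (hreg : ∀ᵐ ω ∂P, RegularAt M C ω) : IsClosedInProbability (attainable M x) := by
  intro f g hf hfg
  choose N hN Y hY hfY using hf
  obtain ⟨k, hk⟩ := exists_attains_zero hR hC hreg
  -- At time `0` every strategy continues every other one, so `N 0` is an arbitrary reference.
  have hd : NearlyDominated P Set.univ (futureWealth M 0 x (N 0)) g := by
    intro ε hε
    have h1 := hfg (ENNReal.ofReal ε) (by simpa using hε)
    obtain ⟨n, hn⟩ := (h1.eventually_le_const (u := ENNReal.ofReal ε) (by simpa using hε)).exists
    refine ⟨_, ⟨N n, hN n, ae_of_all _ fun ω i s j _ hs => absurd hs (Nat.not_lt_zero s), rfl⟩,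
      (measure_mono_ae ?_).trans hn⟩
    filter_upwards [hfY n] with ω h2
    rintro ⟨-, h3⟩
    change ENNReal.ofReal ε ≤ edist (f n ω) (g ω)
    rw [edist_dist, Real.dist_eq]
    refine ENNReal.ofReal_le_ofReal ?_
    have h4 : (0 : ℝ) ≤ Y n ω := NNReal.coe_nonneg _
    rw [abs_sub_comm]
    exact le_trans (by linarith) (le_abs_self _)
  obtain ⟨N', hN', -, hle⟩ := hk (N 0) (hN 0) g g.measurable hd
  obtain ⟨ns, -, hns⟩ := hfg.exists_seq_tendsto_ae
  have hV : ∀ {N}, IsStrategy M N → Measurable[M.filtration T] (terminalWealth M x N) :=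
    fun h => measurable_bank M h x le_rfl
  obtain ⟨g', hg', hgg'⟩ := exists_measurable_ae_eq_of_tendsto (m := M.filtration T) (P := P)
    (F := fun n ω => terminalWealth M x (N (ns n)) ω - Y (ns n) ω)
    (fun n => (hV (hN _)).sub (measurable_coe_nnreal_real.comp (hY _))) (g := g) (by
      filter_upwards [hns, ae_all_iff.mpr hfY] with ω h1 h2
      simpa only [h2] using h1)
  refine ⟨N', hN', fun ω => (terminalWealth M x N' ω - g' ω).toNNReal,
    measurable_real_toNNReal.comp ((hV hN').sub hg'), ?_⟩
  filter_upwards [hle, hgg'] with ω h1 h2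
  rw [Real.coe_toNNReal _ (by linarith)]
  linarith

end TaxModel

theorem mainTheorem1 {Ω : Type*} [MeasurableSpace Ω] (P : Measure Ω) [IsProbabilityMeasure P]
    (T d : ℕ) (M : TaxModel.Market P T d)
    (hNUIBR : TaxModel.NUIBR M)
    (hprice : ∀ t, t ≤ T → ∀ j, ∀ᵐ ω ∂P, 0 ≤ M.price t j ω)
    (hrate : ∀ t, 1 ≤ t → t ≤ T → ∃ C : ℝ, ∀ᵐ ω ∂P, |M.rate t ω| ≤ C) (x : ℝ) :
    TaxModel.IsClosedInProbability (TaxModel.attainable M x) := by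
  obtain ⟨R, hle, hbd⟩ := hNUIBR x
  obtain ⟨C, hC, hreg⟩ := TaxModel.exists_ae_regularAt M hprice hrate
  exact TaxModel.isClosedInProbability_attainable (R := R) ⟨hle, hbd⟩ hC hreg
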